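/- **Setting.** Let $K\ge 2$ and let $\nu_1,\dots,\nu_K$ be probability distributions on $[0,1]$ with means $\mu_1,\dots,\mu_K$; the rewards $X_{a,1},X_{a,2},\dots$ of successive pulls of arm $a$ are i.i.d. with law $\nu_a$, independently over arms. Let $\Delta_a=\max_k\mu_k-\mu_a$. Let $\epsilon\in(0,1)$. A function $f:[0,1]\to[0,\infty)$ is an $\epsilon$-gap function if $f=0$ on $[0,\epsilon]$ and $f>0$ on $(\epsilon,1]$. The lenient regret of a bandit algorithm that plays arm $a_t$ in round $t$ is $R_f(T)=\mathbb E\big[\sum_{t=1}^T f(\Delta_{a_t})\big]$. For $p,q\in[0,1]$ let $d(p,q)=p\ln\frac pq+(1-p)\ln\frac{1-p}{1-q}$, with $d(p,q)=\infty$ if $p<1,\ q=1$ or $p>0,\ q=0$, and $1/\infty=0$. *Algorithm $\epsilon$-TS.* Every observed reward $X\in[0,1]$ is first replaced by an independent Bernoulli variable of mean $X$ (for Bernoulli arms nothing changes). Let $N_a(t)$ be the number of pulls of arm $a$ before round $t$, $S_a(t)$ the sum of its rounded rewards before round $t$, and $\hat\mu_a(t)=S_a(t)/N_a(t)$ ($=0$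 if $N_a(t)=0$). In round $t$, for every arm $a$: if $\hat\mu_a(t)>1-\epsilon$, put $\theta_a(t)=\hat\mu_a(t)$; otherwise draw, independently of everything else given the past, $\theta_a(t)=(1-\epsilon)Y$ with $Y\sim\mathrm{Beta}(\alpha,\,N_a(t)+2-\alpha)$, $\alpha=\lfloor S_a(t)/(1-\epsilon)\rfloor+1$. Then play $a_t\in\arg\max_a\theta_a(t)$, ties being broken uniformly at random. **Theorem.** There are constants $b=b(\mu_1,\mu_2,\epsilon)\in(0,1)$, $C_b=C_b(K,\mu_1,\mu_2,\epsilon)<\infty$, $L_1=L_1(\mu_1,\epsilon,b)$, $L_2=L_2(b,\epsilon)\ge2$ and $x_{a,c}=x_{a,c}(\mu_1,\mu_a,\epsilon)$ (for $c>0$), depending only on the indicated quantities (and, for $x_{a,c}$, on $c$), such that the following holds for all $K\ge2$, all $\epsilon\in(0,1)$, all arm distributions on $[0,1]$ whose means satisfy $\mu_1-\epsilon>\mu_2\ge\dots\ge\mu_K$, every $\epsilon$-gap function $f$ and every $T\ge1$, where $R_f(T)$ is the lenient regret of $\epsilon$-TS. 1. If $\mu_1>1-\epsilon$, then $$R_f(T)\le\sum_{a=2}^K\frac{f(\Delta_a)}{d(1-\epsilon,\mu_a)}+\max_a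 f(\Delta_a)\Big(C_b+L_1+\frac{\pi^2/6}{d(1-\epsilon,\mu_1)}\Big),$$ a bound that does not depend on $T$. Here $(t-1)^b\ge\frac{2\ln t}{d(1-\epsilon,\mu_1)}+1$ for all integers $t\ge L_1$, $t\ge 1$. 2. If $\mu_1\le1-\epsilon$, then for every $c>0$, with $\eta(t)=\max\big\{\mu_1-\epsilon,\ \mu_1-2\sqrt{6\ln t/t^{b}}\big\}$, $$R_f(T)\le\sum_{a=2}^K f(\Delta_a)\Big[(1+c)^2\max_{1\le t\le T}\frac{\ln t}{d\big(\frac{\mu_a}{1-\epsilon},\frac{\eta(t)}{1-\epsilon}\big)}+2+\frac1c+\frac1{d(x_{a,c},\mu_a)}\Big]+\max_a f(\Delta_a)\,(C_b+L_2+6).$$ Here $\eta(t)>\mu_1-\epsilon$ for all integers $t\ge L_2$, and $x_{a,c}\in(\mu_a,\mu_1-\epsilon)$ is the solution of $d\big(\frac{x_{a,c}}{1-\epsilon},\frac{\mu_1-\epsilon}{1-\epsilon}\big)=\frac1{1+c}\,d\big(\frac{\mu_a}{1-\epsilon},\frac{\mu_1-\epsilon}{1-\epsilon}\big)$. -/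

import Mathlib

open MeasureTheory ProbabilityTheory

namespace EpsTS

noncomputable section

/-- Kullback–Leibler divergence `d(p, q)` between Bernoulli distributions with means `p, q ∈ [0, 1]`,
with value `∞` if `p < 1` and `q ≥ 1`, or if `p > 0` and `q = 0`. -/
def klBer (p q : ℝ) : ENNReal :=
  open Classical in
  if (p < 1 ∧ 1 ≤ q) ∨ (0 < p ∧ q ≤ 0) then ⊤
  else ENNReal.ofReal (p * Real.log (p / q) + (1 - p) * Real.log ((1 - p) / (1 - q)))

/-- The real number `1 / d(p, q)`, with the convention `1 / ∞ = 0`. -/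
def invKL (p q : ℝ) : ℝ := ((klBer p q)⁻¹).toReal

/-- `f : [0, 1] → [0, ∞)` is an `ε`-gap function (values of `f` off `[0, 1]` are irrelevant). -/
structure IsGapFunction (ε : ℝ) (f : ℝ → ℝ) : Prop where
  eq_zero : ∀ x ∈ Set.Icc 0 ε, f x = 0
  pos : ∀ x ∈ Set.Ioc ε 1, 0 < f x

/-- The mean `μ_a` of arm `a`. -/
def armMean {K : ℕ} (ν : Fin K → Measure ℝ) (a : Fin K) : ℝ := ∫ x, x ∂(ν a)

/-- The gap `Δ_a = max_k μ_k - μ_a` of arm `a`. -/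
def gap {K : ℕ} (ν : Fin K → Measure ℝ) (a : Fin K) : ℝ := (⨆ k, armMean ν k) - armMean ν a

/-- Names of the primitive random variables driving a bandit problem played by `ε`-TS.
Arms are `0, …, K - 1` and rounds are `t = 0, 1, …` (so `t` is the round number minus one). -/
inductive Seed (K : ℕ) : Type
  /-- the reward of the `(n+1)`-st pull of arm `a` -/
  | reward (a : Fin K) (n : ℕ)
  /-- the coin used to round that reward to `0` or `1` -/
  | coin (a : Fin K) (n : ℕ)
  /-- the fresh Beta variate of round `t` for arm `a`, used if its parameters are `α, β` -/
  | posterior (t : ℕ) (a : Fin K) (α β : ℕ)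
  /-- the priority mark of arm `a` in round `t`, used to break ties -/
  | tie (t : ℕ) (a : Fin K)

/-- The primitive random variables: they are mutually independent, rewards of arm `a` have law
`ν a`, coins and priority marks are uniform on `[0, 1]`, and posterior variates with parameters
`α, β` have law `Beta(α, β)`. -/
structure IsSeed {K : ℕ} {Ω : Type*} [MeasurableSpace Ω] (P : Measure Ω)
    (ν : Fin K → Measure ℝ) (ξ : Seed K → Ω → ℝ) : Prop where
  measurable : ∀ s, Measurable (ξ s)
  indep : iIndepFun ξ P
  reward : ∀ a n, HasLaw (ξ (.reward a n)) (ν a) P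
  coin : ∀ a n, HasLaw (ξ (.coin a n)) (volume.restrict (Set.Icc (0 : ℝ) 1)) P
  posterior : ∀ t a α β, 0 < α → 0 < β →
    HasLaw (ξ (.posterior t a α β)) (betaMeasure (α : ℝ) (β : ℝ)) P
  tie : ∀ t a, HasLaw (ξ (.tie t a)) (volume.restrict (Set.Icc (0 : ℝ) 1)) P

/-- The reward of the `(n+1)`-st pull of arm `a`, randomly rounded to `0` or `1` (given the reward
`X ∈ [0, 1]`, it is `1` with probability `X`). If `X ∈ {0, 1}`, this is almost surely `X` itself. -/
def bit {K : ℕ} (z : Seed K → ℝ) (a : Fin K) (n : ℕ) : ℕ :=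
  open Classical in if z (.coin a n) < z (.reward a n) then 1 else 0

/-- The sum of the first `n` (rounded) rewards of arm `a`. -/
def successes {K : ℕ} (z : Seed K → ℝ) (a : Fin K) (n : ℕ) : ℕ :=
  ∑ k ∈ Finset.range n, bit z a k

/-- The mean of the first `n` (rounded) rewards of arm `a`; it is `0` for `n = 0`. -/
def empMean {K : ℕ} (z : Seed K → ℝ) (a : Fin K) (n : ℕ) : ℝ := (successes z a n : ℝ) / n

/-- The parameter `α_a = ⌊S_a / (1 - ε)⌋ + 1` after `n` pulls of arm `a`. -/
def alpha {K : ℕ} (ε : ℝ) (z : Seed K → ℝ) (a : Fin K) (n : ℕ) : ℕ :=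
  ⌊(successes z a n : ℝ) / (1 - ε)⌋₊ + 1

/-- The index `θ_a` of arm `a` in round `t` after `n` pulls of this arm: the empirical mean if it
exceeds `1 - ε`, and a sample of `(1 - ε) Beta(α_a, n + 2 - α_a)` otherwise. (In the second case
`α_a ≤ n + 1`, so that the subtraction does not truncate and both parameters are positive.) -/
def theta {K : ℕ} (ε : ℝ) (z : Seed K → ℝ) (t : ℕ) (a : Fin K) (n : ℕ) : ℝ :=
  open Classical in
  if 1 - ε < empMean z a n then empMean z a n
  else (1 - ε) * z (.posterior t a (alpha ε z a n) (n + 2 - alpha ε z a n))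

/-- The elements of `s` at which `g` is maximal over `s`. -/
def argmaxSet {K : ℕ} (g : Fin K → ℝ) (s : Finset (Fin K)) : Finset (Fin K) :=
  open Classical in s.filter (fun a => ∀ b ∈ s, g b ≤ g a)

theorem argmaxSet_nonempty {K : ℕ} (g : Fin K → ℝ) {s : Finset (Fin K)} (hs : s.Nonempty) :
    (argmaxSet g s).Nonempty := by
  obtain ⟨a, ha, h⟩ := s.exists_max_image g hs
  exact ⟨a, by simp only [argmaxSet, Finset.mem_filter]; exact ⟨ha, h⟩⟩

/-- Among the maximizers of `θ`, the arm of highest priority `w`. Independent uniform priorities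
are almost surely distinct, so that the choice is uniform among the maximizers of `θ`. -/
def select {K : ℕ} [NeZero K] (θ w : Fin K → ℝ) : Fin K :=
  (argmaxSet w (argmaxSet θ Finset.univ)).min'
    (argmaxSet_nonempty w (argmaxSet_nonempty θ Finset.univ_nonempty))

/-- `pulls ε z t a` is the number of pulls of arm `a` in the first `t` rounds of `ε`-TS. -/
def pulls {K : ℕ} [NeZero K] (ε : ℝ) (z : Seed K → ℝ) : ℕ → Fin K → ℕ
  | 0 => fun _ => 0
  | t + 1 => fun a => pulls ε z t a +
      if select (fun k => theta ε z t k (pulls ε z t k)) (fun k => z (.tie t k)) = a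
      then 1 else 0

/-- The arm played by `ε`-TS in round `t` (rounds are numbered from `0`). -/
def action {K : ℕ} [NeZero K] (ε : ℝ) (z : Seed K → ℝ) (t : ℕ) : Fin K :=
  select (fun k => theta ε z t k (pulls ε z t k)) (fun k => z (.tie t k))

/-- The lenient regret `R_f(T) = 𝔼[∑_{t ≤ T} f(Δ_{a_t})]` of `ε`-TS. -/
def lenientRegret {K : ℕ} [NeZero K] {Ω : Type*} [MeasurableSpace Ω] (P : Measure Ω)
    (ν : Fin K → Measure ℝ) (ξ : Seed K → Ω → ℝ) (ε : ℝ) (f : ℝ → ℝ) (T : ℕ) : ℝ :=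
  ∫ ω, ∑ t ∈ Finset.range T, f (gap ν (action ε (fun s => ξ s ω) t)) ∂P

/-- The threshold `η(t) = max {μ₁ - ε, μ₁ - 2 √(6 ln t / t ^ b)}`. -/
def eta (ε b μ₁ : ℝ) (t : ℕ) : ℝ :=
  max (μ₁ - ε) (μ₁ - 2 * Real.sqrt (6 * Real.log t / (t : ℝ) ^ b))

end

end EpsTS

/-!
Call a round stalling if all indices `θ_a`, `a ≠ 0`, are at most a fixed `y ∈ (μ₂, μ₁ - ε)`, yet the
best arm `0` is not played. If arm `0` has few pulls in `t` rounds, then either another arm is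
played with an index above `y` although it has been pulled a number of times linear in `t`, which
is exponentially unlikely, or arm `0` stalls for at least `m` rounds at one of its pull counts `k`.
After `j` successes in `k` pulls, its posterior sample is at most `y` with probability `1 - p`,
where `p` is the distribution function of the binomial law with parameters `k + 1`,
`y / (1 - ε)` at `⌊j / (1 - ε)⌋`. Hence the exponential of `p` times the number of stalling rounds
is a supermartingale, stopped when arm `0` is played, and `m` stalling rounds have probability at
most `𝔼 [exp (-p m)]`. This is `O(m ^ (-γ))` with `γ > 1` because `y / (1 - ε) < μ₁`: the samples
are scaled by `1 - ε`. So the probability that arm `0` has at most `t ^ b` pulls in `t` rounds is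
summable for a suitable `b > 0`.

Once the best arm has `t ^ b` pulls, its index exceeds `1 - ε` (if `μ₁ > 1 - ε`) or `η(t)` (if
`μ₁ ≤ 1 - ε`) up to summable probabilities. In the first case a suboptimal arm can be played only
if its own empirical mean exceeds `1 - ε`, which happens boundedly often in expectation. In the
second case its posterior sample must reach `η(t)`; by Chernoff's inequality this is unlikely after
`(1 + c) ^ 2 ln T / d(μ_a / (1 - ε), η / (1 - ε))` pulls, unless its empirical mean exceeds
`x_{a,c}`.
-/

namespace EpsTS

open scoped ENNReal

/-! ### Binomial tails and Beta laws -/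

/-- The probability that a binomial variable with parameters `n, q` equals `j`, as a polynomial
function of `q : ℝ`. -/
noncomputable def binomPmf (n : ℕ) (q : ℝ) (j : ℕ) : ℝ := n.choose j * q ^ j * (1 - q) ^ (n - j)

/-- The probability that a binomial variable with parameters `n, q` is at most `i`. -/
noncomputable def binomCdf (n : ℕ) (q : ℝ) (i : ℕ) : ℝ :=
  ∑ j ∈ Finset.range (i + 1), binomPmf n q j

lemma binomPmf_nonneg {q : ℝ} (hq0 : 0 ≤ q) (hq1 : q ≤ 1) (n j : ℕ) : 0 ≤ binomPmf n q j := by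
  have : 0 ≤ 1 - q := sub_nonneg.2 hq1
  unfold binomPmf
  positivity

lemma binomPmf_eq_eval_bernstein (n : ℕ) (q : ℝ) (j : ℕ) :
    binomPmf n q j = (bernsteinPolynomial ℝ n j).eval q := by
  simp [binomPmf, bernsteinPolynomial]

lemma binomPmf_eq_zero_of_lt {n j : ℕ} (h : n < j) (q : ℝ) : binomPmf n q j = 0 := by
  simp [binomPmf, Nat.choose_eq_zero_of_lt h]

lemma sum_range_binomPmf (n : ℕ) (q : ℝ) : ∑ j ∈ Finset.range (n + 1), binomPmf n q j = 1 := by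
  simp_rw [binomPmf_eq_eval_bernstein]
  rw [← Polynomial.eval_finsetSum, bernsteinPolynomial.sum, Polynomial.eval_one]

lemma sum_range_mul_binomPmf (n : ℕ) (q : ℝ) :
    ∑ j ∈ Finset.range (n + 1), (j : ℝ) * binomPmf n q j = n * q := by
  have h := congrArg (Polynomial.eval q) (bernsteinPolynomial.sum_smul ℝ n)
  rw [Polynomial.eval_finsetSum] at h
  simpa [binomPmf_eq_eval_bernstein] using h

lemma binomPmf_succ_zero (n : ℕ) (q : ℝ) : binomPmf (n + 1) q 0 = (1 - q) * binomPmf n q 0 := by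
  simp [binomPmf, pow_succ']

lemma binomPmf_succ_succ (n : ℕ) (q : ℝ) (j : ℕ) :
    binomPmf (n + 1) q (j + 1) = (1 - q) * binomPmf n q (j + 1) + q * binomPmf n q j := by
  rcases lt_trichotomy n j with h | rfl | h
  · rw [binomPmf_eq_zero_of_lt h, binomPmf_eq_zero_of_lt (by lia),
      binomPmf_eq_zero_of_lt (by lia)]
    ring
  · rw [binomPmf_eq_zero_of_lt n.lt_succ_self]
    simp [binomPmf, pow_succ']
  · obtain ⟨d, rfl⟩ : ∃ d, n = j + 1 + d := ⟨n - (j + 1), by lia⟩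
    simp only [binomPmf, Nat.choose_succ_succ (j + 1 + d) j,
      show j + 1 + d + 1 - (j + 1) = d + 1 by lia, show j + 1 + d - (j + 1) = d by lia,
      show j + 1 + d - j = d + 1 by lia]
    push_cast
    ring

lemma sum_range_exp_mul_binomPmf (n : ℕ) (q l : ℝ) :
    ∑ j ∈ Finset.range (n + 1), Real.exp (l * j) * binomPmf n q j =
      (1 - q + q * Real.exp l) ^ n := by
  rw [add_comm (1 - q), add_pow]
  refine Finset.sum_congr rfl fun j _ => ?_
  rw [mul_comm l, Real.exp_nat_mul, binomPmf, mul_pow]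
  ring

lemma sum_binomPmf_le_exp_mul_mgf {n : ℕ} {q : ℝ} (hq0 : 0 ≤ q) (hq1 : q ≤ 1) {l y : ℝ}
    {S : Finset ℕ} (hS : ∀ j ∈ S, l * y ≤ l * j) :
    ∑ j ∈ S, binomPmf n q j ≤ Real.exp (-(l * y)) * (1 - q + q * Real.exp l) ^ n := by
  have hpmf := binomPmf_nonneg hq0 hq1 n
  rw [← sum_range_exp_mul_binomPmf, Finset.mul_sum]
  calc ∑ j ∈ S, binomPmf n q j
      ≤ ∑ j ∈ S, Real.exp (-(l * y)) * (Real.exp (l * j) * binomPmf n q j) := by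
        refine Finset.sum_le_sum fun j hj => ?_
        rw [← mul_assoc, ← Real.exp_add]
        exact le_mul_of_one_le_left (hpmf j) (Real.one_le_exp (by linarith [hS j hj]))
    _ ≤ ∑ j ∈ S ∪ Finset.range (n + 1),
          Real.exp (-(l * y)) * (Real.exp (l * j) * binomPmf n q j) :=
        Finset.sum_le_sum_of_subset_of_nonneg Finset.subset_union_left fun j _ _ =>
          mul_nonneg (Real.exp_pos _).le (mul_nonneg (Real.exp_pos _).le (hpmf j))
    _ = _ := (Finset.sum_subset Finset.subset_union_right fun j _ hj => by
        rw [binomPmf_eq_zero_of_lt (by simpa using hj), mul_zero, mul_zero]).symm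

lemma bernoulli_mgf_le_exp {q : ℝ} (hq0 : 0 ≤ q) (hq1 : q ≤ 1) (l : ℝ) :
    1 - q + q * Real.exp l ≤ Real.exp (l * q + l ^ 2 / 8) := by
  let μ : Measure ℝ := bernoulliMeasure 1 0 ⟨q, hq0, hq1⟩
  have integral_μ (g : ℝ → ℝ) : ∫ x, g x ∂μ = q * g 1 + (1 - q) * g 0 := by
    simp [μ, integral_bernoulliMeasure]
  have mem_Icc : ∀ᵐ x ∂μ, id x ∈ Set.Icc (0 : ℝ) 1 :=
    (mem_ae_iff_prob_eq_one measurableSet_Icc).2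
      (bernoulliMeasure_apply_of_mem_of_mem _ measurableSet_Icc (by simp) (by simp))
  have hoeffding := (hasSubgaussianMGF_of_mem_Icc aemeasurable_id mem_Icc).mgf_le l
  rw [mgf, integral_μ, integral_μ] at hoeffding
  calc 1 - q + q * Real.exp l
      = Real.exp (l * q) *
          (q * Real.exp (l * (1 - q)) + (1 - q) * Real.exp (l * (0 - q))) := by
        rw [mul_add, mul_left_comm, ← Real.exp_add, mul_left_comm, ← Real.exp_add]
        ring_nf
        simp
        ring
    _ ≤ Real.exp (l * q) * Real.exp (l ^ 2 / 8) := by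
        refine mul_le_mul_of_nonneg_left ?_ (Real.exp_pos _).le
        simp only [id, mul_one, mul_zero, add_zero] at hoeffding
        refine hoeffding.trans_eq ?_
        simp
        ring
    _ = _ := (Real.exp_add _ _).symm

/-- Hoeffding's inequality for both tails at once: the upper one for `0 ≤ s`, the lower one for
`s ≤ 0`. -/
lemma sum_binomPmf_le_exp_neg_sq {n : ℕ} {q s : ℝ} (hq0 : 0 ≤ q) (hq1 : q ≤ 1) {S : Finset ℕ}
    (hS : ∀ j ∈ S, s * (n * (q + s)) ≤ s * j) :
    ∑ j ∈ S, binomPmf n q j ≤ Real.exp (-(2 * n * s ^ 2)) := by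
  have : 0 ≤ 1 - q + q * Real.exp (4 * s) :=
    add_nonneg (sub_nonneg.2 hq1) (mul_nonneg hq0 (Real.exp_pos _).le)
  calc ∑ j ∈ S, binomPmf n q j
      ≤ Real.exp (-(4 * s * (n * (q + s)))) * (1 - q + q * Real.exp (4 * s)) ^ n :=
        sum_binomPmf_le_exp_mul_mgf hq0 hq1 fun j hj => by linarith [hS j hj]
    _ ≤ Real.exp (-(4 * s * (n * (q + s)))) * Real.exp (4 * s * q + (4 * s) ^ 2 / 8) ^ n := by
        gcongr
        exact bernoulli_mgf_le_exp hq0 hq1 _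
    _ = _ := by
        rw [← Real.exp_nat_mul, ← Real.exp_add]
        ring_nf

/-- The Bernoulli divergence `d(p, q)` as a real number; `Real.log 0 = 0` and division by zero make
it agree with `klBer` only where the latter is finite. -/
noncomputable def klReal (p q : ℝ) : ℝ :=
  p * Real.log (p / q) + (1 - p) * Real.log ((1 - p) / (1 - q))

lemma exp_mul_mgf_eq_exp_neg_klReal {x q : ℝ} (hx0 : 0 < x) (hx1 : x < 1) (hq0 : 0 < q)
    (hq1 : q < 1) {l : ℝ} (hl : l = Real.log (x / q) - Real.log ((1 - x) / (1 - q))) :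
    Real.exp (-(l * x)) * (1 - q + q * Real.exp l) = Real.exp (-klReal x q) := by
  have hx1' : 0 < 1 - x := sub_pos.2 hx1
  have hq1' : 0 < 1 - q := sub_pos.2 hq1
  have mgf_eq : 1 - q + q * Real.exp l = Real.exp (-Real.log ((1 - x) / (1 - q))) := by
    rw [hl, Real.exp_sub, Real.exp_neg, Real.exp_log (by positivity), Real.exp_log (by positivity)]
    field_simp
    ring
  rw [mgf_eq, ← Real.exp_add, hl, klReal]
  ring_nf

/-- Chernoff's inequality for both tails at once: the upper one for `q < x`, the lower one for
`x < q`. -/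
lemma sum_binomPmf_le_exp_neg_klReal {n : ℕ} {x q : ℝ} (hx0 : 0 < x) (hx1 : x < 1) (hq0 : 0 < q)
    (hq1 : q < 1) {S : Finset ℕ} (hS : ∀ j ∈ S, (x - q) * (n * x) ≤ (x - q) * j) :
    ∑ j ∈ S, binomPmf n q j ≤ Real.exp (-(n * klReal x q)) := by
  have hx1' : 0 < 1 - x := sub_pos.2 hx1
  have hq1' : 0 < 1 - q := sub_pos.2 hq1
  obtain ⟨l, hl⟩ : ∃ l, l = Real.log (x / q) - Real.log ((1 - x) / (1 - q)) := ⟨_, rfl⟩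
  have tilt (j : ℕ) (hj : j ∈ S) : l * (n * x) ≤ l * j := by
    rcases lt_trichotomy x q with hxq | rfl | hqx
    · have : l ≤ 0 := by
        rw [hl, sub_nonpos]
        refine Real.log_le_log (by positivity) ?_
        rw [div_le_div_iff₀ hq0 hq1']
        nlinarith
      exact mul_le_mul_of_nonpos_left ((mul_le_mul_left_of_neg (sub_neg.2 hxq)).1 (hS j hj)) this
    · simp [hl, div_self hx0.ne', div_self hx1'.ne']
    · have : 0 ≤ l := by
        rw [hl, sub_nonneg]
        refine Real.log_le_log (by positivity) ?_
        rw [div_le_div_iff₀ hq1' hq0]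
        nlinarith
      exact mul_le_mul_of_nonneg_left (le_of_mul_le_mul_left (hS j hj) (sub_pos.2 hqx)) this
  refine (sum_binomPmf_le_exp_mul_mgf hq0.le hq1.le tilt).trans_eq ?_
  rw [← mul_neg (n : ℝ), Real.exp_nat_mul, ← exp_mul_mgf_eq_exp_neg_klReal hx0 hx1 hq0 hq1 hl,
    mul_pow, ← Real.exp_nat_mul]
  ring_nf

lemma binomCdf_nonneg {q : ℝ} (hq0 : 0 ≤ q) (hq1 : q ≤ 1) (n i : ℕ) : 0 ≤ binomCdf n q i :=
  Finset.sum_nonneg fun j _ => binomPmf_nonneg hq0 hq1 n j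

lemma binomCdf_succ (n : ℕ) (q : ℝ) (i : ℕ) :
    binomCdf n q (i + 1) = binomCdf n q i + binomPmf n q (i + 1) :=
  Finset.sum_range_succ _ _

lemma binomPmf_le_binomCdf {n i j : ℕ} {q : ℝ} (hq0 : 0 ≤ q) (hq1 : q ≤ 1) (hji : j ≤ i) :
    binomPmf n q j ≤ binomCdf n q i :=
  Finset.single_le_sum (fun l _ => binomPmf_nonneg hq0 hq1 n l) (Finset.mem_range.2 (by lia))

lemma one_sub_binomCdf (n : ℕ) (q : ℝ) (i : ℕ) :
    1 - binomCdf n q i = ∑ j ∈ Finset.Ico (i + 1) (n + 1), binomPmf n q j := by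
  rw [sub_eq_iff_eq_add', binomCdf]
  rcases le_total (i + 1) (n + 1) with h | h
  · rw [Finset.sum_range_add_sum_Ico _ h, sum_range_binomPmf]
  · rw [Finset.Ico_eq_empty_of_le h, Finset.sum_empty, add_zero,
      ← Finset.sum_range_add_sum_Ico _ h, sum_range_binomPmf, Finset.sum_eq_zero, add_zero]
    exact fun j hj => binomPmf_eq_zero_of_lt (by have := Finset.mem_Ico.1 hj; lia) q

lemma one_sub_binomCdf_le {n i : ℕ} {q : ℝ} (hq0 : 0 ≤ q) (hq1 : q ≤ 1) :
    1 - binomCdf n q i ≤ n * q / (i + 1) := by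
  rw [one_sub_binomCdf, le_div_iff₀ (by positivity), ← sum_range_mul_binomPmf, Finset.sum_mul]
  calc ∑ j ∈ Finset.Ico (i + 1) (n + 1), binomPmf n q j * (i + 1)
      ≤ ∑ j ∈ Finset.Ico (i + 1) (n + 1), j * binomPmf n q j := by
        refine Finset.sum_le_sum fun j hj => ?_
        rw [mul_comm]
        refine mul_le_mul_of_nonneg_right ?_ (binomPmf_nonneg hq0 hq1 n j)
        exact_mod_cast (Finset.mem_Ico.1 hj).1
    _ ≤ _ := Finset.sum_le_sum_of_subset_of_nonneg
        (fun j hj => Finset.mem_range.2 (Finset.mem_Ico.1 hj).2) fun j _ _ =>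
          mul_nonneg j.cast_nonneg (binomPmf_nonneg hq0 hq1 n j)

lemma hasDerivAt_binomCdf (n : ℕ) (q : ℝ) (i : ℕ) :
    HasDerivAt (fun q => binomCdf (n + 1) q i) (-((n + 1) * binomPmf n q i)) q := by
  induction i with
  | zero =>
    have h := (bernsteinPolynomial ℝ (n + 1) 0).hasDerivAt q
    rw [bernsteinPolynomial.derivative_zero] at h
    simp only [binomCdf, binomPmf_eq_eval_bernstein, zero_add, Finset.sum_range_one]
    refine h.congr_deriv ?_
    simp
    ring
  | succ i ih =>
    have h := (bernsteinPolynomial ℝ (n + 1) (i + 1)).hasDerivAt q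
    rw [bernsteinPolynomial.derivative_succ_aux] at h
    simp only [binomCdf_succ, binomPmf_eq_eval_bernstein _ _ (i + 1)]
    refine (ih.fun_add h).congr_deriv ?_
    simp [binomPmf_eq_eval_bernstein]
    ring

lemma binomCdf_one_eq_zero {n i : ℕ} (h : i < n) : binomCdf n 1 i = 0 := by
  refine Finset.sum_eq_zero fun j hj => ?_
  have := Finset.mem_range.1 hj
  rw [binomPmf_eq_eval_bernstein, bernsteinPolynomial.eval_at_1, if_neg (by lia)]

lemma integral_binomPmf {n i : ℕ} (h : i ≤ n) (q : ℝ) :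
    ∫ x in q..1, (n + 1) * binomPmf n x i = binomCdf (n + 1) q i := by
  rw [intervalIntegral.integral_eq_sub_of_hasDerivAt (f := fun x => -binomCdf (n + 1) x i)
    (fun x _ => (hasDerivAt_binomCdf n x i).neg.congr_deriv (neg_neg _)),
    binomCdf_one_eq_zero (by lia), neg_zero, zero_sub, neg_neg]
  exact Continuous.intervalIntegrable (by unfold binomPmf; fun_prop) _ _

lemma one_div_beta_natCast {n i : ℕ} (h : i ≤ n) :
    1 / beta ((i : ℝ) + 1) ((n - i : ℕ) + 1) = (n + 1) * n.choose i := by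
  obtain ⟨d, rfl⟩ := Nat.exists_eq_add_of_le h
  have hsum : (i : ℝ) + 1 + (d + 1) = ((i + d + 1 : ℕ) : ℝ) + 1 := by
    push_cast
    ring
  have := i.factorial_pos
  have := d.factorial_pos
  rw [Nat.add_sub_cancel_left, beta, hsum, Real.Gamma_nat_eq_factorial,
    Real.Gamma_nat_eq_factorial, Real.Gamma_nat_eq_factorial, Nat.factorial_succ, Nat.cast_mul,
    ← Nat.add_choose_mul_factorial_mul_factorial i d, Nat.choose_symm_add]
  push_cast
  field_simp

lemma betaPDF_natCast {n i : ℕ} (h : i ≤ n) {x : ℝ} (hx0 : 0 < x) (hx1 : x < 1) :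
    betaPDF ((i : ℝ) + 1) ((n - i : ℕ) + 1) x = ENNReal.ofReal ((n + 1) * binomPmf n x i) := by
  rw [betaPDF_of_pos_lt_one hx0 hx1, one_div_beta_natCast h, add_sub_cancel_right,
    add_sub_cancel_right, Real.rpow_natCast, Real.rpow_natCast, binomPmf]
  ring_nf

lemma betaMeasure_Ioi {n i : ℕ} (h : i ≤ n) {q : ℝ} (hq0 : 0 ≤ q) (hq1 : q ≤ 1) :
    betaMeasure ((i : ℝ) + 1) ((n - i : ℕ) + 1) (Set.Ioi q) =
      ENNReal.ofReal (binomCdf (n + 1) q i) := by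
  have lintegral_Ioi : ∫⁻ x in Set.Ioi q, betaPDF ((i : ℝ) + 1) ((n - i : ℕ) + 1) x =
      ∫⁻ x in Set.Ioo q 1, ENNReal.ofReal ((n + 1) * binomPmf n x i) := by
    rw [← lintegral_indicator measurableSet_Ioi, ← lintegral_indicator measurableSet_Ioo]
    refine lintegral_congr fun x => ?_
    rcases le_or_gt x q with hxq | hqx
    · rw [Set.indicator_of_notMem (by simpa using hxq),
        Set.indicator_of_notMem fun hx => hx.1.not_ge hxq]
    rw [Set.indicator_of_mem (Set.mem_Ioi.2 hqx)]
    rcases lt_or_ge x 1 with hx1 | hx1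
    · rw [Set.indicator_of_mem (Set.mem_Ioo.2 ⟨hqx, hx1⟩), betaPDF_natCast h (hq0.trans_lt hqx) hx1]
    · rw [Set.indicator_of_notMem fun hx => hx.2.not_ge hx1, betaPDF_eq_zero_of_one_le hx1]
  have hcont : Continuous fun x : ℝ => (n + 1) * binomPmf n x i := by unfold binomPmf; fun_prop
  rw [betaMeasure, withDensity_apply _ measurableSet_Ioi, lintegral_Ioi,
    Measure.restrict_congr_set Ioo_ae_eq_Ioc, ← integral_binomPmf h,
    intervalIntegral.integral_of_le hq1, ofReal_integral_eq_lintegral_ofReal]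
  · exact (hcont.intervalIntegrable q 1).1
  · refine ae_restrict_of_forall_mem measurableSet_Ioc fun x hx => ?_
    exact mul_nonneg (by positivity) (binomPmf_nonneg (hq0.trans hx.1.le) hx.2 n i)

lemma betaMeasure_Ici {n i : ℕ} (h : i ≤ n) {q : ℝ} (hq0 : 0 ≤ q) (hq1 : q ≤ 1) :
    betaMeasure ((i : ℝ) + 1) ((n - i : ℕ) + 1) (Set.Ici q) =
      ENNReal.ofReal (binomCdf (n + 1) q i) := by
  have : NullSingletonClass (betaMeasure ((i : ℝ) + 1) ((n - i : ℕ) + 1)) := by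
    unfold betaMeasure
    infer_instance
  rw [← betaMeasure_Ioi h hq0 hq1]
  exact (measure_congr Ioi_ae_eq_Ici).symm

lemma betaMeasure_Iic {n i : ℕ} (h : i ≤ n) {q : ℝ} (hq0 : 0 ≤ q) (hq1 : q ≤ 1) :
    betaMeasure ((i : ℝ) + 1) ((n - i : ℕ) + 1) (Set.Iic q) =
      ENNReal.ofReal (1 - binomCdf (n + 1) q i) := by
  have : IsProbabilityMeasure (betaMeasure ((i : ℝ) + 1) ((n - i : ℕ) + 1)) :=
    isProbabilityMeasureBeta (by positivity) (by positivity)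
  rw [← Set.compl_Ioi, prob_compl_eq_one_sub measurableSet_Ioi, betaMeasure_Ioi h hq0 hq1,
    ENNReal.ofReal_sub _ (binomCdf_nonneg hq0 hq1 _ _), ENNReal.ofReal_one]

/-! ### The Laplace transform of a binomial distribution function -/

lemma exists_weighted_geom_mean_lt_one {q μ : ℝ} (hq0 : 0 < q) (hqμ : q < μ) (hμ1 : μ ≤ 1) :
    ∃ x ∈ Set.Ioo q 1, (μ / q) ^ x * ((1 - μ) / (1 - q)) ^ (1 - x) < 1 := by
  have hq1 : q < 1 := hqμ.trans_le hμ1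
  have hq1' : 0 < 1 - q := sub_pos.2 hq1
  have hμ : 1 < μ / q := (one_lt_div hq0).2 hqμ
  have hν : (1 - μ) / (1 - q) < 1 := (div_lt_one hq1').2 (by linarith)
  have at_q : (μ / q) ^ q * ((1 - μ) / (1 - q)) ^ (1 - q) < 1 := by
    refine ((Real.geom_mean_lt_arith_mean2_weighted_iff_of_pos hq0 hq1' (by linarith)
      (div_nonneg (sub_nonneg.2 hμ1) hq1'.le) (by ring)).2 (hν.trans hμ).ne').trans_eq ?_
    field_simp
    ring
  have hcont : ContinuousAt (fun x : ℝ => (μ / q) ^ x * ((1 - μ) / (1 - q)) ^ (1 - x)) q :=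
    (Real.continuousAt_const_rpow (by linarith)).mul <|
      (Real.continuousAt_const_rpow' (b := 1 - q) hq1'.ne').comp (f := fun x : ℝ => 1 - x)
        (by fun_prop)
  obtain ⟨x, hx, hxq⟩ := (((hcont.eventually_lt_const at_q).filter_mono nhdsWithin_le_nhds).and
    (Ioo_mem_nhdsGT hq1)).exists
  exact ⟨x, hxq, hx⟩

lemma exists_likelihood_ratio_le_pow {q μ : ℝ} (hq0 : 0 < q) (hqμ : q < μ) (hμ1 : μ ≤ 1) :
    ∃ x ∈ Set.Ioo q 1, ∃ r ∈ Set.Ioo (0 : ℝ) 1, ∀ k j : ℕ, j ≤ k → (j : ℝ) ≤ x * k →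
      μ ^ j * (1 - μ) ^ (k - j) ≤ r ^ k * (q ^ j * (1 - q) ^ (k - j)) := by
  obtain ⟨x, hx, hlt⟩ := exists_weighted_geom_mean_lt_one hq0 hqμ hμ1
  have hq1 : 0 < 1 - q := by linarith
  have hμ : 1 ≤ μ / q := (one_le_div hq0).2 hqμ.le
  have hν0 : 0 ≤ (1 - μ) / (1 - q) := div_nonneg (sub_nonneg.2 hμ1) hq1.le
  have hν1 : (1 - μ) / (1 - q) ≤ 1 := (div_le_one hq1).2 (by linarith)
  obtain ⟨r, hr, hr1⟩ := exists_between (max_lt hlt one_pos)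
  refine ⟨x, hx, r, ⟨(le_max_right _ _).trans_lt hr, hr1⟩, fun k j hjk hj => ?_⟩
  have ratio_le : (μ / q) ^ j * ((1 - μ) / (1 - q)) ^ (k - j) ≤ r ^ k := calc
    _ ≤ (μ / q) ^ (x * k) * ((1 - μ) / (1 - q)) ^ ((1 - x) * k) := by
        rw [← Real.rpow_natCast, ← Real.rpow_natCast]
        refine mul_le_mul (Real.rpow_le_rpow_of_exponent_le hμ hj) ?_ (by positivity)
          (by positivity)
        refine Real.rpow_le_rpow_of_exponent_ge' hν0 hν1
          (mul_nonneg (sub_nonneg.2 hx.2.le) k.cast_nonneg) ?_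
        rw [Nat.cast_sub hjk]
        linarith
    _ = ((μ / q) ^ x * ((1 - μ) / (1 - q)) ^ (1 - x)) ^ k := by
        rw [Real.rpow_mul (by positivity), Real.rpow_mul hν0, Real.rpow_natCast,
          Real.rpow_natCast, mul_pow]
    _ ≤ r ^ k := pow_le_pow_left₀ (by positivity) ((le_max_left _ _).trans hr.le) k
  rw [div_pow, div_pow, div_mul_div_comm, div_le_iff₀ (by positivity)] at ratio_le
  exact ratio_le

lemma exp_neg_le_two_mul_rpow_neg {u γ : ℝ} (hu : 0 < u) (hγ0 : 0 ≤ γ) (hγ2 : γ ≤ 2) :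
    Real.exp (-u) ≤ 2 * u ^ (-γ) := by
  have rpow_le : u ^ γ ≤ 2 * Real.exp u := by
    have hexp := Real.quadratic_le_exp_of_nonneg hu.le
    rcases le_total u 1 with h | h
    · exact (Real.rpow_le_one hu.le h hγ0).trans (by nlinarith)
    · refine (Real.rpow_le_rpow_of_exponent_le h hγ2).trans ?_
      rw [Real.rpow_two]
      nlinarith
  rw [Real.exp_neg, Real.rpow_neg hu.le, ← div_eq_mul_inv,
    le_div_iff₀ (Real.rpow_pos_of_pos hu γ), inv_mul_le_iff₀ (Real.exp_pos u), mul_comm]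
  exact rpow_le

lemma pow_le_binomPmf {n j : ℕ} {q w : ℝ} (hw : 0 ≤ w) (hwq : w ≤ q) (hwq' : w ≤ 1 - q)
    (hj : j ≤ n) : w ^ n ≤ binomPmf n q j := by
  have hq : 0 ≤ q := hw.trans hwq
  have hq' : 0 ≤ 1 - q := hw.trans hwq'
  calc w ^ n = w ^ j * w ^ (n - j) := by rw [← pow_add, Nat.add_sub_cancel' hj]
    _ ≤ q ^ j * (1 - q) ^ (n - j) := by gcongr
    _ ≤ n.choose j * (q ^ j * (1 - q) ^ (n - j)) :=
        le_mul_of_one_le_left (by positivity) (by exact_mod_cast Nat.choose_pos hj)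
    _ = binomPmf n q j := (mul_assoc _ _ _).symm

lemma binomPmf_le_mul_binomPmf_succ {q μ r : ℝ} (hq : q < 1) (hμ0 : 0 ≤ μ) (hμ1 : μ ≤ 1) {k j : ℕ}
    (hjk : j ≤ k) (hratio : μ ^ j * (1 - μ) ^ (k - j) ≤ r ^ k * (q ^ j * (1 - q) ^ (k - j))) :
    binomPmf k μ j ≤ r ^ k / (1 - q) * binomPmf (k + 1) q j := by
  have hq' : 1 - q ≠ 0 := (sub_pos.2 hq).ne'
  have : 0 ≤ 1 - μ := sub_nonneg.2 hμ1
  have choose_le : (k.choose j : ℝ) ≤ (k + 1).choose j := by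
    exact_mod_cast Nat.choose_le_choose j k.le_succ
  calc binomPmf k μ j = k.choose j * (μ ^ j * (1 - μ) ^ (k - j)) := mul_assoc _ _ _
    _ ≤ (k + 1).choose j * (r ^ k * (q ^ j * (1 - q) ^ (k - j))) := by gcongr
    _ = r ^ k / (1 - q) * binomPmf (k + 1) q j := by
        rw [binomPmf, Nat.succ_sub hjk, pow_succ]
        field_simp

lemma exists_le_rpow {s w : ℝ} (hs : s < 1) (hw : 0 < w) : ∃ κ ∈ Set.Ioc (0 : ℝ) 1, s ≤ w ^ κ := by
  have hcont : Filter.Tendsto (fun κ : ℝ => w ^ κ) (nhdsWithin 0 (Set.Ioi 0)) (nhds 1) := by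
    simpa using ((Real.continuous_const_rpow hw.ne').tendsto 0).mono_left nhdsWithin_le_nhds
  obtain ⟨κ, hsκ, hκ⟩ := ((hcont.eventually (lt_mem_nhds hs)).and
    (Ioc_mem_nhdsGT one_pos)).exists
  exact ⟨κ, hκ, hsκ.le⟩

lemma exists_forall_succ_mul_pow_le {s : ℝ} (hs0 : 0 ≤ s) (hs1 : s < 1) :
    ∃ C : ℝ, 0 ≤ C ∧ ∀ k : ℕ, ((k : ℝ) + 1) * s ^ k ≤ C := by
  have h := (tendsto_self_mul_const_pow_of_lt_one hs0 hs1).add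
    (tendsto_pow_atTop_nhds_zero_of_lt_one hs0 hs1)
  simp_rw [← add_one_mul] at h
  obtain ⟨C, hC⟩ := h.bddAbove_range
  have hC' (k : ℕ) : ((k : ℝ) + 1) * s ^ k ≤ C := hC ⟨k, rfl⟩
  exact ⟨C, zero_le_one.trans (by simpa using hC' 0), hC'⟩

/-- Trading the factor `p` for `p ^ (-κ)` uses only a fraction of the gain `s ^ (2 * k)`, as `p` is
at least geometrically small; this is what pushes the exponent of `m` beyond `1`. -/
lemma mul_exp_neg_le_of_le_rpow {p s w κ m : ℝ} {k : ℕ} (hm : 0 < m) (hs : 0 < s) (hw : 0 < w)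
    (hκ0 : 0 ≤ κ) (hκ1 : κ ≤ 1) (hsw : s ≤ w ^ κ) (hwp : w ^ (k + 1) ≤ p) :
    s ^ (2 * k) * p * Real.exp (-(p * m)) ≤ 2 / s * s ^ k * m ^ (-(1 + κ)) := by
  have hp : 0 < p := (pow_pos hw _).trans_le hwp
  have rpow_neg_le : p ^ (-κ) ≤ (s ^ (k + 1))⁻¹ := by
    rw [Real.rpow_neg hp.le]
    refine inv_anti₀ (by positivity) ?_
    calc s ^ (k + 1) ≤ (w ^ κ) ^ (k + 1) := pow_le_pow_left₀ hs.le hsw _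
      _ = (w ^ (k + 1)) ^ κ := (Real.rpow_pow_comm hw.le κ (k + 1))
      _ ≤ p ^ κ := Real.rpow_le_rpow (by positivity) hwp hκ0
  have mul_rpow : p * p ^ (-(1 + κ)) = p ^ (-κ) := by
    rw [mul_comm, ← Real.rpow_add_one hp.ne']
    ring_nf
  calc s ^ (2 * k) * p * Real.exp (-(p * m))
      ≤ s ^ (2 * k) * p * (2 * (p * m) ^ (-(1 + κ))) := by
        gcongr
        exact exp_neg_le_two_mul_rpow_neg (mul_pos hp hm) (by linarith) (by linarith)
    _ = 2 * s ^ (2 * k) * p ^ (-κ) * m ^ (-(1 + κ)) := by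
        rw [Real.mul_rpow hp.le hm.le, ← mul_rpow]
        ring
    _ ≤ 2 * s ^ (2 * k) * (s ^ (k + 1))⁻¹ * m ^ (-(1 + κ)) := by gcongr
    _ = 2 / s * s ^ k * m ^ (-(1 + κ)) := by
        rw [two_mul k, pow_add, pow_succ]
        field_simp

lemma exp_neg_binomCdf_mul_le {q x m γ : ℝ} (hq0 : 0 ≤ q) (hqx : q < x) (hx1 : x ≤ 1) (hm : 0 < m)
    (hγ0 : 0 ≤ γ) (hγ2 : γ ≤ 2) {k i : ℕ} (hi : x * k ≤ i) :
    Real.exp (-(binomCdf (k + 1) q i * m)) ≤ 2 * (1 - q / x) ^ (-γ) * m ^ (-γ) := by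
  have hx0 : 0 < x := hq0.trans_lt hqx
  have hδ : 0 < 1 - q / x := by rwa [sub_pos, div_lt_one hx0]
  have le_cdf : 1 - q / x ≤ binomCdf (k + 1) q i := by
    have markov := one_sub_binomCdf_le (n := k + 1) (i := i) hq0 (hqx.le.trans hx1)
    have : ((k + 1 : ℕ) : ℝ) * q / (i + 1) ≤ q / x := by
      rw [div_le_div_iff₀ (by positivity) hx0]
      push_cast
      nlinarith
    linarith
  calc Real.exp (-(binomCdf (k + 1) q i * m)) ≤ Real.exp (-((1 - q / x) * m)) := by gcongr
    _ ≤ 2 * ((1 - q / x) * m) ^ (-γ) := exp_neg_le_two_mul_rpow_neg (mul_pos hδ hm) hγ0 hγ2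
    _ = _ := by rw [Real.mul_rpow hδ.le hm.le, mul_assoc]

lemma binomPmf_mul_exp_neg_binomCdf_le {q μ r κ m : ℝ} (hq0 : 0 < q) (hq1 : q < 1) (hμ0 : 0 ≤ μ)
    (hμ1 : μ ≤ 1) (hr : 0 < r) (hm : 0 < m) (hκ0 : 0 ≤ κ) (hκ1 : κ ≤ 1)
    (hκ : √r ≤ min q (1 - q) ^ κ) {k j i : ℕ} (hjk : j ≤ k) (hji : j ≤ i)
    (hratio : μ ^ j * (1 - μ) ^ (k - j) ≤ r ^ k * (q ^ j * (1 - q) ^ (k - j))) :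
    binomPmf k μ j * Real.exp (-(binomCdf (k + 1) q i * m)) ≤
      2 / √r * √r ^ k * m ^ (-(1 + κ)) / (1 - q) := by
  have hq1' : 0 < 1 - q := sub_pos.2 hq1
  have hp := binomPmf_nonneg hq0.le hq1.le (k + 1) j
  calc binomPmf k μ j * Real.exp (-(binomCdf (k + 1) q i * m))
      ≤ r ^ k / (1 - q) * binomPmf (k + 1) q j * Real.exp (-(binomPmf (k + 1) q j * m)) := by
        gcongr
        · exact binomPmf_le_mul_binomPmf_succ hq1 hμ0 hμ1 hjk hratio
        · exact binomPmf_le_binomCdf hq0.le hq1.le hji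
    _ = √r ^ (2 * k) * binomPmf (k + 1) q j * Real.exp (-(binomPmf (k + 1) q j * m)) /
          (1 - q) := by
        rw [pow_mul, Real.sq_sqrt hr.le]
        ring
    _ ≤ _ := by
        refine div_le_div_of_nonneg_right ?_ hq1'.le
        exact mul_exp_neg_le_of_le_rpow hm (Real.sqrt_pos.2 hr) (lt_min hq0 hq1') hκ0 hκ1 hκ
          (pow_le_binomPmf (lt_min hq0 hq1').le (min_le_left _ _) (min_le_right _ _)
            (hjk.trans k.le_succ))

/-- Split the sum at `j = x * k`. Below it the likelihood ratio of `μ` against `q` is exponentially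
small; above it the distribution function is bounded below by Markov's inequality. -/
lemma exists_laplace_binomCdf_le {q μ : ℝ} (hq0 : 0 < q) (hqμ : q < μ) (hμ1 : μ ≤ 1) :
    ∃ γ C : ℝ, 1 < γ ∧ 0 ≤ C ∧ ∀ (k : ℕ) (i : ℕ → ℕ), (∀ j, j ≤ i j) → ∀ m : ℝ, 0 < m →
      ∑ j ∈ Finset.range (k + 1), binomPmf k μ j * Real.exp (-(binomCdf (k + 1) q (i j) * m)) ≤
        C * m ^ (-γ) := by
  obtain ⟨x, ⟨hqx, hx1⟩, r, ⟨hr0, hr1⟩, hratio⟩ := exists_likelihood_ratio_le_pow hq0 hqμ hμ1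
  have hq1 : 0 < 1 - q := by linarith
  have hμ0 : 0 ≤ μ := (hq0.trans hqμ).le
  have hs0 : 0 < √r := Real.sqrt_pos.2 hr0
  have hs1 : √r < 1 := (Real.sqrt_lt' one_pos).2 (by simpa using hr1)
  have hδ : 0 ≤ 1 - q / x := sub_nonneg.2 ((div_le_one (hq0.trans hqx)).2 hqx.le)
  obtain ⟨κ, ⟨hκ0, hκ1⟩, hκ⟩ := exists_le_rpow hs1 (lt_min hq0 hq1)
  obtain ⟨D, hD0, hD⟩ := exists_forall_succ_mul_pow_le hs0.le hs1
  refine ⟨1 + κ, 2 / √r * D / (1 - q) + 2 * (1 - q / x) ^ (-(1 + κ)), by linarith,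
    by positivity, fun k i hi m hm => ?_⟩
  have term_le (j : ℕ) (hj : j ∈ Finset.range (k + 1)) :
      binomPmf k μ j * Real.exp (-(binomCdf (k + 1) q (i j) * m)) ≤
        2 / √r * √r ^ k * m ^ (-(1 + κ)) / (1 - q) +
          binomPmf k μ j * (2 * (1 - q / x) ^ (-(1 + κ)) * m ^ (-(1 + κ))) := by
    have hjk : j ≤ k := Finset.mem_range_succ_iff.1 hj
    have hb0 := binomPmf_nonneg hμ0 hμ1 k j
    rcases le_or_gt (j : ℝ) (x * k) with hjx | hxj
    · refine le_add_of_le_of_nonneg ?_ (by positivity)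
      exact binomPmf_mul_exp_neg_binomCdf_le hq0 (sub_pos.1 hq1) hμ0 hμ1 hr0 hm hκ0.le hκ1 hκ hjk
        (hi j) (hratio k j hjk hjx)
    · refine le_add_of_nonneg_of_le (by positivity) (mul_le_mul_of_nonneg_left ?_ hb0)
      exact exp_neg_binomCdf_mul_le hq0.le hqx hx1.le hm (by linarith) (by linarith)
        (hxj.le.trans (by exact_mod_cast hi j))
  refine (Finset.sum_le_sum term_le).trans ?_
  rw [Finset.sum_add_distrib, ← Finset.sum_mul (Finset.range (k + 1)) (binomPmf k μ),
    sum_range_binomPmf, one_mul, Finset.sum_const, Finset.card_range, nsmul_eq_mul, add_mul]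
  refine add_le_add ?_ le_rfl
  calc ((k + 1 : ℕ) : ℝ) * (2 / √r * √r ^ k * m ^ (-(1 + κ)) / (1 - q))
      = 2 / √r * (((k : ℝ) + 1) * √r ^ k) / (1 - q) * m ^ (-(1 + κ)) := by
        push_cast
        ring
    _ ≤ _ := by
        gcongr
        exact hD k

/-! ### Paths and measurability of the algorithm -/

section Path

variable {K : ℕ}

lemma successes_le (z : Seed K → ℝ) (a : Fin K) (n : ℕ) : successes z a n ≤ n := by
  calc successes z a n ≤ ∑ _k ∈ Finset.range n, 1 :=
        Finset.sum_le_sum fun k _ => by unfold bit; split_ifs <;> simp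
    _ = n := by simp

lemma successes_succ (z : Seed K → ℝ) (a : Fin K) (n : ℕ) :
    successes z a (n + 1) = successes z a n + bit z a n :=
  Finset.sum_range_succ _ _

lemma successes_congr {z z' : Seed K → ℝ} {a : Fin K}
    (hcoin : ∀ k, z (.coin a k) = z' (.coin a k))
    (hreward : ∀ k, z (.reward a k) = z' (.reward a k)) (n : ℕ) :
    successes z a n = successes z' a n := by
  simp only [successes, bit, hcoin, hreward]

lemma theta_congr {ε : ℝ} {z z' : Seed K → ℝ} {t : ℕ} {a : Fin K} {n : ℕ}
    (hcoin : ∀ k, z (.coin a k) = z' (.coin a k))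
    (hreward : ∀ k, z (.reward a k) = z' (.reward a k))
    (hposterior : ∀ α β, z (.posterior t a α β) = z' (.posterior t a α β)) :
    theta ε z t a n = theta ε z' t a n := by
  simp [theta, empMean, alpha, successes_congr hcoin hreward, hposterior]

lemma dependsOn_successes (r : ℕ) (a : Fin K) (α β : ℕ) (k : Fin K) (n : ℕ) :
    DependsOn (fun z : Seed K → ℝ => successes z k n) {.posterior r a α β}ᶜ := fun _ _ h =>
  successes_congr (fun _ => h _ (by simp)) (fun _ => h _ (by simp)) n

variable [NeZero K]

lemma le_select (θ w : Fin K → ℝ) (b : Fin K) : θ b ≤ θ (select θ w) := by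
  have h := Finset.min'_mem _ (argmaxSet_nonempty w (argmaxSet_nonempty θ Finset.univ_nonempty))
  unfold argmaxSet at h
  exact (Finset.mem_filter.1 (Finset.mem_filter.1 h).1).2 b (Finset.mem_univ b)

lemma theta_le_theta_action (ε : ℝ) (z : Seed K → ℝ) (t : ℕ) (b : Fin K) :
    theta ε z t b (pulls ε z t b) ≤
      theta ε z t (action ε z t) (pulls ε z t (action ε z t)) :=
  le_select (fun k => theta ε z t k (pulls ε z t k)) _ b

lemma pulls_succ (ε : ℝ) (z : Seed K → ℝ) (t : ℕ) (a : Fin K) :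
    pulls ε z (t + 1) a = pulls ε z t a + if action ε z t = a then 1 else 0 := rfl

lemma pulls_mono (ε : ℝ) (z : Seed K → ℝ) (a : Fin K) : Monotone fun t => pulls ε z t a :=
  monotone_nat_of_le_succ fun _ => Nat.le_add_right _ _

lemma pulls_le (ε : ℝ) (z : Seed K → ℝ) (t : ℕ) (a : Fin K) : pulls ε z t a ≤ t := by
  induction t with
  | zero => exact le_rfl
  | succ t ih =>
    rw [pulls_succ]
    split_ifs <;> lia

lemma sum_action_eq_sum_pulls {M : Type*} [AddCommMonoid M] (ε : ℝ) (z : Seed K → ℝ) (a : Fin K)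
    (g : ℕ → M) (t : ℕ) :
    ∑ r ∈ Finset.range t, (if action ε z r = a then g (pulls ε z r a) else 0) =
      ∑ n ∈ Finset.range (pulls ε z t a), g n := by
  induction t with
  | zero => rfl
  | succ t ih =>
    rw [Finset.sum_range_succ, ih, pulls_succ]
    split_ifs
    · rw [Finset.sum_range_succ]
    · simp

lemma pulls_congr {ε : ℝ} {z z' : Seed K → ℝ} {t : ℕ}
    (h : ∀ s, (∀ r a α β, t ≤ r → s ≠ .posterior r a α β) → z s = z' s) :
    pulls ε z t = pulls ε z' t := by
  induction t with
  | zero => rfl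
  | succ t ih =>
    have pulls_eq := ih fun s hs => h s fun r a α β hr => hs r a α β (t.le_succ.trans hr)
    have theta_eq (k n) : theta ε z t k n = theta ε z' t k n :=
      theta_congr (fun _ => h _ (by simp)) (fun _ => h _ (by simp)) fun _ _ =>
        h _ fun r _ _ _ hr => by simp only [ne_eq, Seed.posterior.injEq]; lia
    have tie_eq (k) : z (.tie t k) = z' (.tie t k) := h _ (by simp)
    funext a
    simp only [pulls, pulls_eq, theta_eq, tie_eq]

lemma dependsOn_pulls (ε : ℝ) {t r : ℕ} (htr : t ≤ r) (a : Fin K) (α β : ℕ) (k : Fin K) :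
    DependsOn (fun z : Seed K → ℝ => pulls ε z t k) {.posterior r a α β}ᶜ := fun _ _ h =>
  congrFun (pulls_congr fun s hs => h s fun e => hs r a α β htr e) k

end Path

section Measurability

lemma measurable_comp_nat {X : Type*} [MeasurableSpace X] {N : X → ℕ} (hN : Measurable N)
    {E : Type*} [MeasurableSpace E] {g : ℕ → X → E} (hg : ∀ n, Measurable (g n)) :
    Measurable fun x => g (N x) x :=
  (measurable_from_prod_countable_right (f := fun p : ℕ × X => g p.1 p.2) hg).comp
    (hN.prodMk measurable_id)

variable {K : ℕ}

lemma measurable_bit (a : Fin K) (n : ℕ) : Measurable fun z : Seed K → ℝ => bit z a n :=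
  Measurable.ite (measurableSet_lt (measurable_pi_apply _) (measurable_pi_apply _))
    measurable_const measurable_const

lemma measurable_successes (a : Fin K) (n : ℕ) :
    Measurable fun z : Seed K → ℝ => successes z a n :=
  Finset.measurable_sum _ fun k _ => measurable_bit a k

lemma measurable_theta (ε : ℝ) (t : ℕ) (a : Fin K) (n : ℕ) :
    Measurable fun z : Seed K → ℝ => theta ε z t a n := by
  classical
  refine measurable_comp_nat (measurable_successes a n) (g := fun j z =>
    if 1 - ε < (j : ℝ) / n then (j : ℝ) / n else
      (1 - ε) * z (.posterior t a (⌊(j : ℝ) / (1 - ε)⌋₊ + 1)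
        (n + 2 - (⌊(j : ℝ) / (1 - ε)⌋₊ + 1)))) fun j => ?_
  split_ifs
  · exact measurable_const
  · exact (measurable_pi_apply _).const_mul _

lemma measurableSet_argmaxSet_eq {X : Type*} [MeasurableSpace X] {g : Fin K → X → ℝ}
    (hg : ∀ a, Measurable (g a)) (u s : Finset (Fin K)) :
    MeasurableSet {x | argmaxSet (fun a => g a x) u = s} := by
  have h_eq : {x | argmaxSet (fun a => g a x) u = s} =
      ⋂ a, {x | (a ∈ u ∧ ∀ b ∈ u, g b x ≤ g a x) ↔ a ∈ s} := by
    ext x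
    simp [argmaxSet, Finset.ext_iff]
  have h_max (a : Fin K) : MeasurableSet {x | ∀ b ∈ u, g b x ≤ g a x} := by
    simpa only [Set.ofPred_forall] using
      Finset.measurableSet_biInter u fun b _ => measurableSet_le (hg b) (hg a)
  rw [h_eq]
  exact MeasurableSet.iInter fun a =>
    ((MeasurableSet.const (a ∈ u)).inter (h_max a)).iff (MeasurableSet.const (a ∈ s))

variable [NeZero K]

lemma measurable_select {X : Type*} [MeasurableSpace X] {θ w : Fin K → X → ℝ}
    (hθ : ∀ a, Measurable (θ a)) (hw : ∀ a, Measurable (w a)) :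
    Measurable fun x => select (fun a => θ a x) (fun a => w a x) := by
  refine measurable_to_countable' fun a => ?_
  have h_eq : (fun x => select (fun a => θ a x) (fun a => w a x)) ⁻¹' {a} =
      ⋃ u : Finset (Fin K), ⋃ s ∈ {s : Finset (Fin K) | ∃ h : s.Nonempty, s.min' h = a},
        {x | argmaxSet (fun a => θ a x) Finset.univ = u} ∩
          {x | argmaxSet (fun a => w a x) u = s} := by
    ext x
    simp only [select, Set.mem_preimage, Set.mem_singleton_iff, Set.mem_iUnion, Set.mem_ofPred_eq,
      Set.mem_inter_iff, exists_prop]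
    constructor
    · exact fun h => ⟨_, _, ⟨_, h⟩, rfl, rfl⟩
    · rintro ⟨u, s, ⟨hs, h⟩, rfl, rfl⟩
      exact h
  rw [h_eq]
  exact MeasurableSet.iUnion fun u => MeasurableSet.biUnion (Set.to_countable _) fun s _ =>
    (measurableSet_argmaxSet_eq hθ _ _).inter (measurableSet_argmaxSet_eq hw _ _)

lemma measurable_pulls (ε : ℝ) (t : ℕ) (a : Fin K) :
    Measurable fun z : Seed K → ℝ => pulls ε z t a := by
  induction t generalizing a with
  | zero => exact measurable_const
  | succ t ih =>
    refine (ih a).add (Measurable.ite ?_ measurable_const measurable_const)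
    exact measurable_select (fun k => measurable_comp_nat (ih k) fun n => measurable_theta ε t k n)
      (fun k => measurable_pi_apply _) (measurableSet_singleton a)

lemma measurable_theta_pulls (ε : ℝ) (t : ℕ) (a : Fin K) :
    Measurable fun z : Seed K → ℝ => theta ε z t a (pulls ε z t a) :=
  measurable_comp_nat (measurable_pulls ε t a) fun n => measurable_theta ε t a n

lemma measurable_action (ε : ℝ) (t : ℕ) : Measurable fun z : Seed K → ℝ => action ε z t :=
  measurable_select (measurable_theta_pulls ε t) fun _ => measurable_pi_apply _

end Measurability

/-! ### Laws of the primitive random variables -/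

section Independence

variable {ι Ω E : Type*} [MeasurableSpace E] [Nonempty E] {S T : Set ι}

lemma measurable_iSup_comap_of_dependsOn {F : Type*} [MeasurableSpace F] (ξ : ι → Ω → E)
    {G : (ι → E) → F} (hG : Measurable G) (hGS : DependsOn G S) :
    Measurable[⨆ i ∈ S, MeasurableSpace.comap (ξ i) inferInstance] fun ω => G fun i => ξ i ω := by
  classical
  let x₀ : E := Classical.arbitrary E
  have G_eq : (fun ω => G fun i => ξ i ω) = fun ω => G fun i => if i ∈ S then ξ i ω else x₀ :=
    funext fun ω => hGS fun i hi => by simp [hi]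
  rw [G_eq]
  refine hG.comp (@measurable_pi_lambda _ _ _ (⨆ i ∈ S, _) _ _ fun i => ?_)
  by_cases hi : i ∈ S
  · simp only [hi, if_true]
    exact (comap_measurable (ξ i)).mono (le_iSup₂_of_le i hi le_rfl) le_rfl
  · simp only [hi, if_false]
    exact measurable_const

variable [MeasurableSpace Ω] {P : Measure Ω} {ξ : ι → Ω → E}

lemma lintegral_mul_of_dependsOn (hξ : ∀ i, Measurable (ξ i)) (hind : iIndepFun ξ P)
    (hST : Disjoint S T) {G H : (ι → E) → ℝ≥0∞} (hG : Measurable G) (hH : Measurable H)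
    (hGS : DependsOn G S) (hHT : DependsOn H T) :
    ∫⁻ ω, G (fun i => ξ i ω) * H (fun i => ξ i ω) ∂P =
      (∫⁻ ω, G (fun i => ξ i ω) ∂P) * ∫⁻ ω, H (fun i => ξ i ω) ∂P :=
  lintegral_mul_eq_lintegral_mul_lintegral_of_independent_measurableSpace
    (iSup₂_le fun i _ => (hξ i).comap_le) (iSup₂_le fun i _ => (hξ i).comap_le)
    (indep_iSup_of_disjoint (fun i => (hξ i).comap_le) hind hST)
    (measurable_iSup_comap_of_dependsOn ξ hG hGS) (measurable_iSup_comap_of_dependsOn ξ hH hHT)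

lemma measure_and_of_dependsOn (hξ : ∀ i, Measurable (ξ i)) (hind : iIndepFun ξ P)
    (hST : Disjoint S T) {p r : (ι → E) → Prop} (hp : Measurable p) (hr : Measurable r)
    (hpS : DependsOn p S) (hrT : DependsOn r T) :
    P {ω | p (fun i => ξ i ω) ∧ r fun i => ξ i ω} =
      P {ω | p fun i => ξ i ω} * P {ω | r fun i => ξ i ω} :=
  (Indep_iff _ _ P).1 (indep_iSup_of_disjoint (fun i => (hξ i).comap_le) hind hST) _ _
    ((@measurableSet_setOfPred _ (_) _).2 (measurable_iSup_comap_of_dependsOn ξ hp hpS))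
    ((@measurableSet_setOfPred _ (_) _).2 (measurable_iSup_comap_of_dependsOn ξ hr hrT))

lemma measure_mem_comp_le [IsProbabilityMeasure P] [Countable ι] [MeasurableSpace ι]
    [MeasurableSingletonClass ι] {f : Ω → ι} (hf : Measurable f) {A : ι → Set Ω} {c : ℝ≥0∞}
    (hA : ∀ i, P (f ⁻¹' {i} ∩ A i) ≤ P (f ⁻¹' {i}) * c) : P {ω | ω ∈ A (f ω)} ≤ c := by
  have sum_fiber : ∑' i, P (f ⁻¹' {i}) = 1 := by
    rw [← measure_iUnion (fun i j hij => Set.pairwiseDisjoint_fiber f Set.univ trivial trivial hij)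
      fun i => hf (measurableSet_singleton i), ← Set.preimage_iUnion, Set.iUnion_of_singleton,
      Set.preimage_univ, measure_univ]
  calc P {ω | ω ∈ A (f ω)} ≤ P (⋃ i, f ⁻¹' {i} ∩ A i) :=
        measure_mono fun ω hω => Set.mem_iUnion.2 ⟨f ω, rfl, hω⟩
    _ ≤ ∑' i, P (f ⁻¹' {i}) * c := (measure_iUnion_le _).trans (ENNReal.tsum_le_tsum hA)
    _ = c := by rw [ENNReal.tsum_mul_right, sum_fiber, one_mul]

lemma measure_uniform_lt [IsProbabilityMeasure P] {ν : Measure ℝ} {X U : Ω → ℝ} (hX : HasLaw X ν P)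
    (hU : HasLaw U (volume.restrict (Set.Icc (0 : ℝ) 1)) P) (hXU : IndepFun X U P)
    (hν : ∀ᵐ x ∂ν, x ∈ Set.Icc (0 : ℝ) 1) : P {ω | U ω < X ω} = ENNReal.ofReal (∫ x, x ∂ν) := by
  have hlt : MeasurableSet {p : ℝ × ℝ | p.2 < p.1} := measurableSet_lt measurable_snd measurable_fst
  have : IsProbabilityMeasure ν := hX.isProbabilityMeasure_iff.1 ‹_›
  have law := (indepFun_iff_map_prod_eq_prod_map_map hX.aemeasurable hU.aemeasurable).1 hXU
  rw [hX.map_eq, hU.map_eq] at law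
  calc P {ω | U ω < X ω} = P.map (fun ω => (X ω, U ω)) {p : ℝ × ℝ | p.2 < p.1} :=
        (Measure.map_apply_of_aemeasurable (hX.aemeasurable.prodMk hU.aemeasurable) hlt).symm
    _ = ∫⁻ x, volume.restrict (Set.Icc (0 : ℝ) 1) (Set.Iio x) ∂ν := by
        rw [law, Measure.prod_apply hlt]
        rfl
    _ = ∫⁻ x, ENNReal.ofReal x ∂ν := by
        refine lintegral_congr_ae (hν.mono fun x hx => ?_)
        have : Set.Iio x ∩ Set.Icc 0 1 = Set.Ico 0 x := by
          ext u
          simp only [Set.mem_inter_iff, Set.mem_Iio, Set.mem_Icc, Set.mem_Ico]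
          exact ⟨fun h => ⟨h.2.1, h.1⟩, fun h => ⟨h.2, h.1, (h.2.trans_le hx.2).le⟩⟩
        dsimp only
        rw [Measure.restrict_apply measurableSet_Iio, this, Real.volume_Ico, sub_zero]
    _ = ENNReal.ofReal (∫ x, x ∂ν) :=
        (ofReal_integral_eq_lintegral_ofReal (Integrable.of_mem_Icc 0 1 aemeasurable_id hν)
          (hν.mono fun x hx => hx.1)).symm

end Independence

section Successes

variable {K : ℕ} {Ω : Type*} [MeasurableSpace Ω] {P : Measure Ω} {ν : Fin K → Measure ℝ}
  {ξ : Seed K → Ω → ℝ}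

lemma IsSeed.measurable_pi (h : IsSeed P ν ξ) : Measurable fun ω s => ξ s ω :=
  measurable_pi_lambda _ h.measurable

lemma armMean_mem_Icc {a : Fin K} [IsProbabilityMeasure (ν a)]
    (hν : ∀ᵐ r ∂(ν a), r ∈ Set.Icc (0 : ℝ) 1) : armMean ν a ∈ Set.Icc (0 : ℝ) 1 := by
  refine ⟨integral_nonneg_of_ae (hν.mono fun x hx => hx.1), ?_⟩
  calc armMean ν a ≤ ∫ _x, (1 : ℝ) ∂(ν a) :=
        integral_mono_ae (Integrable.of_mem_Icc 0 1 measurable_id.aemeasurable hν)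
          (integrable_const _) (hν.mono fun x hx => hx.2)
    _ = 1 := by simp

lemma IsSeed.measure_bit_eq_one [IsProbabilityMeasure P] (h : IsSeed P ν ξ) {a : Fin K}
    (hν : ∀ᵐ r ∂(ν a), r ∈ Set.Icc (0 : ℝ) 1) (n : ℕ) :
    P {ω | bit (fun s => ξ s ω) a n = 1} = ENNReal.ofReal (armMean ν a) := by
  simpa [bit, armMean] using
    measure_uniform_lt (h.reward a n) (h.coin a n) (h.indep.indepFun (by simp)) hν

lemma IsSeed.measure_bit_eq_zero [IsProbabilityMeasure P] (h : IsSeed P ν ξ) {a : Fin K}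
    [IsProbabilityMeasure (ν a)] (hν : ∀ᵐ r ∂(ν a), r ∈ Set.Icc (0 : ℝ) 1) (n : ℕ) :
    P {ω | bit (fun s => ξ s ω) a n = 0} = ENNReal.ofReal (1 - armMean ν a) := by
  have compl_eq : {ω | bit (fun s => ξ s ω) a n = 0} = {ω | bit (fun s => ξ s ω) a n = 1}ᶜ := by
    ext ω
    simp only [bit, Set.mem_ofPred_eq, Set.mem_compl_iff]
    split_ifs <;> simp
  have hmeas : MeasurableSet {ω | bit (fun s => ξ s ω) a n = 1} :=
    h.measurable_pi (measurable_bit a n (measurableSet_singleton 1))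
  rw [compl_eq, prob_compl_eq_one_sub hmeas, h.measure_bit_eq_one hν,
    ENNReal.ofReal_sub _ (armMean_mem_Icc hν).1, ENNReal.ofReal_one]

lemma IsSeed.measure_successes_and_bit (h : IsSeed P ν ξ) (a : Fin K) (n i j : ℕ) :
    P {ω | successes (fun s => ξ s ω) a n = i ∧ bit (fun s => ξ s ω) a n = j} =
      P {ω | successes (fun s => ξ s ω) a n = i} * P {ω | bit (fun s => ξ s ω) a n = j} := by
  let T : Set (Seed K) := {.coin a n, .reward a n}
  refine measure_and_of_dependsOn h.measurable h.indep (S := Tᶜ) (T := T) disjoint_compl_left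
    (p := fun z => successes z a n = i) (r := fun z => bit z a n = j)
    ((measurable_successes a n).eq measurable_const) ((measurable_bit a n).eq measurable_const)
    (fun z z' hz => ?_) fun z z' hz => ?_
  · have : successes z a n = successes z' a n := Finset.sum_congr rfl fun k hk => by
      have hk := (Finset.mem_range.1 hk).ne
      rw [bit, bit, hz (.coin a k) (by simp [T, hk]), hz (.reward a k) (by simp [T, hk])]
    simp only [this]
  · simp only [bit, hz (.coin a n) (by simp [T]), hz (.reward a n) (by simp [T])]

lemma IsSeed.measure_successes_eq [IsProbabilityMeasure P] (h : IsSeed P ν ξ) {a : Fin K}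
    [IsProbabilityMeasure (ν a)] (hν : ∀ᵐ r ∂(ν a), r ∈ Set.Icc (0 : ℝ) 1) (n j : ℕ) :
    P {ω | successes (fun s => ξ s ω) a n = j} = ENNReal.ofReal (binomPmf n (armMean ν a) j) := by
  obtain ⟨hμ0, hμ1⟩ := armMean_mem_Icc hν
  induction n generalizing j with
  | zero => cases j <;> simp [successes, binomPmf]
  | succ n ih =>
    have failure (i : ℕ) : P {ω | successes (fun s => ξ s ω) a n = i ∧
        bit (fun s => ξ s ω) a n = 0} =
          ENNReal.ofReal ((1 - armMean ν a) * binomPmf n (armMean ν a) i) := by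
      rw [h.measure_successes_and_bit, ih, h.measure_bit_eq_zero hν, mul_comm,
        ENNReal.ofReal_mul (sub_nonneg.2 hμ1)]
    have success (i : ℕ) : P {ω | successes (fun s => ξ s ω) a n = i ∧
        bit (fun s => ξ s ω) a n = 1} =
          ENNReal.ofReal (armMean ν a * binomPmf n (armMean ν a) i) := by
      rw [h.measure_successes_and_bit, ih, h.measure_bit_eq_one hν, mul_comm,
        ENNReal.ofReal_mul hμ0]
    rcases j with - | j
    · rw [binomPmf_succ_zero, ← failure]
      simp only [successes_succ, Nat.add_eq_zero_iff]
    · rw [binomPmf_succ_succ, ENNReal.ofReal_add (mul_nonneg (sub_nonneg.2 hμ1)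
        (binomPmf_nonneg hμ0 hμ1 _ _)) (mul_nonneg hμ0 (binomPmf_nonneg hμ0 hμ1 _ _)),
        ← failure, ← success, ← measure_union]
      · congr 1
        ext ω
        have : bit (fun s => ξ s ω) a n ≤ 1 := by unfold bit; split_ifs <;> simp
        simp only [successes_succ, Set.mem_union, Set.mem_ofPred_eq]
        lia
      · exact Set.disjoint_left.2 fun ω h₀ h₁ => zero_ne_one (h₀.2.symm.trans h₁.2)
      · exact h.measurable_pi
          ((measurable_successes a n).eq measurable_const |>.and
            ((measurable_bit a n).eq measurable_const)).setOf

lemma IsSeed.measure_successes_mem_le [IsProbabilityMeasure P] (h : IsSeed P ν ξ) {a : Fin K}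
    [IsProbabilityMeasure (ν a)] (hν : ∀ᵐ r ∂(ν a), r ∈ Set.Icc (0 : ℝ) 1) (n : ℕ) (p : ℕ → Prop)
    [DecidablePred p] :
    P {ω | p (successes (fun s => ξ s ω) a n)} ≤
      ENNReal.ofReal (∑ j ∈ Finset.range (n + 1) with p j, binomPmf n (armMean ν a) j) := by
  obtain ⟨hμ0, hμ1⟩ := armMean_mem_Icc hν
  rw [ENNReal.ofReal_sum_of_nonneg fun j _ => binomPmf_nonneg hμ0 hμ1 n j]
  simp_rw [← h.measure_successes_eq hν]
  refine (measure_mono fun ω hω => ?_).trans (measure_biUnion_finset_le _ _)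
  simp only [Set.mem_iUnion, Finset.mem_filter, Finset.mem_range, exists_prop]
  exact ⟨_, ⟨Nat.lt_succ_of_le (successes_le _ a n), hω⟩, rfl⟩

end Successes

section Posterior

/-- The parameters of the posterior after `n` pulls with `j` successes are `alphaOf ε j + 1` and
`n - alphaOf ε j + 1`. -/
noncomputable def alphaOf (ε : ℝ) (j : ℕ) : ℕ := ⌊(j : ℝ) / (1 - ε)⌋₊

lemma alphaOf_le {ε : ℝ} (hε : ε < 1) {n j : ℕ} (hj : (j : ℝ) ≤ (1 - ε) * n) :
    alphaOf ε j ≤ n :=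
  Nat.floor_le_of_le ((div_le_iff₀' (sub_pos.2 hε)).2 hj)

lemma le_alphaOf {ε : ℝ} (hε0 : 0 ≤ ε) (hε1 : ε < 1) (j : ℕ) : j ≤ alphaOf ε j :=
  Nat.le_floor (le_div_self (Nat.cast_nonneg j) (sub_pos.2 hε1) (sub_le_self 1 hε0))

variable {K : ℕ}

/-- The posterior variate used for arm `a` in round `t` after `n` pulls with `j` successes, provided
that `j ≤ (1 - ε) * n`. -/
noncomputable def posteriorSeed (ε : ℝ) (t : ℕ) (a : Fin K) (n j : ℕ) : Seed K :=
  .posterior t a (alphaOf ε j + 1) (n + 2 - (alphaOf ε j + 1))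

lemma theta_eq_posteriorSeed {ε : ℝ} (hε : ε < 1) {z : Seed K → ℝ} (t : ℕ) {a : Fin K} {n j : ℕ}
    (hj : successes z a n = j) (hjn : (j : ℝ) ≤ (1 - ε) * n) :
    theta ε z t a n = (1 - ε) * z (posteriorSeed ε t a n j) := by
  have h : ¬ 1 - ε < empMean z a n := by
    rw [not_lt, empMean, hj]
    exact div_le_of_le_mul₀ (Nat.cast_nonneg n) (sub_pos.2 hε).le hjn
  rw [theta, if_neg h, alpha, hj, posteriorSeed, alphaOf]

variable {Ω : Type*} [MeasurableSpace Ω] {P : Measure Ω} {ν : Fin K → Measure ℝ}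
  {ξ : Seed K → Ω → ℝ}

lemma IsSeed.hasLaw_posteriorSeed (h : IsSeed P ν ξ) {ε : ℝ} (hε : ε < 1) (t : ℕ) (a : Fin K)
    {n j : ℕ} (hj : (j : ℝ) ≤ (1 - ε) * n) :
    HasLaw (ξ (posteriorSeed ε t a n j))
      (betaMeasure ((alphaOf ε j : ℝ) + 1) ((n - alphaOf ε j : ℕ) + 1)) P := by
  have hn : n + 2 - (alphaOf ε j + 1) = n - alphaOf ε j + 1 := by
    have := alphaOf_le hε hj
    lia
  rw [posteriorSeed, hn]
  exact_mod_cast h.posterior t a (alphaOf ε j + 1) (n - alphaOf ε j + 1) (by lia) (by lia)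

lemma IsSeed.measure_posteriorSeed_le (h : IsSeed P ν ξ) {ε : ℝ} (hε : ε < 1) (t : ℕ) (a : Fin K)
    {n j : ℕ} (hj : (j : ℝ) ≤ (1 - ε) * n) {q : ℝ} (hq0 : 0 ≤ q) (hq1 : q ≤ 1) :
    P {ω | ξ (posteriorSeed ε t a n j) ω ≤ q} =
      ENNReal.ofReal (1 - binomCdf (n + 1) q (alphaOf ε j)) := by
  rw [← betaMeasure_Iic (alphaOf_le hε hj) hq0 hq1]
  exact (h.hasLaw_posteriorSeed hε t a hj).measure_eq (p := (· ≤ q)) measurableSet_Iic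

lemma IsSeed.measure_le_posteriorSeed (h : IsSeed P ν ξ) {ε : ℝ} (hε : ε < 1) (t : ℕ) (a : Fin K)
    {n j : ℕ} (hj : (j : ℝ) ≤ (1 - ε) * n) {q : ℝ} (hq0 : 0 ≤ q) (hq1 : q ≤ 1) :
    P {ω | q ≤ ξ (posteriorSeed ε t a n j) ω} =
      ENNReal.ofReal (binomCdf (n + 1) q (alphaOf ε j)) := by
  rw [← betaMeasure_Ici (alphaOf_le hε hj) hq0 hq1]
  exact (h.hasLaw_posteriorSeed hε t a hj).measure_eq (p := (q ≤ ·)) measurableSet_Ici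

variable [NeZero K]

lemma IsSeed.measure_pulls_successes_posteriorSeed (h : IsSeed P ν ξ) (ε : ℝ) (t : ℕ) (a : Fin K)
    (n j : ℕ) {B : Set ℝ} (hB : MeasurableSet B) :
    P {ω | (pulls ε (fun s => ξ s ω) t a = n ∧ successes (fun s => ξ s ω) a n = j) ∧
        ξ (posteriorSeed ε t a n j) ω ∈ B} =
      P {ω | pulls ε (fun s => ξ s ω) t a = n ∧ successes (fun s => ξ s ω) a n = j} *
        P {ω | ξ (posteriorSeed ε t a n j) ω ∈ B} := by
  let s₀ : Seed K := posteriorSeed ε t a n j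
  refine measure_and_of_dependsOn h.measurable h.indep (S := {s₀}ᶜ) (T := {s₀}) disjoint_compl_left
    (p := fun z => pulls ε z t a = n ∧ successes z a n = j) (r := fun z => z s₀ ∈ B)
    (((measurable_pulls ε t a).eq measurable_const).and
      ((measurable_successes a n).eq measurable_const))
    (measurableSet_setOfPred.1 (measurable_pi_apply s₀ hB)) (fun z z' hz => ?_)
    fun z z' hz => by simp only [hz s₀ rfl]
  have pulls_eq : pulls ε z t a = pulls ε z' t a := dependsOn_pulls ε le_rfl a _ _ a hz
  have successes_eq : successes z a n = successes z' a n := dependsOn_successes t a _ _ a n hz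
  simp only [pulls_eq, successes_eq]

lemma IsSeed.measure_theta_mem_le [IsProbabilityMeasure P] (h : IsSeed P ν ξ) {ε : ℝ}
    (hε : ε < 1) (t : ℕ) (a : Fin K) {Q : ℕ → ℕ → Prop} {B : Set ℝ} (hB : MeasurableSet B)
    {c : ℝ≥0∞} (hQ : ∀ n j, Q n j → (j : ℝ) ≤ (1 - ε) * n)
    (hc : ∀ n j, n ≤ t → Q n j → P {ω | (1 - ε) * ξ (posteriorSeed ε t a n j) ω ∈ B} ≤ c) :
    P {ω | Q (pulls ε (fun s => ξ s ω) t a)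
          (successes (fun s => ξ s ω) a (pulls ε (fun s => ξ s ω) t a)) ∧
        theta ε (fun s => ξ s ω) t a (pulls ε (fun s => ξ s ω) t a) ∈ B} ≤ c := by
  let f : Ω → ℕ × ℕ := fun ω => (pulls ε (fun s => ξ s ω) t a,
    successes (fun s => ξ s ω) a (pulls ε (fun s => ξ s ω) t a))
  have hf : Measurable f := by
    have hN := (measurable_pulls ε t a).comp h.measurable_pi
    exact hN.prodMk <| measurable_comp_nat hN fun n =>
      (measurable_successes a n).comp h.measurable_pi
  let A : ℕ × ℕ → Set Ω := fun p =>
    {ω | Q p.1 p.2 ∧ (1 - ε) * ξ (posteriorSeed ε t a p.1 p.2) ω ∈ B}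
  refine (measure_mono fun ω hω => ?_).trans (measure_mem_comp_le (f := f) (A := A) hf ?_)
  · refine ⟨hω.1, ?_⟩
    rw [← theta_eq_posteriorSeed (z := fun s => ξ s ω) hε t rfl (hQ _ _ hω.1)]
    exact hω.2
  rintro ⟨n, j⟩
  by_cases hnj : n ≤ t ∧ Q n j
  · have fiber_eq : f ⁻¹' {(n, j)} =
        {ω | pulls ε (fun s => ξ s ω) t a = n ∧ successes (fun s => ξ s ω) a n = j} := by
      ext ω
      simp only [f, Set.mem_preimage, Set.mem_singleton_iff, Prod.mk.injEq, Set.mem_ofPred_eq]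
      exact and_congr_right fun hn => by rw [hn]
    calc P (f ⁻¹' {(n, j)} ∩ A (n, j))
        ≤ P {ω | (pulls ε (fun s => ξ s ω) t a = n ∧ successes (fun s => ξ s ω) a n = j) ∧
            ξ (posteriorSeed ε t a n j) ω ∈ ((1 - ε) * ·) ⁻¹' B} := by
          rw [fiber_eq]
          exact measure_mono fun ω hω => ⟨hω.1, hω.2.2⟩
      _ ≤ P (f ⁻¹' {(n, j)}) * c := by
          rw [h.measure_pulls_successes_posteriorSeed ε t a n j (measurable_const_mul _ hB),
            fiber_eq]
          exact mul_le_mul_right (hc n j hnj.1 hnj.2) _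
  · have : f ⁻¹' {(n, j)} ∩ A (n, j) = ∅ := by
      refine Set.eq_empty_of_forall_notMem fun ω hω => hnj ⟨?_, hω.2.1⟩
      have hn : pulls ε (fun s => ξ s ω) t a = n := congrArg Prod.fst hω.1
      exact hn ▸ pulls_le ε _ t a
    rw [this, measure_empty]
    exact zero_le

lemma IsSeed.measure_theta_le_le [IsProbabilityMeasure P] (h : IsSeed P ν ξ) {ε : ℝ} (hε : ε < 1)
    (t : ℕ) (a : Fin K) {Q : ℕ → ℕ → Prop} {q c : ℝ} (hq0 : 0 ≤ q) (hq1 : q ≤ 1)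
    (hQ : ∀ n j, Q n j → (j : ℝ) ≤ (1 - ε) * n)
    (hc : ∀ n j, n ≤ t → Q n j → 1 - binomCdf (n + 1) q (alphaOf ε j) ≤ c) :
    P {ω | Q (pulls ε (fun s => ξ s ω) t a)
          (successes (fun s => ξ s ω) a (pulls ε (fun s => ξ s ω) t a)) ∧
        theta ε (fun s => ξ s ω) t a (pulls ε (fun s => ξ s ω) t a) ≤ (1 - ε) * q} ≤
      ENNReal.ofReal c := by
  refine h.measure_theta_mem_le hε t a (B := Set.Iic ((1 - ε) * q)) measurableSet_Iic hQ ?_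
  intro n j hn hnj
  simp only [Set.mem_Iic, mul_le_mul_iff_right₀ (sub_pos.2 hε)]
  rw [h.measure_posteriorSeed_le hε t a (hQ n j hnj) hq0 hq1]
  exact ENNReal.ofReal_le_ofReal (hc n j hn hnj)

lemma IsSeed.measure_le_theta_le [IsProbabilityMeasure P] (h : IsSeed P ν ξ) {ε : ℝ} (hε : ε < 1)
    (t : ℕ) (a : Fin K) {Q : ℕ → ℕ → Prop} {q c : ℝ} (hq0 : 0 ≤ q) (hq1 : q ≤ 1)
    (hQ : ∀ n j, Q n j → (j : ℝ) ≤ (1 - ε) * n)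
    (hc : ∀ n j, n ≤ t → Q n j → binomCdf (n + 1) q (alphaOf ε j) ≤ c) :
    P {ω | Q (pulls ε (fun s => ξ s ω) t a)
          (successes (fun s => ξ s ω) a (pulls ε (fun s => ξ s ω) t a)) ∧
        (1 - ε) * q ≤ theta ε (fun s => ξ s ω) t a (pulls ε (fun s => ξ s ω) t a)} ≤
      ENNReal.ofReal c := by
  refine h.measure_theta_mem_le hε t a (B := Set.Ici ((1 - ε) * q)) measurableSet_Ici hQ ?_
  intro n j hn hnj
  simp only [Set.mem_Ici, mul_le_mul_iff_right₀ (sub_pos.2 hε)]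
  rw [h.measure_le_posteriorSeed hε t a (hQ n j hnj) hq0 hq1]
  exact ENNReal.ofReal_le_ofReal (hc n j hn hnj)

end Posterior

/-! ### Stalling rounds -/

section Stall

variable {K : ℕ} [NeZero K]

/-- The event that in round `t` the indices of all arms but `o` are at most `y`. -/
def OthersLow (ε : ℝ) (o : Fin K) (y : ℝ) (z : Seed K → ℝ) (t : ℕ) : Prop :=
  ∀ a, a ≠ o → theta ε z t a (pulls ε z t a) ≤ y

open Classical in
/-- The number of rounds before `t` in which arm `o` has been pulled `k` times so far, the indices
of all other arms are at most `y`, and nevertheless arm `o` is not played. -/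
noncomputable def stall (ε : ℝ) (o : Fin K) (y : ℝ) (z : Seed K → ℝ) (k t : ℕ) : ℕ :=
  ∑ r ∈ Finset.range t, if pulls ε z r o = k ∧ OthersLow ε o y z r ∧ action ε z r ≠ o then 1 else 0

open Classical in
/-- The number of rounds before `t` in which arm `a` is played with an index exceeding `y`. -/
noncomputable def overCount (ε y : ℝ) (z : Seed K → ℝ) (a : Fin K) (t : ℕ) : ℕ :=
  ∑ r ∈ Finset.range t, if action ε z r = a ∧ y < theta ε z r a (pulls ε z r a) then 1 else 0

lemma stall_succ_of_stalled {ε : ℝ} {o : Fin K} {y : ℝ} {z : Seed K → ℝ} {k t : ℕ}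
    (h : pulls ε z t o = k ∧ OthersLow ε o y z t ∧ action ε z t ≠ o) :
    stall ε o y z k (t + 1) = stall ε o y z k t + 1 := by
  rw [stall, Finset.sum_range_succ, if_pos h, stall]

lemma stall_succ_of_not_stalled {ε : ℝ} {o : Fin K} {y : ℝ} {z : Seed K → ℝ} {k t : ℕ}
    (h : ¬ (pulls ε z t o = k ∧ OthersLow ε o y z t ∧ action ε z t ≠ o)) :
    stall ε o y z k (t + 1) = stall ε o y z k t := by
  rw [stall, Finset.sum_range_succ, if_neg h, add_zero, stall]

lemma action_eq_or_lt_theta_or_othersLow (ε : ℝ) (o : Fin K) (y : ℝ) (z : Seed K → ℝ) (r : ℕ) :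
    action ε z r = o ∨
      (action ε z r ≠ o ∧ y < theta ε z r (action ε z r) (pulls ε z r (action ε z r))) ∨
      (OthersLow ε o y z r ∧ action ε z r ≠ o) := by
  by_cases hact : action ε z r = o
  · exact .inl hact
  by_cases hlow : OthersLow ε o y z r
  · exact .inr (.inr ⟨hlow, hact⟩)
  · unfold OthersLow at hlow
    push Not at hlow
    obtain ⟨b, -, hb⟩ := hlow
    exact .inr (.inl ⟨hact, hb.trans_le (theta_le_theta_action ε z r b)⟩)

lemma le_pulls_add_overCount_add_stall (ε : ℝ) (o : Fin K) (y : ℝ) (z : Seed K → ℝ) {n t : ℕ}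
    (hn : pulls ε z t o ≤ n) :
    t ≤ pulls ε z t o + ∑ a ∈ Finset.univ.erase o, overCount ε y z a t +
      ∑ k ∈ Finset.range (n + 1), stall ε o y z k t := by
  classical
  have sum_action : ∑ r ∈ Finset.range t, (if action ε z r = o then 1 else 0) = pulls ε z t o := by
    rw [sum_action_eq_sum_pulls ε z o (fun _ => 1) t, Finset.sum_const, Finset.card_range,
      smul_eq_mul, mul_one]
  simp only [overCount, stall]
  rw [Finset.sum_comm, Finset.sum_comm (s := Finset.range (n + 1)), ← sum_action,
    ← Finset.sum_add_distrib, ← Finset.sum_add_distrib]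
  calc t = ∑ r ∈ Finset.range t, 1 := by simp
    _ ≤ _ := Finset.sum_le_sum fun r hr => ?_
  have hrn : pulls ε z r o ≤ n := (pulls_mono ε z o (Finset.mem_range.1 hr).le).trans hn
  rcases action_eq_or_lt_theta_or_othersLow ε o y z r with hact | ⟨hact, hover⟩ | ⟨hlow, hact⟩
  · rw [if_pos hact]
    lia
  · refine le_add_of_le_of_nonneg (le_add_of_nonneg_of_le (Nat.zero_le _) ?_) (Nat.zero_le _)
    refine le_trans (le_of_eq ?_) (Finset.single_le_sum (fun _ _ => Nat.zero_le _)
      (Finset.mem_erase.2 ⟨hact, Finset.mem_univ (action ε z r)⟩))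
    rw [if_pos ⟨rfl, hover⟩]
  · refine le_add_of_nonneg_of_le (Nat.zero_le _) (le_trans (le_of_eq ?_) (Finset.single_le_sum
      (fun _ _ => Nat.zero_le _) (Finset.mem_range.2 (Nat.lt_succ_of_le hrn))))
    rw [if_pos ⟨rfl, hlow, hact⟩]

lemma exists_of_lt_overCount {ε y : ℝ} {z : Seed K → ℝ} {a : Fin K} {A t : ℕ}
    (h : A < overCount ε y z a t) :
    ∃ r < t, A ≤ pulls ε z r a ∧ y < theta ε z r a (pulls ε z r a) := by
  classical
  contrapose! h
  calc overCount ε y z a t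
      ≤ ∑ r ∈ Finset.range t,
          (if action ε z r = a then (if pulls ε z r a < A then 1 else 0) else 0) := by
        refine Finset.sum_le_sum fun r hr => ?_
        have := h r (Finset.mem_range.1 hr)
        grind
    _ = ∑ n ∈ Finset.range (pulls ε z t a), if n < A then 1 else 0 :=
        sum_action_eq_sum_pulls ε z a (fun n => if n < A then 1 else 0) t
    _ ≤ A := by
        rw [Finset.sum_boole, Nat.cast_id]
        refine (Finset.card_le_card fun n hn => ?_).trans (Finset.card_range A).le
        exact Finset.mem_range.2 (Finset.mem_filter.1 hn).2

lemma stall_eq_zero_of_lt_successes {ε y : ℝ} (hy : y ≤ 1 - ε) {o : Fin K}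
    {z : Seed K → ℝ} {k : ℕ} (hk : (1 - ε) * k < successes z o k) (t : ℕ) :
    stall ε o y z k t = 0 := by
  refine Finset.sum_eq_zero fun r _ => if_neg ?_
  rintro ⟨hpulls, hlow, hact⟩
  have hk0 : (0 : ℝ) < k := Nat.cast_pos.2 <| Nat.pos_of_ne_zero fun h0 => by
    simp [h0, successes] at hk
  have empMean_gt : 1 - ε < empMean z o k := by rwa [empMean, lt_div_iff₀ hk0]
  have index_le := (theta_le_theta_action ε z r o).trans (hlow _ hact)
  rw [hpulls, theta, if_pos empMean_gt] at index_le
  linarith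

lemma measurableSet_othersLow (ε : ℝ) (o : Fin K) (y : ℝ) (t : ℕ) :
    MeasurableSet {z : Seed K → ℝ | OthersLow ε o y z t} := by
  simp only [OthersLow, Set.ofPred_forall]
  exact .iInter fun a => .iInter fun _ => measurableSet_le (measurable_theta_pulls ε t a)
    measurable_const

lemma measurable_stall (ε : ℝ) (o : Fin K) (y : ℝ) (k t : ℕ) :
    Measurable fun z : Seed K → ℝ => stall ε o y z k t := by
  refine Finset.measurable_sum _ fun r _ => Measurable.ite ?_ measurable_const measurable_const
  exact (measurable_pulls ε r o (measurableSet_singleton k)).inter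
    ((measurableSet_othersLow ε o y r).inter
      (measurable_action ε r (measurableSet_singleton o).compl))

lemma action_congr {ε : ℝ} {z z' : Seed K → ℝ} {r t : ℕ} (hrt : r < t) {a : Fin K} {α β : ℕ}
    (h : ∀ s ∈ ({.posterior t a α β} : Set (Seed K))ᶜ, z s = z' s) :
    action ε z r = action ε z' r := by
  have pulls_eq (k) : pulls ε z r k = pulls ε z' r k := dependsOn_pulls ε hrt.le a α β k h
  have theta_eq (k n) : theta ε z r k n = theta ε z' r k n :=
    theta_congr (fun _ => h _ (by simp)) (fun _ => h _ (by simp))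
      fun _ _ => h _ (by simp [hrt.ne])
  have tie_eq (k) : z (.tie r k) = z' (.tie r k) := h _ (by simp)
  simp only [action, pulls_eq, theta_eq, tie_eq]

lemma othersLow_congr {ε : ℝ} {o : Fin K} {y : ℝ} {z z' : Seed K → ℝ} {r t : ℕ} (hrt : r ≤ t)
    {α β : ℕ} (h : ∀ s ∈ ({.posterior t o α β} : Set (Seed K))ᶜ, z s = z' s) :
    OthersLow ε o y z r ↔ OthersLow ε o y z' r := by
  have pulls_eq (k) : pulls ε z r k = pulls ε z' r k := dependsOn_pulls ε hrt o α β k h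
  refine forall_congr' fun a => imp_congr_right fun ha => ?_
  rw [pulls_eq, theta_congr (fun _ => h _ (by simp)) (fun _ => h _ (by simp))
    fun _ _ => h _ (by simp [ha])]

lemma stall_congr {ε : ℝ} {o : Fin K} {y : ℝ} {z z' : Seed K → ℝ} {k t α β : ℕ}
    (h : ∀ s ∈ ({.posterior t o α β} : Set (Seed K))ᶜ, z s = z' s) :
    stall ε o y z k t = stall ε o y z' k t := by
  classical
  refine Finset.sum_congr rfl fun r hr => ?_
  have hrt := Finset.mem_range.1 hr
  have pulls_eq : pulls ε z r o = pulls ε z' r o := dependsOn_pulls ε hrt.le o α β o h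
  simp only [pulls_eq, othersLow_congr hrt.le h, action_congr hrt h]

end Stall

section PosteriorWeight

variable {K : ℕ} {Ω : Type*} [MeasurableSpace Ω] {P : Measure Ω} {ν : Fin K → Measure ℝ}
  {ξ : Seed K → Ω → ℝ}

open Classical in
lemma IsSeed.lintegral_ite_posteriorSeed_le_one (h : IsSeed P ν ξ) {ε : ℝ} (hε : ε < 1) (t : ℕ)
    (a : Fin K) {n j : ℕ} (hj : (j : ℝ) ≤ (1 - ε) * n) {q : ℝ} (hq0 : 0 ≤ q) (hq1 : q ≤ 1) :
    ∫⁻ ω, (if ξ (posteriorSeed ε t a n j) ω ≤ q then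
      ENNReal.ofReal (Real.exp (binomCdf (n + 1) q (alphaOf ε j))) else 0) ∂P ≤ 1 := by
  set p := binomCdf (n + 1) q (alphaOf ε j) with hp
  have hmeas : MeasurableSet {ω | ξ (posteriorSeed ε t a n j) ω ≤ q} :=
    measurableSet_le (h.measurable _) measurable_const
  calc _ = ∫⁻ ω, {ω | ξ (posteriorSeed ε t a n j) ω ≤ q}.indicator
          (fun _ => ENNReal.ofReal (Real.exp p)) ω ∂P :=
        lintegral_congr fun ω => by simp [Set.indicator_apply]
    _ = ENNReal.ofReal (Real.exp p * (1 - p)) := by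
        rw [lintegral_indicator_const hmeas, h.measure_posteriorSeed_le hε t a hj hq0 hq1, ← hp,
          ENNReal.ofReal_mul (Real.exp_pos _).le]
    _ ≤ 1 := by
        rw [ENNReal.ofReal_le_one]
        calc Real.exp p * (1 - p) ≤ Real.exp p * Real.exp (-p) := by
              gcongr
              exact Real.one_sub_le_exp_neg p
          _ = 1 := by rw [← Real.exp_add, add_neg_cancel, Real.exp_zero]

end PosteriorWeight

section StallWeight

variable {K : ℕ} [NeZero K]

open Classical in
/-- On the event of `j` successes in `k` pulls of arm `o`, the exponential `exp (p * s)` of the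
number `s` of stalling rounds after the `k`-th pull. It is frozen once `s` has reached `m`, and
drops to `0` when arm `o` is pulled again before. -/
noncomputable def stallWeight (ε : ℝ) (o : Fin K) (y p : ℝ) (k j m : ℕ) (z : Seed K → ℝ) (t : ℕ) :
    ℝ≥0∞ :=
  if successes z o k = j then
    if m ≤ stall ε o y z k t then ENNReal.ofReal (Real.exp (p * m))
    else if pulls ε z t o ≤ k then ENNReal.ofReal (Real.exp (p * stall ε o y z k t)) else 0
  else 0

/-- The event that in round `t` the weight `stallWeight` changes: it either drops to `0`, because
the posterior sample of arm `o` exceeds `y`, or grows by a factor of at most `exp p`. -/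
def Critical (ε : ℝ) (o : Fin K) (y : ℝ) (k j m : ℕ) (z : Seed K → ℝ) (t : ℕ) : Prop :=
  successes z o k = j ∧ stall ε o y z k t < m ∧ pulls ε z t o = k ∧ OthersLow ε o y z t

lemma measurable_stallWeight (ε : ℝ) (o : Fin K) (y p : ℝ) (k j m t : ℕ) :
    Measurable fun z : Seed K → ℝ => stallWeight ε o y p k j m z t := by
  have measurable_exp : Measurable fun n : ℕ => ENNReal.ofReal (Real.exp (p * n)) :=
    measurable_of_countable _
  exact Measurable.ite (measurable_successes o k (measurableSet_singleton j))
    (Measurable.ite (measurable_stall ε o y k t (measurableSet_Ici (a := m))) measurable_const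
      (Measurable.ite (measurable_pulls ε t o (measurableSet_Iic (a := k)))
        (measurable_exp.comp (measurable_stall ε o y k t)) measurable_const))
    measurable_const

lemma measurableSet_critical (ε : ℝ) (o : Fin K) (y : ℝ) (k j m t : ℕ) :
    MeasurableSet {z : Seed K → ℝ | Critical ε o y k j m z t} :=
  (measurable_successes o k (measurableSet_singleton j)).inter
    ((measurable_stall ε o y k t (measurableSet_Iio (a := m))).inter
      ((measurable_pulls ε t o (measurableSet_singleton k)).inter
        (measurableSet_othersLow ε o y t)))

lemma stallWeight_congr {ε : ℝ} {o : Fin K} {y p : ℝ} {k j m t α β : ℕ} {z z' : Seed K → ℝ}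
    (h : ∀ s ∈ ({.posterior t o α β} : Set (Seed K))ᶜ, z s = z' s) :
    stallWeight ε o y p k j m z t = stallWeight ε o y p k j m z' t := by
  have pulls_eq : pulls ε z t o = pulls ε z' t o := dependsOn_pulls ε le_rfl o α β o h
  have successes_eq : successes z o k = successes z' o k := dependsOn_successes t o α β o k h
  simp only [stallWeight, pulls_eq, successes_eq, stall_congr h]

lemma critical_congr {ε : ℝ} {o : Fin K} {y : ℝ} {k j m t α β : ℕ} {z z' : Seed K → ℝ}
    (h : ∀ s ∈ ({.posterior t o α β} : Set (Seed K))ᶜ, z s = z' s) :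
    Critical ε o y k j m z t ↔ Critical ε o y k j m z' t := by
  have pulls_eq : pulls ε z t o = pulls ε z' t o := dependsOn_pulls ε le_rfl o α β o h
  have successes_eq : successes z o k = successes z' o k := dependsOn_successes t o α β o k h
  simp only [Critical, pulls_eq, successes_eq, stall_congr h, othersLow_congr le_rfl h]

lemma stallWeight_zero_le (ε : ℝ) (o : Fin K) (y p : ℝ) (k j m : ℕ) (z : Seed K → ℝ) :
    stallWeight ε o y p k j m z 0 ≤ {z | successes z o k = j}.indicator 1 z := by
  by_cases hj : successes z o k = j
  · rcases Nat.eq_zero_or_pos m with rfl | hm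
    · simp [stallWeight, hj]
    · simp [stallWeight, hj, stall, hm.ne', pulls]
  · simp [stallWeight, hj]

lemma stallWeight_succ_le_of_not_critical {ε : ℝ} {o : Fin K} {y p : ℝ} {k j m : ℕ}
    {z : Seed K → ℝ} {t : ℕ} (h : ¬ Critical ε o y k j m z t) :
    stallWeight ε o y p k j m z (t + 1) ≤ stallWeight ε o y p k j m z t := by
  by_cases hj : successes z o k = j
  swap
  · simp [stallWeight, hj]
  have pulls_le_succ : pulls ε z t o ≤ pulls ε z (t + 1) o := pulls_mono ε z o t.le_succ
  by_cases hs : pulls ε z t o = k ∧ OthersLow ε o y z t ∧ action ε z t ≠ o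
  · have hm : m ≤ stall ε o y z k t := not_lt.1 fun hlt => h ⟨hj, hlt, hs.1, hs.2.1⟩
    simp [stallWeight, hj, hm, stall_succ_of_stalled hs, hm.trans (Nat.le_succ _)]
  · simp only [stallWeight, stall_succ_of_not_stalled hs]
    split_ifs <;> first | exact le_rfl | exact zero_le | lia

lemma stallWeight_succ_le_of_critical {ε : ℝ} {o : Fin K} {y p : ℝ} (hp : 0 ≤ p) {k j m : ℕ}
    {z : Seed K → ℝ} {t : ℕ} (h : Critical ε o y k j m z t) :
    stallWeight ε o y p k j m z (t + 1) ≤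
      stallWeight ε o y p k j m z t * ENNReal.ofReal (Real.exp p) := by
  obtain ⟨hj, hm, hk, -⟩ := h
  have weight_eq : stallWeight ε o y p k j m z t * ENNReal.ofReal (Real.exp p) =
      ENNReal.ofReal (Real.exp (p * (stall ε o y z k t + 1))) := by
    simp only [stallWeight, hj, hm.not_ge, hk, le_refl, if_true, if_false]
    rw [← ENNReal.ofReal_mul (Real.exp_pos _).le, ← Real.exp_add]
    ring_nf
  have stall_le : stall ε o y z k (t + 1) ≤ stall ε o y z k t + 1 := by
    by_cases hs : pulls ε z t o = k ∧ OthersLow ε o y z t ∧ action ε z t ≠ o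
    · exact (stall_succ_of_stalled hs).le
    · exact (stall_succ_of_not_stalled hs).le.trans (Nat.le_succ _)
  rw [weight_eq, stallWeight, if_pos hj]
  split_ifs with hm'
  · gcongr
    exact_mod_cast hm'.trans stall_le
  · gcongr
    exact_mod_cast stall_le
  · exact zero_le

lemma stallWeight_succ_eq_zero {ε : ℝ} {o : Fin K} {y p : ℝ} {k j m : ℕ} {z : Seed K → ℝ} {t : ℕ}
    (h : Critical ε o y k j m z t) (hy : y < theta ε z t o (pulls ε z t o)) :
    stallWeight ε o y p k j m z (t + 1) = 0 := by
  obtain ⟨-, hm, hk, hlow⟩ := h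
  have action_eq : action ε z t = o := by
    by_contra hact
    exact (hy.trans_le (theta_le_theta_action ε z t o)).not_ge (hlow _ hact)
  have stall_eq : stall ε o y z k (t + 1) = stall ε o y z k t :=
    stall_succ_of_not_stalled fun hs => hs.2.2 action_eq
  have pulls_eq : pulls ε z (t + 1) o = k + 1 := by rw [pulls_succ, if_pos action_eq, hk]
  simp [stallWeight, stall_eq, hm, pulls_eq]

open Classical in
lemma stallWeight_succ_le {ε : ℝ} (hε : ε < 1) {o : Fin K} {y p : ℝ} (hp : 0 ≤ p) {k j : ℕ}
    (hjk : (j : ℝ) ≤ (1 - ε) * k) (m : ℕ) (z : Seed K → ℝ) (t : ℕ) :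
    stallWeight ε o y p k j m z (t + 1) ≤
      (if Critical ε o y k j m z t then 0 else stallWeight ε o y p k j m z t) +
      (if Critical ε o y k j m z t then stallWeight ε o y p k j m z t else 0) *
        (if z (posteriorSeed ε t o k j) ≤ y / (1 - ε) then ENNReal.ofReal (Real.exp p) else 0) := by
  by_cases h : Critical ε o y k j m z t
  · simp only [if_pos h, zero_add]
    split_ifs with hz
    · exact stallWeight_succ_le_of_critical hp h
    · rw [mul_zero, stallWeight_succ_eq_zero h]
      rw [h.2.2.1, theta_eq_posteriorSeed hε t h.1 hjk, mul_comm]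
      exact (div_lt_iff₀ (sub_pos.2 hε)).1 (not_le.1 hz)
  · simpa [if_neg h] using stallWeight_succ_le_of_not_critical h

variable {Ω : Type*} [MeasurableSpace Ω] {P : Measure Ω} {ν : Fin K → Measure ℝ}
  {ξ : Seed K → Ω → ℝ}

lemma IsSeed.lintegral_stallWeight_succ_le (h : IsSeed P ν ξ) {ε : ℝ} (hε : ε < 1) (o : Fin K)
    {y : ℝ} (hy0 : 0 ≤ y) (hy1 : y ≤ 1 - ε) {k j : ℕ} (hjk : (j : ℝ) ≤ (1 - ε) * k) (m t : ℕ) :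
    ∫⁻ ω, stallWeight ε o y (binomCdf (k + 1) (y / (1 - ε)) (alphaOf ε j)) k j m
        (fun s => ξ s ω) (t + 1) ∂P ≤
      ∫⁻ ω, stallWeight ε o y (binomCdf (k + 1) (y / (1 - ε)) (alphaOf ε j)) k j m
        (fun s => ξ s ω) t ∂P := by
  classical
  have hq0 : 0 ≤ y / (1 - ε) := div_nonneg hy0 (sub_pos.2 hε).le
  have hq1 : y / (1 - ε) ≤ 1 := (div_le_one (sub_pos.2 hε)).2 hy1
  set p := binomCdf (k + 1) (y / (1 - ε)) (alphaOf ε j)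
  let s₀ : Seed K := posteriorSeed ε t o k j
  let V : (Seed K → ℝ) → ℝ≥0∞ := fun z => stallWeight ε o y p k j m z t
  let G : (Seed K → ℝ) → ℝ≥0∞ := fun z => if Critical ε o y k j m z t then V z else 0
  let G' : (Seed K → ℝ) → ℝ≥0∞ := fun z => if Critical ε o y k j m z t then 0 else V z
  let H : (Seed K → ℝ) → ℝ≥0∞ := fun z =>
    if z s₀ ≤ y / (1 - ε) then ENNReal.ofReal (Real.exp p) else 0
  have hV : Measurable V := measurable_stallWeight ε o y p k j m t
  have hcrit := measurableSet_critical ε o y k j m t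
  have hG : Measurable G := hV.ite hcrit measurable_const
  have hG' : Measurable fun ω => G' fun s => ξ s ω :=
    (measurable_const.ite hcrit hV).comp h.measurable_pi
  have hH : Measurable H := measurable_const.ite
    (measurableSet_le (measurable_pi_apply s₀) measurable_const) measurable_const
  have factor := lintegral_mul_of_dependsOn h.measurable h.indep (S := {s₀}ᶜ) (T := {s₀})
    disjoint_compl_left hG hH
    (fun z z' hz => by simp only [G, V, critical_congr hz, stallWeight_congr hz])
    (fun z z' hz => by simp only [H, hz s₀ rfl])
  calc _ ≤ ∫⁻ ω, (G' (fun s => ξ s ω) + G (fun s => ξ s ω) * H (fun s => ξ s ω)) ∂P :=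
        lintegral_mono fun ω =>
          stallWeight_succ_le hε (binomCdf_nonneg hq0 hq1 _ _) hjk m (fun s => ξ s ω) t
    _ = ∫⁻ ω, G' (fun s => ξ s ω) ∂P +
          (∫⁻ ω, G (fun s => ξ s ω) ∂P) * ∫⁻ ω, H (fun s => ξ s ω) ∂P := by
        rw [lintegral_add_left hG', factor]
    _ ≤ ∫⁻ ω, G' (fun s => ξ s ω) ∂P + (∫⁻ ω, G (fun s => ξ s ω) ∂P) * 1 := by
        gcongr
        exact h.lintegral_ite_posteriorSeed_le_one hε t o hjk hq0 hq1
    _ = ∫⁻ ω, V (fun s => ξ s ω) ∂P := by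
        rw [mul_one, ← lintegral_add_left hG']
        refine lintegral_congr fun ω => ?_
        simp only [G, G']
        split_ifs <;> simp

lemma IsSeed.lintegral_stallWeight_le (h : IsSeed P ν ξ) {ε : ℝ} (hε : ε < 1) (o : Fin K)
    {y : ℝ} (hy0 : 0 ≤ y) (hy1 : y ≤ 1 - ε) {k j : ℕ} (hjk : (j : ℝ) ≤ (1 - ε) * k) (m t : ℕ) :
    ∫⁻ ω, stallWeight ε o y (binomCdf (k + 1) (y / (1 - ε)) (alphaOf ε j)) k j m
      (fun s => ξ s ω) t ∂P ≤ P {ω | successes (fun s => ξ s ω) o k = j} := by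
  induction t with
  | zero =>
    have hmeas : MeasurableSet {ω | successes (fun s => ξ s ω) o k = j} :=
      h.measurable_pi (measurable_successes o k (measurableSet_singleton j))
    rw [← lintegral_indicator_one hmeas]
    exact lintegral_mono fun ω => stallWeight_zero_le ε o y _ k j m fun s => ξ s ω
  | succ t ih => exact (h.lintegral_stallWeight_succ_le hε o hy0 hy1 hjk m t).trans ih

lemma IsSeed.measure_successes_and_le_stall_le (h : IsSeed P ν ξ) {ε : ℝ} (hε : ε < 1) (o : Fin K)
    {y : ℝ} (hy0 : 0 ≤ y) (hy1 : y ≤ 1 - ε) (k j : ℕ) {m : ℕ} (hm : 1 ≤ m) (t : ℕ) :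
    P {ω | successes (fun s => ξ s ω) o k = j ∧ m ≤ stall ε o y (fun s => ξ s ω) k t} ≤
      P {ω | successes (fun s => ξ s ω) o k = j} *
        ENNReal.ofReal (Real.exp (-(binomCdf (k + 1) (y / (1 - ε)) (alphaOf ε j) * m))) := by
  rcases le_or_gt (j : ℝ) ((1 - ε) * k) with hjk | hjk
  · set p := binomCdf (k + 1) (y / (1 - ε)) (alphaOf ε j)
    have exp_ne_zero : ENNReal.ofReal (Real.exp (p * m)) ≠ 0 := by simpa using Real.exp_pos _
    rw [Real.exp_neg, ENNReal.ofReal_inv_of_pos (Real.exp_pos _), ← div_eq_mul_inv,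
      ENNReal.le_div_iff_mul_le (.inl exp_ne_zero) (.inl ENNReal.ofReal_ne_top), mul_comm]
    calc _ ≤ ENNReal.ofReal (Real.exp (p * m)) * P {ω | ENNReal.ofReal (Real.exp (p * m)) ≤
          stallWeight ε o y p k j m (fun s => ξ s ω) t} := by
          gcongr
          rintro ⟨hj, hstall⟩
          simp [stallWeight, hj, hstall]
      _ ≤ ∫⁻ ω, stallWeight ε o y p k j m (fun s => ξ s ω) t ∂P :=
          mul_meas_ge_le_lintegral
            ((measurable_stallWeight ε o y p k j m t).comp h.measurable_pi) _
      _ ≤ _ := h.lintegral_stallWeight_le hε o hy0 hy1 hjk m t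
  · have : {ω | successes (fun s => ξ s ω) o k = j ∧ m ≤ stall ε o y (fun s => ξ s ω) k t} = ∅ := by
      refine Set.eq_empty_of_forall_notMem fun ω hω => ?_
      have stall_eq := stall_eq_zero_of_lt_successes hy1 (o := o) (z := fun s => ξ s ω)
        (hω.1 ▸ hjk) t
      have := hω.2
      lia
    rw [this, measure_empty]
    exact zero_le

lemma IsSeed.measure_le_stall_le [IsProbabilityMeasure P] (h : IsSeed P ν ξ) {o : Fin K}
    [IsProbabilityMeasure (ν o)] (hν : ∀ᵐ r ∂(ν o), r ∈ Set.Icc (0 : ℝ) 1) {ε : ℝ} (hε : ε < 1)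
    {y : ℝ} (hy0 : 0 ≤ y) (hy1 : y ≤ 1 - ε) (k : ℕ) {m : ℕ} (hm : 1 ≤ m) (t : ℕ) :
    P {ω | m ≤ stall ε o y (fun s => ξ s ω) k t} ≤
      ENNReal.ofReal (∑ j ∈ Finset.range (k + 1), binomPmf k (armMean ν o) j *
        Real.exp (-(binomCdf (k + 1) (y / (1 - ε)) (alphaOf ε j) * m))) := by
  obtain ⟨hμ0, hμ1⟩ := armMean_mem_Icc hν
  rw [ENNReal.ofReal_sum_of_nonneg fun j _ =>
    mul_nonneg (binomPmf_nonneg hμ0 hμ1 k j) (Real.exp_pos _).le]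
  calc P {ω | m ≤ stall ε o y (fun s => ξ s ω) k t}
      ≤ P (⋃ j ∈ Finset.range (k + 1), {ω | successes (fun s => ξ s ω) o k = j ∧
          m ≤ stall ε o y (fun s => ξ s ω) k t}) := by
        refine measure_mono fun ω hω => ?_
        simp only [Set.mem_iUnion, exists_prop]
        exact ⟨_, Finset.mem_range.2 (Nat.lt_succ_of_le (successes_le _ o k)), rfl, hω⟩
    _ ≤ ∑ j ∈ Finset.range (k + 1), P {ω | successes (fun s => ξ s ω) o k = j ∧
          m ≤ stall ε o y (fun s => ξ s ω) k t} := measure_biUnion_finset_le _ _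
    _ ≤ _ := by
        refine Finset.sum_le_sum fun j _ => ?_
        rw [ENNReal.ofReal_mul (binomPmf_nonneg hμ0 hμ1 k j), ← h.measure_successes_eq hν]
        exact h.measure_successes_and_le_stall_le hε o hy0 hy1 k j hm t

end StallWeight

section LargeIndex

lemma binomCdf_alphaOf_le {ε x σ y : ℝ} (hε0 : 0 ≤ ε) (hε : ε < 1) (hx : 0 ≤ x) (hσ : 0 ≤ σ)
    (hxy : x + σ ≤ y) (hy : y ≤ 1 - ε) {n j : ℕ} (hj : (j : ℝ) ≤ x * n) :
    binomCdf (n + 1) (y / (1 - ε)) (alphaOf ε j) ≤ Real.exp (-(2 * (n + 1 : ℕ) * σ ^ 2)) := by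
  have h1ε : 0 < 1 - ε := sub_pos.2 hε
  have mean_le : x / (1 - ε) ≤ y / (1 - ε) - σ := by
    rw [div_le_iff₀ h1ε, sub_mul, div_mul_cancel₀ _ h1ε.ne']
    nlinarith
  rw [← neg_sq σ]
  refine sum_binomPmf_le_exp_neg_sq (div_nonneg (by linarith) h1ε.le) ((div_le_one h1ε).2 hy)
    fun i hi => ?_
  have i_le : (i : ℝ) ≤ x / (1 - ε) * n := by
    calc (i : ℝ) ≤ alphaOf ε j := by exact_mod_cast Nat.lt_succ_iff.1 (Finset.mem_range.1 hi)
      _ ≤ j / (1 - ε) := Nat.floor_le (by positivity)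
      _ ≤ x / (1 - ε) * n := by rw [div_mul_eq_mul_div]; gcongr
  refine mul_le_mul_of_nonpos_left (i_le.trans ?_) (neg_nonpos.2 hσ)
  have : 0 ≤ x / (1 - ε) := by positivity
  push_cast
  nlinarith [(Nat.cast_nonneg n : (0 : ℝ) ≤ n)]

variable {K : ℕ} [NeZero K] {Ω : Type*} [MeasurableSpace Ω] {P : Measure Ω} {ν : Fin K → Measure ℝ}
  {ξ : Seed K → Ω → ℝ}

/-- Bounds deviations above the mean (`0 < σ`) and below it (`σ < 0`). -/
lemma IsSeed.measure_successes_pulls_deviation_le [IsProbabilityMeasure P] (h : IsSeed P ν ξ)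
    {a : Fin K} [IsProbabilityMeasure (ν a)] (hν : ∀ᵐ r ∂(ν a), r ∈ Set.Icc (0 : ℝ) 1)
    (ε σ A : ℝ) (t : ℕ) :
    P {ω | A ≤ pulls ε (fun s => ξ s ω) t a ∧
        σ * (pulls ε (fun s => ξ s ω) t a * (armMean ν a + σ)) ≤
          σ * successes (fun s => ξ s ω) a (pulls ε (fun s => ξ s ω) t a)} ≤
      ENNReal.ofReal ((t + 1) * Real.exp (-(2 * A * σ ^ 2))) := by
  classical
  obtain ⟨hμ0, hμ1⟩ := armMean_mem_Icc hν
  have tail (n : ℕ) (hn : A ≤ n) :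
      P {ω | σ * (n * (armMean ν a + σ)) ≤ σ * successes (fun s => ξ s ω) a n} ≤
        ENNReal.ofReal (Real.exp (-(2 * A * σ ^ 2))) := by
    refine (h.measure_successes_mem_le hν n
      fun j => σ * (n * (armMean ν a + σ)) ≤ σ * j).trans (ENNReal.ofReal_le_ofReal ?_)
    calc _ ≤ Real.exp (-(2 * n * σ ^ 2)) :=
          sum_binomPmf_le_exp_neg_sq hμ0 hμ1 fun j hj => (Finset.mem_filter.1 hj).2
      _ ≤ _ := by gcongr
  calc _ ≤ P (⋃ n ∈ (Finset.range (t + 1)).filter (fun n : ℕ => A ≤ n),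
          {ω | σ * (n * (armMean ν a + σ)) ≤ σ * successes (fun s => ξ s ω) a n}) := by
        refine measure_mono fun ω hω => ?_
        simp only [Set.mem_iUnion, Finset.mem_filter, Finset.mem_range, exists_prop]
        exact ⟨_, ⟨Nat.lt_succ_of_le (pulls_le ε _ t a), hω.1⟩, hω.2⟩
    _ ≤ ∑ n ∈ (Finset.range (t + 1)).filter (fun n : ℕ => A ≤ n),
          ENNReal.ofReal (Real.exp (-(2 * A * σ ^ 2))) :=
        (measure_biUnion_finset_le _ _).trans
          (Finset.sum_le_sum fun n hn => tail n (Finset.mem_filter.1 hn).2)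
    _ ≤ ∑ n ∈ Finset.range (t + 1), ENNReal.ofReal (Real.exp (-(2 * A * σ ^ 2))) := by
        gcongr
        exact Finset.filter_subset _ _
    _ = _ := by
        rw [Finset.sum_const, Finset.card_range, nsmul_eq_mul, ← ENNReal.ofReal_natCast,
          ← ENNReal.ofReal_mul (Nat.cast_nonneg _), Nat.cast_add_one]

lemma IsSeed.measure_lt_theta_le [IsProbabilityMeasure P] (h : IsSeed P ν ξ) {a : Fin K}
    [IsProbabilityMeasure (ν a)] (hν : ∀ᵐ r ∂(ν a), r ∈ Set.Icc (0 : ℝ) 1) {ε σ y : ℝ}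
    (hε0 : 0 ≤ ε) (hε : ε < 1) (hσ : 0 ≤ σ) (hy : armMean ν a + 2 * σ ≤ y) (hy1 : y ≤ 1 - ε)
    (A t : ℕ) :
    P {ω | A ≤ pulls ε (fun s => ξ s ω) t a ∧
        y < theta ε (fun s => ξ s ω) t a (pulls ε (fun s => ξ s ω) t a)} ≤
      ENNReal.ofReal ((t + 2) * Real.exp (-(2 * A * σ ^ 2))) := by
  have hμ0 := (armMean_mem_Icc hν).1
  have h1ε : 0 < 1 - ε := sub_pos.2 hε
  set μ := armMean ν a
  let Q : ℕ → ℕ → Prop := fun n j => A ≤ n ∧ (j : ℝ) ≤ (μ + σ) * n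
  have small_mean := h.measure_le_theta_le hε t a (Q := Q) (q := y / (1 - ε))
    (c := Real.exp (-(2 * A * σ ^ 2))) (div_nonneg (by linarith) h1ε.le) ((div_le_one h1ε).2 hy1)
    (fun n j hQ => hQ.2.trans (by gcongr; linarith)) fun n j _ hQ => by
      refine (binomCdf_alphaOf_le hε0 hε (by linarith) hσ (by linarith) hy1 hQ.2).trans ?_
      gcongr
      exact hQ.1.trans n.le_succ
  rw [mul_div_cancel₀ _ h1ε.ne'] at small_mean
  calc _ ≤ _ := (measure_mono fun ω hω => ?_).trans ((measure_union_le _ _).trans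
        (add_le_add (h.measure_successes_pulls_deviation_le hν ε σ A t) small_mean))
    _ = _ := by
        rw [← ENNReal.ofReal_add (by positivity) (by positivity)]
        ring_nf
  rcases le_or_gt (pulls ε (fun s => ξ s ω) t a * (μ + σ))
    (successes (fun s => ξ s ω) a (pulls ε (fun s => ξ s ω) t a) : ℝ) with hs | hs
  · exact .inl ⟨by exact_mod_cast hω.1, mul_le_mul_of_nonneg_left hs hσ⟩
  · exact .inr ⟨⟨hω.1, (mul_comm (μ + σ) _ ▸ hs.le)⟩, hω.2.le⟩

end LargeIndex

/-! ### The number of pulls of the best arm -/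

section FewPulls

variable {K : ℕ} [NeZero K] {Ω : Type*} [MeasurableSpace Ω] {P : Measure Ω} {ν : Fin K → Measure ℝ}
  {ξ : Seed K → Ω → ℝ}

lemma IsSeed.measure_exists_lt_theta_le [IsProbabilityMeasure P] (h : IsSeed P ν ξ) {a : Fin K}
    [IsProbabilityMeasure (ν a)] (hν : ∀ᵐ r ∂(ν a), r ∈ Set.Icc (0 : ℝ) 1) {ε σ y : ℝ}
    (hε0 : 0 ≤ ε) (hε : ε < 1) (hσ : 0 ≤ σ) (hy : armMean ν a + 2 * σ ≤ y) (hy1 : y ≤ 1 - ε)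
    (A t : ℕ) :
    P {ω | ∃ r < t, A ≤ pulls ε (fun s => ξ s ω) r a ∧
        y < theta ε (fun s => ξ s ω) r a (pulls ε (fun s => ξ s ω) r a)} ≤
      ENNReal.ofReal (t * ((t + 2) * Real.exp (-(2 * A * σ ^ 2)))) := by
  calc _ ≤ P (⋃ r ∈ Finset.range t, {ω | A ≤ pulls ε (fun s => ξ s ω) r a ∧
          y < theta ε (fun s => ξ s ω) r a (pulls ε (fun s => ξ s ω) r a)}) := by
        refine measure_mono ?_
        rintro ω ⟨r, hr, hω⟩
        simp only [Set.mem_iUnion, exists_prop]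
        exact ⟨r, Finset.mem_range.2 hr, hω⟩
    _ ≤ ∑ r ∈ Finset.range t, ENNReal.ofReal ((t + 2) * Real.exp (-(2 * A * σ ^ 2))) := by
        refine (measure_biUnion_finset_le _ _).trans (Finset.sum_le_sum fun r hr => ?_)
        refine (h.measure_lt_theta_le hν hε0 hε hσ hy hy1 A r).trans (ENNReal.ofReal_le_ofReal ?_)
        have : (r : ℝ) ≤ t := by exact_mod_cast (Finset.mem_range.1 hr).le
        gcongr
    _ = _ := by
        rw [Finset.sum_const, Finset.card_range, nsmul_eq_mul, ← ENNReal.ofReal_natCast,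
          ← ENNReal.ofReal_mul (Nat.cast_nonneg _)]

lemma le_of_overCount_le_of_stall_le {ε : ℝ} {o : Fin K} {y : ℝ} {z : Seed K → ℝ} {n A m t : ℕ}
    (hn : pulls ε z t o ≤ n) (hover : ∀ a ≠ o, overCount ε y z a t ≤ A)
    (hstall : ∀ k ≤ n, stall ε o y z k t ≤ m) : t ≤ n + K * A + (n + 1) * m := by
  have sum_over : ∑ a ∈ Finset.univ.erase o, overCount ε y z a t ≤ K * A := by
    calc _ ≤ ∑ _a ∈ Finset.univ.erase o, A :=
          Finset.sum_le_sum fun a ha => hover a (Finset.ne_of_mem_erase ha)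
      _ ≤ ∑ _a : Fin K, A := Finset.sum_le_sum_of_subset (Finset.erase_subset _ _)
      _ = K * A := by simp
  have sum_stall : ∑ k ∈ Finset.range (n + 1), stall ε o y z k t ≤ (n + 1) * m := by
    calc _ ≤ ∑ _k ∈ Finset.range (n + 1), m :=
          Finset.sum_le_sum fun k hk => hstall k (Nat.lt_succ_iff.1 (Finset.mem_range.1 hk))
      _ = _ := by simp
  have := le_pulls_add_overCount_add_stall ε o y z hn
  lia

lemma IsSeed.measure_pulls_le [IsProbabilityMeasure P] (h : IsSeed P ν ξ)
    [hp : ∀ a, IsProbabilityMeasure (ν a)] (hν : ∀ a, ∀ᵐ r ∂(ν a), r ∈ Set.Icc (0 : ℝ) 1)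
    {ε σ y B : ℝ} (hε0 : 0 ≤ ε) (hε : ε < 1) (hσ : 0 ≤ σ) (hy0 : 0 ≤ y) (hy1 : y ≤ 1 - ε)
    (hB : 0 ≤ B) {o : Fin K} (hy : ∀ a ≠ o, armMean ν a + 2 * σ ≤ y) {n A m t : ℕ} (hm : 1 ≤ m)
    (hlaplace : ∀ k, ∑ j ∈ Finset.range (k + 1), binomPmf k (armMean ν o) j *
      Real.exp (-(binomCdf (k + 1) (y / (1 - ε)) (alphaOf ε j) * m)) ≤ B)
    (ht : n + K * A + (n + 1) * m < t) :
    P {ω | pulls ε (fun s => ξ s ω) t o ≤ n} ≤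
      ENNReal.ofReal (K * (t * ((t + 2) * Real.exp (-(2 * A * σ ^ 2)))) + (n + 1) * B) := by
  set D : ℝ := t * ((t + 2) * Real.exp (-(2 * A * σ ^ 2)))
  calc _ ≤ P ((⋃ a ∈ Finset.univ.erase o, {ω | ∃ r < t, A ≤ pulls ε (fun s => ξ s ω) r a ∧
            y < theta ε (fun s => ξ s ω) r a (pulls ε (fun s => ξ s ω) r a)}) ∪
        ⋃ k ∈ Finset.range (n + 1), {ω | m ≤ stall ε o y (fun s => ξ s ω) k t}) := by
        refine measure_mono fun ω hω => ?_
        by_contra hcon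
        simp only [Set.mem_union, Set.mem_iUnion, exists_prop, not_or, not_exists, not_and,
          Finset.mem_erase, Finset.mem_univ, and_true, Finset.mem_range, Nat.lt_succ_iff] at hcon
        refine ht.not_ge (le_of_overCount_le_of_stall_le hω (fun a ha => not_lt.1 fun hlt => ?_)
          fun k hk => (not_le.1 (hcon.2 k hk)).le)
        exact hcon.1 a ha (exists_of_lt_overCount hlt)
    _ ≤ ∑ _a ∈ Finset.univ.erase o, ENNReal.ofReal D +
          ∑ _k ∈ Finset.range (n + 1), ENNReal.ofReal B :=
        (measure_union_le _ _).trans (add_le_add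
          ((measure_biUnion_finset_le _ _).trans (Finset.sum_le_sum fun a ha =>
            h.measure_exists_lt_theta_le (hν a) hε0 hε hσ (hy a (Finset.ne_of_mem_erase ha)) hy1
              A t))
          ((measure_biUnion_finset_le _ _).trans (Finset.sum_le_sum fun k _ =>
            (h.measure_le_stall_le (hν o) hε hy0 hy1 k hm t).trans
              (ENNReal.ofReal_le_ofReal (hlaplace k)))))
    _ ≤ ∑ _a : Fin K, ENNReal.ofReal D + ∑ _k ∈ Finset.range (n + 1), ENNReal.ofReal B := by
        gcongr
        exact Finset.erase_subset _ _
    _ = _ := by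
        rw [Finset.sum_const, Finset.sum_const, Finset.card_range, Finset.card_univ,
          Fintype.card_fin, nsmul_eq_mul, nsmul_eq_mul, ← ENNReal.ofReal_natCast,
          ← ENNReal.ofReal_natCast, ← ENNReal.ofReal_mul (Nat.cast_nonneg _),
          ← ENNReal.ofReal_mul (Nat.cast_nonneg _), ← ENNReal.ofReal_add (by positivity)
            (by positivity), Nat.cast_add_one]

end FewPulls

section BlockSizes

lemma eventually_mul_rpow_le {b : ℝ} (hb : b < 1) (c : ℝ) :
    ∀ᶠ t : ℕ in Filter.atTop, c * ((t : ℝ) + 1) ^ b ≤ t + 1 := by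
  have ratio : Filter.Tendsto (fun t : ℕ => c * ((t : ℝ) + 1) ^ (-(1 - b))) Filter.atTop
      (nhds (c * 0)) :=
    ((tendsto_rpow_neg_atTop (sub_pos.2 hb)).comp (Filter.tendsto_atTop_add_const_right _ _
      tendsto_natCast_atTop_atTop)).const_mul c
  filter_upwards [ratio.eventually (ge_mem_nhds (by simp : c * 0 < 1))] with t ht
  have t_pos : (0 : ℝ) < t + 1 := by positivity
  calc c * ((t : ℝ) + 1) ^ b = c * ((t : ℝ) + 1) ^ (-(1 - b)) * (t + 1) := by
        rw [mul_assoc, ← Real.rpow_add_one t_pos.ne']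
        congr 2
        ring
    _ ≤ t + 1 := mul_le_of_le_one_left t_pos.le ht

lemma floor_add_mul_floor_add_mul_ceil_lt {b τ : ℝ} {K : ℕ} (hb : 0 ≤ b) (hK : 0 < K)
    (hτ : 7 ≤ τ) (hτb : 16 * τ ^ b ≤ τ) :
    (⌊τ ^ b⌋₊ : ℝ) + K * ⌊τ / (4 * K)⌋₊ + (⌊τ ^ b⌋₊ + 1) * ⌈τ ^ (1 - b) / 8⌉₊ + 1 < τ := by
  have τ_pos : 0 < τ := by linarith
  have one_le : 1 ≤ τ ^ b := Real.one_le_rpow (by linarith) hb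
  have rpow_pos : 0 < τ ^ (1 - b) := Real.rpow_pos_of_pos τ_pos _
  have rpow_mul : τ ^ b * τ ^ (1 - b) = τ := by
    rw [← Real.rpow_add τ_pos, add_sub_cancel, Real.rpow_one]
  have rpow_le : τ ^ (1 - b) ≤ τ := by
    nlinarith
  have mul_floor_le : (K : ℝ) * ⌊τ / (4 * K)⌋₊ ≤ τ / 4 := by
    calc (K : ℝ) * ⌊τ / (4 * K)⌋₊ ≤ K * (τ / (4 * K)) := by
          gcongr
          exact Nat.floor_le (by positivity)
      _ = τ / 4 := by field_simp
  have mul_ceil_le : ((⌊τ ^ b⌋₊ : ℝ) + 1) * ⌈τ ^ (1 - b) / 8⌉₊ ≤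
      (τ ^ b + 1) * (τ ^ (1 - b) / 8 + 1) := by
    gcongr
    · exact Nat.floor_le (by positivity)
    · exact (Nat.ceil_lt_add_one (by positivity)).le
  linarith [Nat.floor_le (one_le.trans' zero_le_one)]

lemma exp_neg_floor_le {K : ℕ} (hK : 0 < K) (σ : ℝ) (t : ℕ) :
    Real.exp (-(2 * (⌊((t : ℝ) + 1) / (4 * K)⌋₊ : ℝ) * σ ^ 2)) ≤
      Real.exp (2 * σ ^ 2) * Real.exp (-(σ ^ 2 / (2 * K))) ^ (t + 1) := by
  have : (0 : ℝ) < K := by exact_mod_cast hK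
  rw [← Real.exp_nat_mul, ← Real.exp_add]
  refine Real.exp_le_exp.2 ?_
  have exponent : ((t + 1 : ℕ) : ℝ) * -(σ ^ 2 / (2 * K)) =
      -(2 * (((t : ℝ) + 1) / (4 * K)) * σ ^ 2) := by
    push_cast
    field_simp
    ring
  rw [exponent]
  nlinarith [sq_nonneg σ, Nat.lt_floor_add_one (((t : ℝ) + 1) / (4 * K))]

lemma floor_add_one_mul_ceil_rpow_le {b γ τ : ℝ} (hb : 0 ≤ b) (hγ : 0 ≤ γ) (hτ : 1 ≤ τ) :
    ((⌊τ ^ b⌋₊ : ℝ) + 1) * (⌈τ ^ (1 - b) / 8⌉₊ : ℝ) ^ (-γ) ≤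
      2 * 8 ^ γ * τ ^ (b - (1 - b) * γ) := by
  have τ_pos : 0 < τ := by linarith
  have rpow_pos : 0 < τ ^ (1 - b) := Real.rpow_pos_of_pos τ_pos _
  have ceil_rpow_le : (⌈τ ^ (1 - b) / 8⌉₊ : ℝ) ^ (-γ) ≤ 8 ^ γ * τ ^ (-((1 - b) * γ)) := by
    calc (⌈τ ^ (1 - b) / 8⌉₊ : ℝ) ^ (-γ) ≤ (τ ^ (1 - b) / 8) ^ (-γ) :=
          Real.rpow_le_rpow_of_nonpos (by positivity) (Nat.le_ceil _) (by linarith)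
      _ = 8 ^ γ * τ ^ (-((1 - b) * γ)) := by
          rw [Real.div_rpow rpow_pos.le (by norm_num), ← Real.rpow_mul τ_pos.le,
            Real.rpow_neg (by norm_num : (0 : ℝ) ≤ 8), div_inv_eq_mul, mul_comm, mul_neg]
  calc ((⌊τ ^ b⌋₊ : ℝ) + 1) * (⌈τ ^ (1 - b) / 8⌉₊ : ℝ) ^ (-γ)
      ≤ (2 * τ ^ b) * (8 ^ γ * τ ^ (-((1 - b) * γ))) := by
        gcongr
        linarith [Nat.floor_le (Real.rpow_nonneg τ_pos.le b), Real.one_le_rpow hτ hb]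
    _ = 2 * 8 ^ γ * (τ ^ b * τ ^ (-((1 - b) * γ))) := by ring
    _ = _ := by rw [← Real.rpow_add τ_pos, ← sub_eq_add_neg]

/-- The bound on the probability that the best arm is pulled at most `(t + 1) ^ b` times in `t`
rounds, where `b = (γ - 1) / (2 (γ + 1))`, obtained from the block sizes `⌊(t + 1) ^ b⌋`,
`⌊(t + 1) / (4 K)⌋` and `⌈(t + 1) ^ (1 - b) / 8⌉`. -/
noncomputable def fewPullsBound (K : ℕ) (γ C σ : ℝ) (t : ℕ) : ℝ :=
  K * Real.exp (2 * σ ^ 2) *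
      (((t + 1 : ℕ) : ℝ) ^ 2 * Real.exp (-(σ ^ 2 / (2 * K))) ^ (t + 1)) +
    2 * C * 8 ^ γ * ((t + 1 : ℕ) : ℝ) ^ (-((γ + 1) / 2))

lemma fewPullsBound_nonneg {C : ℝ} (hC : 0 ≤ C) (K : ℕ) (γ σ : ℝ) (t : ℕ) :
    0 ≤ fewPullsBound K γ C σ t := by
  unfold fewPullsBound
  positivity

lemma summable_fewPullsBound {K : ℕ} (hK : 0 < K) {γ σ : ℝ} (hγ : 1 < γ) (hσ : 0 < σ) (C : ℝ) :
    Summable (fewPullsBound K γ C σ) := by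
  have ratio_lt_one : Real.exp (-(σ ^ 2 / (2 * K))) < 1 := by
    rw [Real.exp_lt_one_iff, neg_lt_zero]
    positivity
  refine .add (.mul_left _ ?_) (.mul_left _ ?_)
  · exact (summable_nat_add_iff (f := fun t : ℕ => (t : ℝ) ^ 2 *
      Real.exp (-(σ ^ 2 / (2 * K))) ^ t) 1).2 (summable_pow_mul_geometric_of_norm_lt_one 2
        (by rwa [Real.norm_of_nonneg (Real.exp_pos _).le]))
  · exact (summable_nat_add_iff (f := fun t : ℕ => (t : ℝ) ^ (-((γ + 1) / 2))) 1).2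
      (Real.summable_nat_rpow.2 (by linarith))

lemma le_fewPullsBound {γ C : ℝ} (hγ : 1 < γ) (hC : 0 ≤ C) {K : ℕ} (hK : 0 < K) (σ : ℝ) {b : ℝ}
    (hb : b = (γ - 1) / (2 * (γ + 1))) (t : ℕ) :
    K * (t * ((t + 2) *
        Real.exp (-(2 * (⌊((t : ℝ) + 1) / (4 * K)⌋₊ : ℝ) * σ ^ 2)))) +
      (⌊((t : ℝ) + 1) ^ b⌋₊ + 1) *
        (C * (⌈((t : ℝ) + 1) ^ (1 - b) / 8⌉₊ : ℝ) ^ (-γ)) ≤ fewPullsBound K γ C σ t := by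
  have b_nonneg : 0 ≤ b := by
    rw [hb]
    exact div_nonneg (by linarith) (by linarith)
  have exponent : b - (1 - b) * γ = -((γ + 1) / 2) := by
    have : γ + 1 ≠ 0 := by linarith
    rw [hb]
    field_simp
    ring
  refine add_le_add ?_ ?_
  · have sq_bound : (t : ℝ) * (t + 2) ≤ ((t + 1 : ℕ) : ℝ) ^ 2 := by push_cast; nlinarith
    calc _ = K * (t * (t + 2)) *
          Real.exp (-(2 * (⌊((t : ℝ) + 1) / (4 * K)⌋₊ : ℝ) * σ ^ 2)) := by ring
      _ ≤ K * ((t + 1 : ℕ) : ℝ) ^ 2 *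
          (Real.exp (2 * σ ^ 2) * Real.exp (-(σ ^ 2 / (2 * K))) ^ (t + 1)) := by
        gcongr
        exact exp_neg_floor_le hK σ t
      _ = _ := by ring
  · calc _ = C * ((⌊((t : ℝ) + 1) ^ b⌋₊ + 1) *
          (⌈((t : ℝ) + 1) ^ (1 - b) / 8⌉₊ : ℝ) ^ (-γ)) := by ring
      _ ≤ C * (2 * 8 ^ γ * ((t : ℝ) + 1) ^ (b - (1 - b) * γ)) :=
        mul_le_mul_of_nonneg_left (floor_add_one_mul_ceil_rpow_le b_nonneg (by linarith)
          (le_add_of_nonneg_left t.cast_nonneg)) hC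
      _ = _ := by
        rw [exponent]
        push_cast
        ring

end BlockSizes

/-- A bandit problem with rewards in `[0, 1]`, driven by the primitive random variables `ξ`, in
which arm `0` has mean `μ₁` and all other arms have means at most `μ₂`. -/
structure IsBandit {K : ℕ} [NeZero K] {Ω : Type*} [MeasurableSpace Ω] (P : Measure Ω)
    (ν : Fin K → Measure ℝ) (ξ : Seed K → Ω → ℝ) (μ₁ μ₂ : ℝ) : Prop extends IsSeed P ν ξ where
  isProbabilityMeasure : ∀ a, IsProbabilityMeasure (ν a)
  mem_Icc : ∀ a, ∀ᵐ r ∂(ν a), r ∈ Set.Icc (0 : ℝ) 1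
  armMean_zero : armMean ν 0 = μ₁
  armMean_le : ∀ a ≠ 0, armMean ν a ≤ μ₂

lemma IsBandit.measure_pulls_le_rpow {K : ℕ} [NeZero K] {Ω : Type*} [MeasurableSpace Ω]
    {P : Measure Ω} [IsProbabilityMeasure P] {ν : Fin K → Measure ℝ} {ξ : Seed K → Ω → ℝ}
    {μ₁ μ₂ : ℝ} (h : IsBandit P ν ξ μ₁ μ₂) {ε y γ C b : ℝ} (hε0 : 0 ≤ ε) (hε : ε < 1)
    (hy0 : 0 ≤ y) (hμ₂y : μ₂ ≤ y) (hy1 : y ≤ 1 - ε) (hγ : 1 < γ) (hC : 0 ≤ C)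
    (hb : b = (γ - 1) / (2 * (γ + 1)))
    (hlaplace : ∀ (k : ℕ) (i : ℕ → ℕ), (∀ j, j ≤ i j) → ∀ m : ℝ, 0 < m →
      ∑ j ∈ Finset.range (k + 1), binomPmf k μ₁ j *
        Real.exp (-(binomCdf (k + 1) (y / (1 - ε)) (i j) * m)) ≤ C * m ^ (-γ))
    {t : ℕ} (ht : 6 ≤ t) (htb : 16 * ((t : ℝ) + 1) ^ b ≤ t + 1) :
    P {ω | (pulls ε (fun s => ξ s ω) t 0 : ℝ) ≤ ((t : ℝ) + 1) ^ b} ≤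
      ENNReal.ofReal (fewPullsBound K γ C ((y - μ₂) / 2) t) := by
  have := h.isProbabilityMeasure
  have hK : 0 < K := Nat.pos_of_neZero K
  have ht6 : (6 : ℝ) ≤ t := by exact_mod_cast ht
  have b_nonneg : 0 ≤ b := by
    rw [hb]
    exact div_nonneg (by linarith) (by linarith)
  have rpow_nonneg : 0 ≤ ((t : ℝ) + 1) ^ b := by positivity
  have sizes := floor_add_mul_floor_add_mul_ceil_lt b_nonneg hK (by linarith) htb
  have one_le_ceil : 1 ≤ ⌈((t : ℝ) + 1) ^ (1 - b) / 8⌉₊ := Nat.one_le_ceil_iff.2 (by positivity)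
  simp only [← Nat.le_floor_iff rpow_nonneg]
  refine (h.toIsSeed.measure_pulls_le h.mem_Icc hε0 hε (by linarith) hy0 hy1 (by positivity)
    (fun a ha => by linarith [h.armMean_le a ha]) one_le_ceil (fun k => ?_) ?_).trans
    (ENNReal.ofReal_le_ofReal (le_fewPullsBound hγ hC hK _ hb t))
  · rw [h.armMean_zero]
    exact hlaplace k _ (le_alphaOf hε0 hε) _ (by exact_mod_cast one_le_ceil)
  · exact_mod_cast lt_of_add_lt_add_right sizes

lemma exists_measure_pulls_le_rpow {μ₁ μ₂ ε : ℝ} (hε0 : 0 ≤ ε) (hε : ε < 1) (hμ₂ : 0 ≤ μ₂)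
    (hμ : μ₂ < μ₁ - ε) (hμ₁ : μ₁ ≤ 1) :
    ∃ b ∈ Set.Ioo (0 : ℝ) 1, ∀ (K : ℕ) [NeZero K], ∃ g : ℕ → ℝ, Summable g ∧ (∀ t, 0 ≤ g t) ∧
      ∀ (Ω : Type*) [MeasurableSpace Ω] (P : Measure Ω) [IsProbabilityMeasure P]
        (ν : Fin K → Measure ℝ) (ξ : Seed K → Ω → ℝ), IsBandit P ν ξ μ₁ μ₂ → ∀ t : ℕ,
        P {ω | (pulls ε (fun s => ξ s ω) t 0 : ℝ) ≤ ((t : ℝ) + 1) ^ b} ≤ ENNReal.ofReal (g t) := by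
  have h1ε : 0 < 1 - ε := sub_pos.2 hε
  obtain ⟨y, hμ₂y, hyμ₁⟩ := exists_between hμ
  have hqμ : y / (1 - ε) < μ₁ := by
    rw [div_lt_iff₀ h1ε]
    nlinarith
  obtain ⟨γ, C, hγ, hC, hlaplace⟩ :=
    exists_laplace_binomCdf_le (div_pos (hμ₂.trans_lt hμ₂y) h1ε) hqμ hμ₁
  set b := (γ - 1) / (2 * (γ + 1)) with hb
  have hb1 : b < 1 := (div_lt_one (by linarith)).2 (by linarith)
  obtain ⟨t₀, ht₀⟩ := Filter.eventually_atTop.1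
    ((Filter.eventually_ge_atTop 6).and (eventually_mul_rpow_le hb1 16))
  refine ⟨b, ⟨div_pos (by linarith) (by linarith), hb1⟩, fun K _ => ?_⟩
  have bound_nonneg := fewPullsBound_nonneg hC K γ ((y - μ₂) / 2)
  refine ⟨fun t => fewPullsBound K γ C ((y - μ₂) / 2) t + if t < t₀ then 1 else 0,
    (summable_fewPullsBound (Nat.pos_of_neZero K) hγ (by linarith) C).add
      (summable_of_ne_finset_zero (s := Finset.range t₀) fun t ht => if_neg (by simpa using ht)),
    fun t => add_nonneg (bound_nonneg t) (by split_ifs <;> norm_num), fun Ω _ P _ ν ξ h t => ?_⟩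
  rcases lt_or_ge t t₀ with ht | ht
  · refine prob_le_one.trans (ENNReal.one_le_ofReal.2 ?_)
    simpa [ht] using bound_nonneg t
  · obtain ⟨ht6, htb⟩ := ht₀ t ht
    simpa only [if_neg ht.not_gt, add_zero] using h.measure_pulls_le_rpow hε0 hε
      (hμ₂.trans hμ₂y.le) hμ₂y.le (by linarith) hγ hC hb hlaplace ht6 htb

/-! ### Divergence of Bernoulli distributions -/

section KullbackLeibler

open InformationTheory in
lemma klReal_pos {p q : ℝ} (hp0 : 0 ≤ p) (hp1 : p ≤ 1) (hq0 : 0 < q) (hq1 : q < 1)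
    (hpq : p ≠ q) : 0 < klReal p q := by
  have hq1' : 0 < 1 - q := sub_pos.2 hq1
  have ratio_nonneg : 0 ≤ p / q := by positivity
  have klFun_pos : 0 < klFun (p / q) := (klFun_nonneg ratio_nonneg).lt_of_ne' fun h =>
    hpq ((div_eq_one_iff_eq hq0.ne').1 ((klFun_eq_zero_iff ratio_nonneg).1 h))
  have klFun_compl_nonneg : 0 ≤ klFun ((1 - p) / (1 - q)) :=
    klFun_nonneg (div_nonneg (sub_nonneg.2 hp1) hq1'.le)
  calc 0 < q * klFun (p / q) + (1 - q) * klFun ((1 - p) / (1 - q)) := by positivity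
    _ = klReal p q := by
      rw [klReal, klFun, klFun]
      field [hq1'.ne']

lemma klReal_eq {p q : ℝ} (hp1 : p < 1) (hq0 : 0 < q) (hq1 : q < 1) :
    klReal p q = p * Real.log p + (1 - p) * Real.log (1 - p) -
      p * Real.log q - (1 - p) * Real.log (1 - q) := by
  rw [klReal, Real.log_div (sub_pos.2 hp1).ne' (sub_pos.2 hq1).ne']
  rcases eq_or_ne p 0 with rfl | hp
  · simp
  · rw [Real.log_div hp hq0.ne']
    ring

lemma klReal_self {q : ℝ} (hq0 : 0 < q) (hq1 : q < 1) : klReal q q = 0 := by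
  rw [klReal, div_self hq0.ne', div_self (sub_pos.2 hq1).ne', Real.log_one, mul_zero, mul_zero,
    add_zero]

lemma klBer_eq_ofReal {p q : ℝ} (hq0 : 0 < q) (hq1 : q < 1) :
    klBer p q = ENNReal.ofReal (klReal p q) := by
  rw [klBer, if_neg (by grind), klReal]

lemma invKL_eq {p q : ℝ} (hp0 : 0 ≤ p) (hp1 : p ≤ 1) (hq0 : 0 < q) (hq1 : q < 1)
    (hpq : p ≠ q) : invKL p q = (klReal p q)⁻¹ := by
  rw [invKL, klBer_eq_ofReal hq0 hq1, ENNReal.toReal_inv,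
    ENNReal.toReal_ofReal (klReal_pos hp0 hp1 hq0 hq1 hpq).le]

lemma invKL_nonneg (p q : ℝ) : 0 ≤ invKL p q := ENNReal.toReal_nonneg

lemma continuousOn_klReal {q : ℝ} (hq0 : 0 < q) (hq1 : q < 1) :
    ContinuousOn (fun p => klReal p q) (Set.Iio 1) := by
  have continuous_entropy := Real.continuous_mul_log.add
    (Real.continuous_mul_log.comp (continuous_const.sub continuous_id : Continuous (1 - · : ℝ → ℝ)))
  have continuous_expansion : Continuous fun p : ℝ => p * Real.log p +
      (1 - p) * Real.log (1 - p) - p * Real.log q - (1 - p) * Real.log (1 - q) :=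
    (continuous_entropy.sub (by fun_prop)).sub (by fun_prop)
  exact continuous_expansion.continuousOn.congr fun p hp => klReal_eq hp hq0 hq1

lemma exists_klReal_eq_div {p q c : ℝ} (hp0 : 0 ≤ p) (hpq : p < q) (hq1 : q < 1) (hc : 0 < c) :
    ∃ x ∈ Set.Ioo p q, klReal x q = klReal p q / (1 + c) := by
  have hq0 : 0 < q := hp0.trans_lt hpq
  have hpos := klReal_pos hp0 (hpq.trans hq1).le hq0 hq1 hpq.ne
  have hIoo := intermediate_value_Ioo' hpq.le
    ((continuousOn_klReal hq0 hq1).mono fun u hu => hu.2.trans_lt hq1)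
  rw [klReal_self hq0 hq1] at hIoo
  exact hIoo ⟨by positivity, div_lt_self hpos (by linarith)⟩

lemma klReal_sub_mul_klReal_eq {p x l u : ℝ} (hp1 : p < 1) (hx1 : x < 1) (hu0 : 0 < u)
    (hu1 : u < 1) :
    klReal x u - l * klReal p u =
      (x * Real.log x + (1 - x) * Real.log (1 - x) -
        l * (p * Real.log p + (1 - p) * Real.log (1 - p))) -
      (x - l * p) * Real.log u - ((1 - x) - l * (1 - p)) * Real.log (1 - u) := by
  rw [klReal_eq hx1 hu0 hu1, klReal_eq hp1 hu0 hu1]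
  ring

lemma convexOn_klReal_sub_mul {p x l : ℝ} (hp1 : p < 1) (hx1 : x < 1) (hl : l * p ≤ x)
    (hl' : l * (1 - p) ≤ 1 - x) :
    ConvexOn ℝ (Set.Ioo 0 1) (fun u => klReal x u - l * klReal p u) := by
  have concaveOn_log : ConcaveOn ℝ (Set.Ioo (0 : ℝ) 1) Real.log :=
    strictConcaveOn_log_Ioi.concaveOn.subset (fun _ hu => hu.1) (convex_Ioo 0 1)
  have concaveOn_log_compl : ConcaveOn ℝ (Set.Ioo (0 : ℝ) 1) fun u => Real.log (1 - u) := by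
    refine ⟨convex_Ioo 0 1, fun u hu v hv a b ha hb hab => ?_⟩
    have hconcave := concaveOn_log.2 ⟨sub_pos.2 hu.2, sub_lt_self 1 hu.1⟩
      ⟨sub_pos.2 hv.2, sub_lt_self 1 hv.1⟩ ha hb hab
    rwa [show a • (1 - u) + b • (1 - v) = 1 - (a • u + b • v) by
      simp only [smul_eq_mul]; linear_combination hab] at hconcave
  have convexOn_expansion := ((convexOn_const (x * Real.log x + (1 - x) * Real.log (1 - x) -
    l * (p * Real.log p + (1 - p) * Real.log (1 - p))) (convex_Ioo 0 1)).sub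
    (concaveOn_log.smul (sub_nonneg.2 hl))).sub (concaveOn_log_compl.smul (sub_nonneg.2 hl'))
  exact convexOn_expansion.congr fun u hu => (klReal_sub_mul_klReal_eq hp1 hx1 hu.1 hu.2).symm

/-- The difference of both sides is convex in the second argument, negative at `x` and nonnegative
at `q₀`, hence nonnegative beyond `q₀`. -/
lemma mul_klReal_le_klReal_of_le {p x q₀ q l : ℝ} (hp0 : 0 ≤ p) (hpx : p < x) (hxq₀ : x < q₀)
    (hq₀q : q₀ ≤ q) (hq1 : q < 1) (hl0 : 0 < l) (hl1 : l ≤ 1)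
    (h : l * klReal p q₀ ≤ klReal x q₀) : l * klReal p q ≤ klReal x q := by
  have hx0 : 0 < x := hp0.trans_lt hpx
  have hx1 : x < 1 := by linarith
  have hq₀1 : q₀ < 1 := hq₀q.trans_lt hq1
  have hq₀0 : 0 < q₀ := hx0.trans hxq₀
  have neg_at_x : klReal x x - l * klReal p x < 0 := by
    rw [klReal_self hx0 hx1, zero_sub, neg_lt_zero]
    exact mul_pos hl0 (klReal_pos hp0 (hpx.trans hx1).le hx0 hx1 hpx.ne)
  have lp_le : l * p ≤ x := (mul_le_of_le_one_left hp0 hl1).trans hpx.le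
  have l_compl_le : l * (1 - p) ≤ 1 - x := by
    by_contra! hlt
    have hlog : Real.log x ≤ Real.log q₀ := Real.log_le_log hx0 hxq₀.le
    have hlog_compl : Real.log (1 - q₀) ≤ Real.log (1 - x) :=
      Real.log_le_log (by linarith) (by linarith)
    have := klReal_sub_mul_klReal_eq (l := l) (hpx.trans hx1) hx1 hx0 hx1
    have := klReal_sub_mul_klReal_eq (l := l) (hpx.trans hx1) hx1 hq₀0 hq₀1
    nlinarith
  have hconvex := convexOn_klReal_sub_mul (hpx.trans hx1) hx1 lp_le l_compl_le
  have hle := hconvex.le_right_of_left_le'' ⟨hx0, hx1⟩ ⟨hq₀0.trans_le hq₀q, hq1⟩ hxq₀ hq₀q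
    (neg_at_x.le.trans (sub_nonneg.2 h))
  exact sub_nonneg.1 ((sub_nonneg.2 h).trans hle)

end KullbackLeibler

/-! ### Elementary series and asymptotics -/

section Series

lemma rpow_neg_le_sub_div {c u : ℝ} (hc : 0 < c) (hu : 1 < u) :
    u ^ (-(1 + c)) ≤ ((u - 1) ^ (-c) - u ^ (-c)) / c := by
  have hu0 : 0 < u := by linarith
  have bernoulli : 1 + c / u ≤ ((u - 1) / u) ^ (-c) := by
    have hratio : 0 < (u - 1) / u := div_pos (by linarith) hu0
    have hlog : Real.log ((u - 1) / u) ≤ -(1 / u) :=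
      (Real.log_le_sub_one_of_pos hratio).trans_eq (by field_simp; ring)
    rw [Real.rpow_def_of_pos hratio]
    refine le_trans ?_ (Real.add_one_le_exp _)
    calc 1 + c / u = -(1 / u) * -c + 1 := by ring
      _ ≤ Real.log ((u - 1) / u) * -c + 1 := by
        have := mul_le_mul_of_nonpos_right hlog (neg_nonpos.2 hc.le)
        linarith
  have hsplit : (u - 1) ^ (-c) = u ^ (-c) * ((u - 1) / u) ^ (-c) := by
    rw [← Real.mul_rpow hu0.le (div_nonneg (by linarith) hu0.le), mul_div_cancel₀ _ hu0.ne']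
  rw [le_div_iff₀ hc, show -(1 + c) = -c - 1 by ring, Real.rpow_sub_one hu0.ne', hsplit]
  calc u ^ (-c) / u * c = u ^ (-c) * (1 + c / u) - u ^ (-c) := by ring
    _ ≤ _ := by gcongr

lemma sum_rpow_neg_le {c : ℝ} (hc : 0 < c) (N : ℕ) :
    ∑ t ∈ Finset.range N, ((t : ℝ) + 1) ^ (-(1 + c)) ≤ 1 + 1 / c := by
  have telescope (n : ℕ) : ∑ t ∈ Finset.range (n + 1), ((t : ℝ) + 1) ^ (-(1 + c)) ≤
      1 + 1 / c - ((n : ℝ) + 1) ^ (-c) / c := by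
    induction n with
    | zero => simp
    | succ n ih =>
      have hstep := rpow_neg_le_sub_div hc (lt_add_of_pos_left 1 (n.cast_add_one_pos (α := ℝ)))
      rw [add_sub_cancel_right, sub_div] at hstep
      rw [Finset.sum_range_succ]
      push_cast
      linarith
  calc _ ≤ ∑ t ∈ Finset.range (N + 1), ((t : ℝ) + 1) ^ (-(1 + c)) :=
        Finset.sum_le_sum_of_subset_of_nonneg (Finset.range_mono N.le_succ)
          fun t _ _ => by positivity
    _ ≤ _ := (telescope N).trans (sub_le_self _ (by positivity))

lemma sum_exp_neg_le {d : ℝ} (hd : 0 < d) (N : ℕ) :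
    ∑ n ∈ Finset.range N, Real.exp (-((n + 1 : ℕ) * d)) ≤ d⁻¹ := by
  have hlt : Real.exp (-d) < 1 := Real.exp_lt_one_iff.2 (neg_lt_zero.2 hd)
  have hterm (n : ℕ) : Real.exp (-((n + 1 : ℕ) * d)) = Real.exp (-d) * Real.exp (-d) ^ n := by
    rw [← mul_neg, Real.exp_nat_mul, pow_succ']
  have hgeom : ∑ n ∈ Finset.range N, Real.exp (-d) ^ n ≤ (1 - Real.exp (-d))⁻¹ := by
    rw [← tsum_geometric_of_lt_one (Real.exp_pos _).le hlt]
    exact (summable_geometric_of_lt_one (Real.exp_pos _).le hlt).sum_le_tsum _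
      fun _ _ => by positivity
  have hexp : Real.exp (-d) * (1 + d) ≤ 1 := by
    calc Real.exp (-d) * (1 + d) ≤ Real.exp (-d) * Real.exp d := by
          gcongr
          linarith [Real.add_one_le_exp d]
      _ = 1 := by rw [← Real.exp_add, neg_add_cancel, Real.exp_zero]
  simp_rw [hterm]
  rw [← Finset.mul_sum]
  calc Real.exp (-d) * ∑ n ∈ Finset.range N, Real.exp (-d) ^ n
      ≤ Real.exp (-d) * (1 - Real.exp (-d))⁻¹ := by gcongr
    _ ≤ d⁻¹ := by
      rw [← div_eq_mul_inv, div_le_iff₀ (sub_pos.2 hlt), ← div_eq_inv_mul, le_div_iff₀ hd]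
      linarith

lemma exists_mul_exp_neg_rpow_le {b c : ℝ} (hb : 0 < b) (hc : 0 < c) :
    ∃ D : ℝ, 0 ≤ D ∧ ∀ τ : ℝ, 1 ≤ τ → τ * Real.exp (-(c * τ ^ b)) ≤ D * τ ^ (-2 : ℝ) := by
  obtain ⟨k, hk⟩ := exists_nat_ge (3 / b)
  rw [div_le_iff₀ hb] at hk
  refine ⟨k.factorial / c ^ k, by positivity, fun τ hτ => ?_⟩
  have hτ0 : 0 < τ := by linarith
  have cube_le : τ ^ (3 : ℝ) ≤ (τ ^ b) ^ k := by
    rw [← Real.rpow_natCast, ← Real.rpow_mul hτ0.le]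
    exact Real.rpow_le_rpow_of_exponent_le hτ (by linarith)
  have le_exp : c ^ k * τ ^ (3 : ℝ) / k.factorial ≤ Real.exp (c * τ ^ b) := by
    refine le_trans ?_ (Real.pow_div_factorial_le_exp (c * τ ^ b) (by positivity) k)
    rw [mul_pow]
    gcongr
  rw [Real.exp_neg, ← div_eq_mul_inv, div_le_iff₀ (Real.exp_pos _)]
  calc τ = τ ^ (-2 : ℝ) * τ ^ (3 : ℝ) := by
        rw [← Real.rpow_add hτ0]
        norm_num
    _ = k.factorial / c ^ k * τ ^ (-2 : ℝ) * (c ^ k * τ ^ (3 : ℝ) / k.factorial) := by field_simp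
    _ ≤ _ := by gcongr

lemma tendsto_sqrt_log_div_rpow {b : ℝ} (hb : 0 < b) :
    Filter.Tendsto (fun t : ℕ => √(6 * Real.log t / (t : ℝ) ^ b)) Filter.atTop (nhds 0) := by
  have hlog := ((isLittleO_log_rpow_atTop hb).tendsto_div_nhds_zero.comp
    tendsto_natCast_atTop_atTop).const_mul 6
  simpa only [Function.comp_def, mul_div_assoc, mul_zero, Real.sqrt_zero] using hlog.sqrt

lemma exists_log_le_rpow {β : ℝ} (hβ : 0 < β) (d : ℝ) :
    ∃ t₀ : ℕ, ∀ t : ℕ, t₀ ≤ t → 2 * Real.log t * d + 1 ≤ ((t : ℝ) - 1) ^ β := by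
  have hlog := ((isLittleO_log_rpow_atTop hβ).const_mul_left (2 * d)).bound
    (show 0 < 1 / (2 * 2 ^ β) by positivity)
  have hgrow : ∀ᶠ x : ℝ in Filter.atTop, 2 ≤ (x / 2) ^ β :=
    ((tendsto_rpow_atTop hβ).comp (Filter.tendsto_id.atTop_div_const two_pos)).eventually_ge_atTop 2
  obtain ⟨t₀, ht₀⟩ := Filter.eventually_atTop.1 (tendsto_natCast_atTop_atTop.eventually
    ((hlog.and hgrow).and (Filter.eventually_ge_atTop (2 : ℝ))))
  refine ⟨t₀, fun t ht => ?_⟩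
  obtain ⟨⟨hlog_t, hgrow_t⟩, ht2⟩ := ht₀ t ht
  rw [Real.norm_of_nonneg (show (0 : ℝ) ≤ (t : ℝ) ^ β by positivity)] at hlog_t
  calc 2 * Real.log t * d + 1 ≤ 1 / (2 * 2 ^ β) * (t : ℝ) ^ β + 1 := by
        linarith [(le_abs_self _).trans hlog_t]
    _ = ((t : ℝ) / 2) ^ β / 2 + 1 := by
      rw [Real.div_rpow (by positivity) two_pos.le]
      field_simp
    _ ≤ ((t : ℝ) / 2) ^ β := by linarith
    _ ≤ ((t : ℝ) - 1) ^ β := Real.rpow_le_rpow (by positivity) (by linarith) hβ.le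

end Series

/-! ### Rounds in which a suboptimal arm is played -/

section Counting

variable {K : ℕ}

lemma empMean_zero (z : Seed K → ℝ) (a : Fin K) : empMean z a 0 = 0 := by
  rw [empMean, Nat.cast_zero, div_zero]

lemma successes_le_of_empMean_le {z : Seed K → ℝ} {a : Fin K} {n : ℕ} {x : ℝ}
    (h : empMean z a n ≤ x) : (successes z a n : ℝ) ≤ x * n := by
  rcases n.eq_zero_or_pos with rfl | hn
  · simp [successes]
  · rwa [empMean, div_le_iff₀ (Nat.cast_pos.2 hn)] at h

lemma lt_successes_of_lt_empMean {z : Seed K → ℝ} {a : Fin K} {n : ℕ} {x : ℝ} (hx : 0 ≤ x)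
    (h : x < empMean z a n) : x * n < successes z a n := by
  rcases n.eq_zero_or_pos with rfl | hn
  · exact absurd h (empMean_zero z a ▸ hx.not_gt)
  · rwa [empMean, lt_div_iff₀ (Nat.cast_pos.2 hn)] at h

lemma measurable_empMean (a : Fin K) (n : ℕ) : Measurable fun z : Seed K → ℝ => empMean z a n :=
  ((measurable_of_countable fun j : ℕ => (j : ℝ)).comp (measurable_successes a n)).div_const _

variable {Ω : Type*} [MeasurableSpace Ω] {P : Measure Ω} {ν : Fin K → Measure ℝ}
  {ξ : Seed K → Ω → ℝ}

lemma IsSeed.sum_measure_lt_empMean_le [IsProbabilityMeasure P] (h : IsSeed P ν ξ) {a : Fin K}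
    [IsProbabilityMeasure (ν a)] (hν : ∀ᵐ r ∂(ν a), r ∈ Set.Icc (0 : ℝ) 1) {x d : ℝ} (hx : 0 ≤ x)
    (hd : 0 < d) (htail : ∀ (n : ℕ) (S : Finset ℕ), (∀ j ∈ S, x * n < j) →
      ∑ j ∈ S, binomPmf n (armMean ν a) j ≤ Real.exp (-(n * d))) (T : ℕ) :
    ∑ n ∈ Finset.range T, P {ω | x < empMean (fun s => ξ s ω) a n} ≤ ENNReal.ofReal d⁻¹ := by
  classical
  have tail (n : ℕ) : P {ω | x < empMean (fun s => ξ s ω) a n} ≤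
      ENNReal.ofReal (Real.exp (-(n * d))) := by
    calc _ ≤ P {ω | x * n < successes (fun s => ξ s ω) a n} :=
          measure_mono fun ω hω => lt_successes_of_lt_empMean hx hω
      _ ≤ _ := (h.measure_successes_mem_le hν n fun j => x * n < j).trans
          (ENNReal.ofReal_le_ofReal (htail n _ fun j hj => (Finset.mem_filter.1 hj).2))
  calc _ ≤ ∑ n ∈ Finset.range (T + 1), P {ω | x < empMean (fun s => ξ s ω) a n} := by
        gcongr
        exact T.le_succ
    _ = ∑ n ∈ Finset.range T, P {ω | x < empMean (fun s => ξ s ω) a (n + 1)} := by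
        simp only [Finset.sum_range_succ', empMean_zero, hx.not_gt, Set.ofPred_false,
          measure_empty, add_zero]
    _ ≤ ∑ n ∈ Finset.range T, ENNReal.ofReal (Real.exp (-((n + 1 : ℕ) * d))) :=
        Finset.sum_le_sum fun n _ => tail (n + 1)
    _ = ENNReal.ofReal (∑ n ∈ Finset.range T, Real.exp (-((n + 1 : ℕ) * d))) :=
        (ENNReal.ofReal_sum_of_nonneg fun n _ => (Real.exp_pos _).le).symm
    _ ≤ _ := ENNReal.ofReal_le_ofReal (sum_exp_neg_le hd T)

lemma IsSeed.sum_measure_lt_empMean_le_sq [IsProbabilityMeasure P] (h : IsSeed P ν ξ) {a : Fin K}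
    [IsProbabilityMeasure (ν a)] (hν : ∀ᵐ r ∂(ν a), r ∈ Set.Icc (0 : ℝ) 1) {σ x : ℝ} (hσ : 0 < σ)
    (hx : armMean ν a + σ ≤ x) (T : ℕ) :
    ∑ n ∈ Finset.range T, P {ω | x < empMean (fun s => ξ s ω) a n} ≤
      ENNReal.ofReal (2 * σ ^ 2)⁻¹ := by
  obtain ⟨hμ0, hμ1⟩ := armMean_mem_Icc hν
  refine h.sum_measure_lt_empMean_le hν (by linarith) (by positivity) (fun n S hS => ?_) T
  calc _ ≤ Real.exp (-(2 * n * σ ^ 2)) := sum_binomPmf_le_exp_neg_sq hμ0 hμ1 fun j hj =>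
        mul_le_mul_of_nonneg_left (by nlinarith [hS j hj, n.cast_nonneg (α := ℝ)]) hσ.le
    _ = _ := by ring_nf

lemma IsSeed.sum_measure_lt_empMean_le_invKL [IsProbabilityMeasure P] (h : IsSeed P ν ξ)
    {a : Fin K} [IsProbabilityMeasure (ν a)] (hν : ∀ᵐ r ∂(ν a), r ∈ Set.Icc (0 : ℝ) 1) {x : ℝ}
    (hx : armMean ν a < x) (hx1 : x < 1) (T : ℕ) :
    ∑ n ∈ Finset.range T, P {ω | x < empMean (fun s => ξ s ω) a n} ≤
      ENNReal.ofReal (invKL x (armMean ν a)) := by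
  obtain ⟨hμ0, -⟩ := armMean_mem_Icc hν
  have hx0 : 0 < x := hμ0.trans_lt hx
  rcases hμ0.eq_or_lt with hμ | hμ
  · suffices ∀ n, P {ω | x < empMean (fun s => ξ s ω) a n} = 0 by simp [this]
    intro n
    have no_success := h.measure_successes_mem_le hν n (0 < ·)
    rw [← hμ, Finset.sum_eq_zero fun j hj => by
      rw [binomPmf, zero_pow (Finset.mem_filter.1 hj).2.ne', mul_zero, zero_mul],
      ENNReal.ofReal_zero] at no_success
    refine measure_mono_null (fun ω hω => ?_) (nonpos_iff_eq_zero.1 no_success)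
    exact Nat.cast_pos.1 ((by positivity : 0 ≤ x * n).trans_lt
      (lt_successes_of_lt_empMean hx0.le hω))
  · have hμ1 := hx.trans hx1
    rw [invKL_eq hx0.le hx1.le hμ hμ1 hx.ne']
    refine h.sum_measure_lt_empMean_le hν hx0.le (klReal_pos hx0.le hx1.le hμ hμ1 hx.ne')
      (fun n S hS => sum_binomPmf_le_exp_neg_klReal hx0 hx1 hμ hμ1 fun j hj => ?_) T
    exact mul_le_mul_of_nonneg_left (mul_comm x n ▸ (hS j hj).le) (sub_pos.2 hx).le

variable [NeZero K]

lemma IsSeed.measurableSet_action_eq_and (h : IsSeed P ν ξ) (ε : ℝ) (a : Fin K)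
    {Q : ℕ → (Seed K → ℝ) → Prop} (hQ : ∀ n, MeasurableSet {z | Q n z}) (t : ℕ) :
    MeasurableSet {ω | action ε (fun s => ξ s ω) t = a ∧
      Q (pulls ε (fun s => ξ s ω) t a) fun s => ξ s ω} :=
  h.measurable_pi ((measurable_action ε t (measurableSet_singleton a)).inter
    (measurableSet_setOfPred.2
      (measurable_comp_nat (measurable_pulls ε t a) fun n => measurableSet_setOfPred.1 (hQ n))))

/-- Each number of pulls of `a` is attained in at most one round in which `a` is played. -/
lemma IsSeed.sum_measure_action_eq_and_le (h : IsSeed P ν ξ) (ε : ℝ) (a : Fin K)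
    {Q : ℕ → (Seed K → ℝ) → Prop} (hQ : ∀ n, MeasurableSet {z | Q n z}) (T : ℕ) :
    ∑ t ∈ Finset.range T, P {ω | action ε (fun s => ξ s ω) t = a ∧
      Q (pulls ε (fun s => ξ s ω) t a) fun s => ξ s ω} ≤
      ∑ n ∈ Finset.range T, P {ω | Q n fun s => ξ s ω} := by
  classical
  have hQξ (n : ℕ) : MeasurableSet {ω | Q n fun s => ξ s ω} := h.measurable_pi (hQ n)
  have sum_indicator_le (ω : Ω) :
      ∑ t ∈ Finset.range T, {ω | action ε (fun s => ξ s ω) t = a ∧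
        Q (pulls ε (fun s => ξ s ω) t a) fun s => ξ s ω}.indicator (1 : Ω → ℝ≥0∞) ω ≤
      ∑ n ∈ Finset.range T, {ω | Q n fun s => ξ s ω}.indicator 1 ω := by
    simp only [Set.indicator_apply, Set.mem_ofPred_eq, Pi.one_apply, ite_and]
    rw [sum_action_eq_sum_pulls ε (fun s => ξ s ω) a
      fun n => if Q n (fun s => ξ s ω) then (1 : ℝ≥0∞) else 0]
    exact Finset.sum_le_sum_of_subset (Finset.range_mono (pulls_le ε _ T a))
  simp_rw [← lintegral_indicator_one (h.measurableSet_action_eq_and ε a hQ _),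
    ← lintegral_indicator_one (hQξ _)]
  rw [← lintegral_finsetSum _ fun t _ =>
      measurable_one.indicator (h.measurableSet_action_eq_and ε a hQ t),
    ← lintegral_finsetSum _ fun n _ => measurable_one.indicator (hQξ n)]
  exact lintegral_mono sum_indicator_le

end Counting

lemma sum_le_ofReal_tsum {g : ℕ → ℝ} (hg : Summable g) (hg0 : ∀ t, 0 ≤ g t) {u : ℕ → ℝ≥0∞}
    (hu : ∀ t, u t ≤ ENNReal.ofReal (g t)) (T : ℕ) :
    ∑ t ∈ Finset.range T, u t ≤ ENNReal.ofReal (∑' t, g t) := by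
  calc _ ≤ ∑ t ∈ Finset.range T, ENNReal.ofReal (g t) := Finset.sum_le_sum fun t _ => hu t
    _ = ENNReal.ofReal (∑ t ∈ Finset.range T, g t) :=
        (ENNReal.ofReal_sum_of_nonneg fun t _ => hg0 t).symm
    _ ≤ _ := ENNReal.ofReal_le_ofReal (hg.sum_le_tsum _ fun t _ => hg0 t)

lemma summable_const_mul_succ_rpow (D : ℝ) :
    Summable fun t : ℕ => D * ((t : ℝ) + 1) ^ (-2 : ℝ) := by
  have hshift := (summable_nat_add_iff (f := fun t : ℕ => (t : ℝ) ^ (-2 : ℝ)) 1).2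
    (Real.summable_nat_rpow.2 (by norm_num))
  simpa only [Nat.cast_add_one] using hshift.mul_left D

/-! ### A best arm with mean above `1 - ε` -/

section HighBestMean

variable {K : ℕ} [NeZero K] {Ω : Type*} [MeasurableSpace Ω] {P : Measure Ω}
  [IsProbabilityMeasure P] {ν : Fin K → Measure ℝ} {ξ : Seed K → Ω → ℝ}

lemma IsSeed.measure_one_sub_le_theta_eq_zero (h : IsSeed P ν ξ) {ε : ℝ} (hε : ε < 1) (t : ℕ)
    (a : Fin K) :
    P {ω | (successes (fun s => ξ s ω) a (pulls ε (fun s => ξ s ω) t a) : ℝ) ≤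
          (1 - ε) * pulls ε (fun s => ξ s ω) t a ∧
        1 - ε ≤ theta ε (fun s => ξ s ω) t a (pulls ε (fun s => ξ s ω) t a)} = 0 := by
  have hle := h.measure_le_theta_le hε t a (Q := fun n j => (j : ℝ) ≤ (1 - ε) * n) (c := 0)
    zero_le_one le_rfl (fun _ _ h => h)
    fun n j _ hjn => (binomCdf_one_eq_zero (Nat.lt_succ_of_le (alphaOf_le hε hjn))).le
  rwa [ENNReal.ofReal_zero, nonpos_iff_eq_zero, mul_one] at hle

/-- If the empirical mean of arm `o` exceeds `1 - ε`, an arm with empirical mean at most `1 - ε` can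
only be played if its posterior sample is at least `1`, which is a null event. -/
lemma IsSeed.measure_action_eq_le (h : IsSeed P ν ξ) {ε : ℝ} (hε : ε < 1) (o a : Fin K) (A : ℝ)
    (t : ℕ) :
    P {ω | action ε (fun s => ξ s ω) t = a} ≤
      P {ω | (pulls ε (fun s => ξ s ω) t o : ℝ) ≤ A} +
      P {ω | A ≤ pulls ε (fun s => ξ s ω) t o ∧
        (successes (fun s => ξ s ω) o (pulls ε (fun s => ξ s ω) t o) : ℝ) ≤
          (1 - ε) * pulls ε (fun s => ξ s ω) t o} +
      P {ω | action ε (fun s => ξ s ω) t = a ∧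
        1 - ε < empMean (fun s => ξ s ω) a (pulls ε (fun s => ξ s ω) t a)} := by
  rw [← add_zero (_ + _ + P _), ← h.measure_one_sub_le_theta_eq_zero hε t a]
  refine le_trans (measure_mono fun ω hact => ?_) ((measure_union_le _ _).trans
    (add_le_add_left ((measure_union_le _ _).trans
      (add_le_add_left (measure_union_le _ _) _)) _))
  rw [Set.mem_ofPred_eq] at hact
  by_contra! hcon
  simp only [Set.mem_union, Set.mem_ofPred_eq, not_or, not_and, not_le, not_lt] at hcon
  obtain ⟨⟨⟨many_pulls, high_successes⟩, low_mean⟩, low_theta⟩ := hcon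
  have high_mean : 1 - ε < empMean (fun s => ξ s ω) o (pulls ε (fun s => ξ s ω) t o) := by
    by_contra! hle
    exact (high_successes many_pulls.le).not_ge (successes_le_of_empMean_le hle)
  have theta_le := theta_le_theta_action ε (fun s => ξ s ω) t o
  rw [hact, theta, if_pos high_mean] at theta_le
  exact (low_theta (successes_le_of_empMean_le (low_mean hact))).not_ge
    (high_mean.le.trans theta_le)

end HighBestMean

lemma exists_sum_measure_action_eq_le_of_lt {μ₁ μ₂ ε b : ℝ} (hε : ε < 1) (hμ₂ : μ₂ < 1 - ε)
    (hμ₁ : 1 - ε < μ₁) (hb : 0 < b) :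
    ∃ C : ℝ, 0 ≤ C ∧ ∀ (K : ℕ) [NeZero K] (Ω : Type*) [MeasurableSpace Ω] (P : Measure Ω)
      [IsProbabilityMeasure P] (ν : Fin K → Measure ℝ) (ξ : Seed K → Ω → ℝ),
      IsBandit P ν ξ μ₁ μ₂ → ∀ a ≠ 0, ∀ T : ℕ,
      ∑ t ∈ Finset.range T, P {ω | action ε (fun s => ξ s ω) t = a} ≤
        ∑ t ∈ Finset.range T,
          P {ω | (pulls ε (fun s => ξ s ω) t 0 : ℝ) ≤ ((t : ℝ) + 1) ^ b} + ENNReal.ofReal C := by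
  have hρ : 0 < 1 - ε - μ₂ := sub_pos.2 hμ₂
  obtain ⟨D, hD0, hD⟩ := exists_mul_exp_neg_rpow_le hb
    (mul_pos two_pos (pow_pos (sub_pos.2 hμ₁) 2) : 0 < 2 * (μ₁ - (1 - ε)) ^ 2)
  have summable_tail := summable_const_mul_succ_rpow D
  have tail_nonneg (t : ℕ) : 0 ≤ D * ((t : ℝ) + 1) ^ (-2 : ℝ) := by positivity
  refine ⟨∑' t : ℕ, D * ((t : ℝ) + 1) ^ (-2 : ℝ) + (2 * (1 - ε - μ₂) ^ 2)⁻¹,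
    add_nonneg (tsum_nonneg tail_nonneg) (by positivity), fun K _ Ω _ P _ ν ξ h a ha T => ?_⟩
  have := h.isProbabilityMeasure
  have low_best_mean (t : ℕ) : P {ω | ((t : ℝ) + 1) ^ b ≤ pulls ε (fun s => ξ s ω) t 0 ∧
      (successes (fun s => ξ s ω) 0 (pulls ε (fun s => ξ s ω) t 0) : ℝ) ≤
        (1 - ε) * pulls ε (fun s => ξ s ω) t 0} ≤
      ENNReal.ofReal (D * ((t : ℝ) + 1) ^ (-2 : ℝ)) := by
    have deviation := h.toIsSeed.measure_successes_pulls_deviation_le (h.mem_Icc 0) ε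
      (-(μ₁ - (1 - ε))) (((t : ℝ) + 1) ^ b) t
    rw [h.armMean_zero, neg_sq, mul_right_comm 2] at deviation
    refine (measure_mono ?_).trans (deviation.trans (ENNReal.ofReal_le_ofReal
      (hD (t + 1) (le_add_of_nonneg_left t.cast_nonneg))))
    rintro ω ⟨many_pulls, low_successes⟩
    exact ⟨many_pulls, by nlinarith⟩
  have high_mean := (h.toIsSeed.sum_measure_action_eq_and_le ε a
    (fun n => measurableSet_lt measurable_const (measurable_empMean a n)) T).trans
    (h.toIsSeed.sum_measure_lt_empMean_le_sq (h.mem_Icc a) hρ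
      (by linarith [h.armMean_le a ha] : armMean ν a + (1 - ε - μ₂) ≤ 1 - ε) T)
  refine (Finset.sum_le_sum fun (t : ℕ) _ =>
    h.toIsSeed.measure_action_eq_le hε 0 a (((t : ℝ) + 1) ^ b) t).trans ?_
  rw [Finset.sum_add_distrib, Finset.sum_add_distrib,
    ENNReal.ofReal_add (tsum_nonneg tail_nonneg) (by positivity), ← add_assoc]
  exact add_le_add (add_le_add le_rfl
    (sum_le_ofReal_tsum summable_tail tail_nonneg low_best_mean T)) high_mean

/-! ### A best arm with mean at most `1 - ε` -/

section LowBestMean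

lemma one_sub_binomCdf_alphaOf_le {ε δ y : ℝ} (hε0 : 0 ≤ ε) (hε : ε < 1) (hδ : 0 ≤ δ)
    (hy0 : 0 ≤ y) (hy : y ≤ 1 - ε) (hyδ : y + δ ≤ 1) {n j : ℕ} (hn : 2 ≤ n * δ)
    (hj : n * (y + δ) ≤ j) :
    1 - binomCdf (n + 1) (y / (1 - ε)) (alphaOf ε j) ≤
      Real.exp (-((n + 1 : ℕ) * δ ^ 2 / 2)) := by
  have h1ε : 0 < 1 - ε := sub_pos.2 hε
  have tail_start : ((n + 1 : ℕ) : ℝ) * (y / (1 - ε) + δ / 2) ≤ j / (1 - ε) := by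
    rw [le_div_iff₀ h1ε, mul_assoc, add_mul, div_mul_cancel₀ _ h1ε.ne']
    have : δ / 2 * (1 - ε) ≤ δ / 2 := mul_le_of_le_one_right (by positivity) (by linarith)
    push_cast
    nlinarith
  rw [one_sub_binomCdf, show ((n + 1 : ℕ) : ℝ) * δ ^ 2 / 2 = 2 * (n + 1 : ℕ) * (δ / 2) ^ 2 by ring]
  refine sum_binomPmf_le_exp_neg_sq (by positivity) ((div_le_one h1ε).2 hy) fun i hi => ?_
  have hi : ((alphaOf ε j : ℝ) + 1) ≤ i := by exact_mod_cast (Finset.mem_Ico.1 hi).1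
  exact mul_le_mul_of_nonneg_left (tail_start.trans ((Nat.lt_floor_add_one _).le.trans hi))
    (by positivity)

variable {K : ℕ} [NeZero K] {Ω : Type*} [MeasurableSpace Ω] {P : Measure Ω}
  [IsProbabilityMeasure P] {ν : Fin K → Measure ℝ} {ξ : Seed K → Ω → ℝ}

lemma IsSeed.measure_theta_lt_le (h : IsSeed P ν ξ) {a : Fin K} [IsProbabilityMeasure (ν a)]
    (hν : ∀ᵐ r ∂(ν a), r ∈ Set.Icc (0 : ℝ) 1) {ε δ y A : ℝ} (hε0 : 0 ≤ ε) (hε : ε < 1)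
    (hδ : 0 ≤ δ) (hy0 : 0 ≤ y) (hy : y ≤ 1 - ε) (hμ : y + 2 * δ ≤ armMean ν a)
    (hA : 2 ≤ A * δ) (t : ℕ) :
    P {ω | A ≤ pulls ε (fun s => ξ s ω) t a ∧
        theta ε (fun s => ξ s ω) t a (pulls ε (fun s => ξ s ω) t a) < y} ≤
      ENNReal.ofReal ((t + 1) * Real.exp (-(2 * A * δ ^ 2)) + Real.exp (-(A * δ ^ 2 / 2))) := by
  have h1ε : 0 < 1 - ε := sub_pos.2 hε
  have hμ1 := (armMean_mem_Icc hν).2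
  let Q : ℕ → ℕ → Prop := fun n j => A ≤ n ∧ n * (y + δ) ≤ j ∧ (j : ℝ) ≤ (1 - ε) * n
  have large_mean := h.measure_theta_le_le hε t a (Q := Q) (q := y / (1 - ε))
    (c := Real.exp (-(A * δ ^ 2 / 2))) (by positivity) ((div_le_one h1ε).2 hy)
    (fun n j hQ => hQ.2.2) fun n j _ hQ => by
      refine (one_sub_binomCdf_alphaOf_le hε0 hε hδ hy0 hy (by linarith)
        (hA.trans (mul_le_mul_of_nonneg_right hQ.1 hδ)) hQ.2.1).trans ?_
      gcongr
      exact hQ.1.trans (Nat.cast_le.2 n.le_succ)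
  rw [mul_div_cancel₀ _ h1ε.ne'] at large_mean
  have small_mean := h.measure_successes_pulls_deviation_le hν ε (-δ) A t
  rw [neg_sq] at small_mean
  rw [ENNReal.ofReal_add (by positivity) (by positivity)]
  refine (measure_mono ?_).trans
    ((measure_union_le _ _).trans (add_le_add small_mean large_mean))
  rintro ω ⟨many_pulls, theta_lt⟩
  rcases le_or_gt (successes (fun s => ξ s ω) a (pulls ε (fun s => ξ s ω) t a) : ℝ)
    (pulls ε (fun s => ξ s ω) t a * (armMean ν a - δ)) with hs | hs
  · exact .inl ⟨many_pulls, by nlinarith⟩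
  · have empMean_le : empMean (fun s => ξ s ω) a (pulls ε (fun s => ξ s ω) t a) ≤ 1 - ε := by
      by_contra! hlt
      rw [theta, if_pos hlt] at theta_lt
      linarith
    refine .inr ⟨⟨many_pulls, le_trans ?_ hs.le, successes_le_of_empMean_le empMean_le⟩,
      theta_lt.le⟩
    gcongr
    linarith

lemma IsBandit.measure_theta_lt_eta_le {μ₁ μ₂ ε b : ℝ} (h : IsBandit P ν ξ μ₁ μ₂) (hε0 : 0 ≤ ε)
    (hε : ε < 1) (hμε : ε ≤ μ₁) (hμ₁ : μ₁ ≤ 1 - ε) (hb : 0 < b) {t : ℕ} (ht : 3 ≤ t)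
    (hsqrt : √(6 * Real.log (t + 1 : ℕ) / ((t + 1 : ℕ) : ℝ) ^ b) ≤ ε / 2) :
    P {ω | ((t : ℝ) + 1) ^ b ≤ pulls ε (fun s => ξ s ω) t 0 ∧
        theta ε (fun s => ξ s ω) t 0 (pulls ε (fun s => ξ s ω) t 0) < eta ε b μ₁ (t + 1)} ≤
      ENNReal.ofReal (2 * ((t : ℝ) + 1) ^ (-2 : ℝ)) := by
  have := h.isProbabilityMeasure
  rw [eta, max_eq_right (by linarith)]
  rw [Nat.cast_add_one] at hsqrt ⊢
  have hτ : 3 + 1 ≤ (t : ℝ) + 1 := add_le_add_left (by exact_mod_cast ht) 1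
  generalize hτ_def : (t : ℝ) + 1 = τ at *
  generalize hδ : √(6 * Real.log τ / τ ^ b) = δ at *
  have hτ0 : 0 < τ := by linarith
  have hlog : 1 ≤ Real.log τ := (Real.le_log_iff_exp_le hτ0).2 (by linarith [Real.exp_one_lt_d9])
  have hδ0 : 0 ≤ δ := hδ ▸ Real.sqrt_nonneg _
  have hδ_sq : τ ^ b * δ ^ 2 = 6 * Real.log τ := by
    rw [← hδ, Real.sq_sqrt (by positivity), mul_div_cancel₀ _ (by positivity)]
  have two_le : 2 ≤ τ ^ b * δ := by
    refine (abs_le_of_sq_le_sq' ?_ (by positivity)).2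
    nlinarith [Real.one_le_rpow (by linarith : 1 ≤ τ) hb.le]
  have exp_le {k l : ℝ} (hk : l + 2 ≤ k) :
      Real.exp (l * Real.log τ) * Real.exp (-(k * Real.log τ)) ≤ τ ^ (-2 : ℝ) := by
    rw [← Real.exp_add, Real.rpow_def_of_pos hτ0]
    exact Real.exp_le_exp.2 (by nlinarith)
  refine (h.toIsSeed.measure_theta_lt_le (h.mem_Icc 0) hε0 hε hδ0 (by linarith) (by linarith)
    (by rw [h.armMean_zero, sub_add_cancel]) two_le t).trans (ENNReal.ofReal_le_ofReal ?_)
  have deviation_le := exp_le (l := 1) (k := 12) (by norm_num)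
  have posterior_le := exp_le (l := 0) (k := 3) (by norm_num)
  rw [one_mul, Real.exp_log hτ0] at deviation_le
  rw [zero_mul, Real.exp_zero, one_mul] at posterior_le
  rw [hτ_def, mul_assoc 2, hδ_sq, two_mul (τ ^ _)]
  exact add_le_add (le_of_eq_of_le (by ring_nf) deviation_le)
    (le_of_eq_of_le (by ring_nf) posterior_le)

lemma binomCdf_alphaOf_le_exp_neg_klReal {ε x y : ℝ} (hε : ε < 1) (hx : 0 < x) (hxy : x < y)
    (hy : y < 1 - ε) {n j : ℕ} (hj : (j : ℝ) ≤ x * n) :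
    binomCdf (n + 1) (y / (1 - ε)) (alphaOf ε j) ≤
      Real.exp (-((n + 1 : ℕ) * klReal (x / (1 - ε)) (y / (1 - ε)))) := by
  have h1ε : 0 < 1 - ε := sub_pos.2 hε
  have hxy' : x / (1 - ε) < y / (1 - ε) := div_lt_div_of_pos_right hxy h1ε
  have hy1 : y / (1 - ε) < 1 := (div_lt_one h1ε).2 hy
  have hx0 : 0 < x / (1 - ε) := div_pos hx h1ε
  refine sum_binomPmf_le_exp_neg_klReal hx0 (hxy'.trans hy1) (hx0.trans hxy') hy1 fun i hi =>
    mul_le_mul_of_nonpos_left ?_ (sub_nonpos.2 hxy'.le)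
  calc (i : ℝ) ≤ alphaOf ε j := by exact_mod_cast Nat.lt_succ_iff.1 (Finset.mem_range.1 hi)
    _ ≤ j / (1 - ε) := Nat.floor_le (by positivity)
    _ ≤ n * (x / (1 - ε)) := by
        rw [← mul_div_assoc, mul_comm]
        gcongr
    _ ≤ (n + 1 : ℕ) * (x / (1 - ε)) := by
        gcongr
        exact n.le_succ

lemma IsSeed.measure_empMean_le_and_le_theta_le (h : IsSeed P ν ξ) {ε x y : ℝ} (hε : ε < 1)
    (hx : 0 < x) (hxy : x < y) (hy : y < 1 - ε) (A : ℝ) (t : ℕ) (a : Fin K) :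
    P {ω | A ≤ pulls ε (fun s => ξ s ω) t a ∧
        empMean (fun s => ξ s ω) a (pulls ε (fun s => ξ s ω) t a) ≤ x ∧
        y ≤ theta ε (fun s => ξ s ω) t a (pulls ε (fun s => ξ s ω) t a)} ≤
      ENNReal.ofReal (Real.exp (-(A * klReal (x / (1 - ε)) (y / (1 - ε))))) := by
  have h1ε : 0 < 1 - ε := sub_pos.2 hε
  have hxy' : x / (1 - ε) < y / (1 - ε) := div_lt_div_of_pos_right hxy h1ε
  have hy1 : y / (1 - ε) < 1 := (div_lt_one h1ε).2 hy
  have hx0 : 0 < x / (1 - ε) := div_pos hx h1ε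
  have hkl := klReal_pos hx0.le (hxy'.trans hy1).le (hx0.trans hxy') hy1 hxy'.ne
  have large_theta := h.measure_le_theta_le hε t a (Q := fun n j => A ≤ n ∧ (j : ℝ) ≤ x * n)
    (q := y / (1 - ε)) (c := Real.exp (-(A * klReal (x / (1 - ε)) (y / (1 - ε)))))
    (hx0.trans hxy').le hy1.le
    (fun n j hQ => hQ.2.trans (mul_le_mul_of_nonneg_right (hxy.trans hy).le n.cast_nonneg))
    fun n j _ hQ => by
      refine (binomCdf_alphaOf_le_exp_neg_klReal hε hx hxy hy hQ.2).trans ?_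
      gcongr
      exact hQ.1.trans (Nat.cast_le.2 n.le_succ)
  rw [mul_div_cancel₀ _ h1ε.ne'] at large_theta
  refine (measure_mono ?_).trans large_theta
  rintro ω ⟨many_pulls, empMean_le, le_theta⟩
  exact ⟨⟨many_pulls, successes_le_of_empMean_le empMean_le⟩, le_theta⟩

lemma eta_lt_one_sub {ε b μ₁ : ℝ} (hε0 : 0 < ε) (hμ₁ : μ₁ ≤ 1 - ε) {t : ℕ} (ht : 1 < t) :
    eta ε b μ₁ t < 1 - ε := by
  have hlog : 0 < Real.log t := Real.log_pos (Nat.one_lt_cast.2 ht)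
  have hsqrt : 0 < √(6 * Real.log t / (t : ℝ) ^ b) := by positivity
  exact max_lt (by linarith) (by linarith)

/-- The choice of `x` makes `d(x / (1 - ε), ·)` at least `d(μ / (1 - ε), ·) / (1 + c)` at `η` as
soon as it is so at `μ₁ - ε ≤ η`. -/
lemma IsSeed.measure_eta_le_theta_le (h : IsSeed P ν ξ) {μ₁ μ ε b c x M : ℝ} (hε0 : 0 < ε)
    (hε : ε < 1) (hμ : 0 ≤ μ) (hμ₁ : μ₁ ≤ 1 - ε) (hx : x ∈ Set.Ioo μ (μ₁ - ε)) (hc : 0 < c)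
    (hkl : klReal (x / (1 - ε)) ((μ₁ - ε) / (1 - ε)) =
      klReal (μ / (1 - ε)) ((μ₁ - ε) / (1 - ε)) / (1 + c)) (t : ℕ)
    (hM : (1 + c) ^ 2 * (Real.log (t + 1 : ℕ) *
      invKL (μ / (1 - ε)) (eta ε b μ₁ (t + 1) / (1 - ε))) ≤ M) (a : Fin K) :
    P {ω | M ≤ pulls ε (fun s => ξ s ω) t a ∧
        empMean (fun s => ξ s ω) a (pulls ε (fun s => ξ s ω) t a) ≤ x ∧
        eta ε b μ₁ (t + 1) ≤ theta ε (fun s => ξ s ω) t a (pulls ε (fun s => ξ s ω) t a)} ≤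
      ENNReal.ofReal (((t : ℝ) + 1) ^ (-(1 + c))) := by
  rcases t.eq_zero_or_pos with rfl | ht
  · exact prob_le_one.trans (by simp)
  have h1ε : 0 < 1 - ε := sub_pos.2 hε
  have η_lt := eta_lt_one_sub (b := b) hε0 hμ₁ (Nat.succ_lt_succ ht)
  have le_η : μ₁ - ε ≤ eta ε b μ₁ (t + 1) := le_max_left _ _
  rw [Nat.succ_eq_add_one] at η_lt
  generalize eta ε b μ₁ (t + 1) = η at *
  refine (h.measure_empMean_le_and_le_theta_le hε (hμ.trans_lt hx.1) (hx.2.trans_le le_η) η_lt M t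
    a).trans (ENNReal.ofReal_le_ofReal ?_)
  have hq1 : η / (1 - ε) < 1 := (div_lt_one h1ε).2 η_lt
  have hpx : μ / (1 - ε) < x / (1 - ε) := div_lt_div_of_pos_right hx.1 h1ε
  have hxq₀ : x / (1 - ε) < (μ₁ - ε) / (1 - ε) := div_lt_div_of_pos_right hx.2 h1ε
  have hq₀q : (μ₁ - ε) / (1 - ε) ≤ η / (1 - ε) := div_le_div_of_nonneg_right le_η h1ε.le
  have hp0 : 0 ≤ μ / (1 - ε) := by positivity
  have hpq : μ / (1 - ε) < η / (1 - ε) := by linarith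
  have kl_pos := klReal_pos hp0 (hpq.trans hq1).le (hp0.trans_lt hpq) hq1 hpq.ne
  have kl_le : 1 / (1 + c) * klReal (μ / (1 - ε)) (η / (1 - ε)) ≤
      klReal (x / (1 - ε)) (η / (1 - ε)) :=
    mul_klReal_le_klReal_of_le hp0 hpx hxq₀ hq₀q hq1 (by positivity)
      ((div_le_one (by positivity)).2 (by linarith)) (by rw [hkl, one_div_mul_eq_div])
  rw [invKL_eq hp0 (hpq.trans hq1).le (hp0.trans_lt hpq) hq1 hpq.ne, Nat.cast_add_one] at hM
  rw [Real.rpow_def_of_pos (by positivity), mul_neg, mul_comm (Real.log _)]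
  refine Real.exp_le_exp.2 (neg_le_neg ?_)
  have hlog : 0 ≤ Real.log ((t : ℝ) + 1) := Real.log_nonneg (by linarith [t.cast_nonneg (α := ℝ)])
  calc (1 + c) * Real.log ((t : ℝ) + 1)
      = (1 + c) ^ 2 * (Real.log (t + 1) * (klReal (μ / (1 - ε)) (η / (1 - ε)))⁻¹) *
        (1 / (1 + c) * klReal (μ / (1 - ε)) (η / (1 - ε))) := by field
    _ ≤ M * klReal (x / (1 - ε)) (η / (1 - ε)) :=
        mul_le_mul hM kl_le (by positivity) (le_trans (by positivity) hM)

lemma IsSeed.sum_measure_action_eq_and_pulls_lt_le (h : IsSeed P ν ξ) (ε : ℝ) (a : Fin K) {M : ℝ}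
    (hM : 0 ≤ M) (T : ℕ) :
    ∑ t ∈ Finset.range T, P {ω | action ε (fun s => ξ s ω) t = a ∧
        (pulls ε (fun s => ξ s ω) t a : ℝ) < M} ≤ ENNReal.ofReal (M + 1) := by
  classical
  calc _ ≤ ∑ n ∈ Finset.range T, P {_ω | (n : ℝ) < M} :=
        h.sum_measure_action_eq_and_le ε a (Q := fun n _ => (n : ℝ) < M)
          (fun n => MeasurableSet.const _) T
    _ ≤ ∑ n ∈ Finset.range T, (if n < ⌈M⌉₊ then 1 else 0) := by
        refine Finset.sum_le_sum fun n _ => ?_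
        split_ifs with hn
        · exact prob_le_one
        · simp [mt Nat.lt_ceil.2 hn]
    _ ≤ (⌈M⌉₊ : ℝ≥0∞) := by
        rw [Finset.sum_boole]
        refine Nat.cast_le.2 ((Finset.card_le_card fun n hn => ?_).trans_eq (Finset.card_range _))
        exact Finset.mem_range.2 (Finset.mem_filter.1 hn).2
    _ ≤ _ := by
        rw [← ENNReal.ofReal_natCast]
        exact ENNReal.ofReal_le_ofReal (Nat.ceil_lt_add_one hM).le

/-- Rounds before the `M`-th pull of `a`, rounds in which its empirical mean exceeds `x`, and
rounds in which its posterior sample is unusually large are counted separately. -/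
lemma IsSeed.sum_measure_action_eq_and_eta_le_le (h : IsSeed P ν ξ) {a : Fin K}
    [IsProbabilityMeasure (ν a)] (hν : ∀ᵐ r ∂(ν a), r ∈ Set.Icc (0 : ℝ) 1) {μ₁ ε b c x M : ℝ}
    (hε0 : 0 < ε) (hε : ε < 1) (hμ₁ : μ₁ ≤ 1 - ε) (hx : x ∈ Set.Ioo (armMean ν a) (μ₁ - ε))
    (hc : 0 < c) (hkl : klReal (x / (1 - ε)) ((μ₁ - ε) / (1 - ε)) =
      klReal (armMean ν a / (1 - ε)) ((μ₁ - ε) / (1 - ε)) / (1 + c)) (hM0 : 0 ≤ M) {T : ℕ}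
    (hM : ∀ t < T, (1 + c) ^ 2 * (Real.log (t + 1 : ℕ) *
      invKL (armMean ν a / (1 - ε)) (eta ε b μ₁ (t + 1) / (1 - ε))) ≤ M) :
    ∑ t ∈ Finset.range T, P {ω | action ε (fun s => ξ s ω) t = a ∧
        eta ε b μ₁ (t + 1) ≤ theta ε (fun s => ξ s ω) t a (pulls ε (fun s => ξ s ω) t a)} ≤
      ENNReal.ofReal (M + 2 + 1 / c + invKL x (armMean ν a)) := by
  have few_pulls := h.sum_measure_action_eq_and_pulls_lt_le ε a hM0 T
  have high_mean := (h.sum_measure_action_eq_and_le ε a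
    (fun n => measurableSet_lt measurable_const (measurable_empMean a n)) T).trans
    (h.sum_measure_lt_empMean_le_invKL hν hx.1 (by linarith [hx.2]) T)
  have high_theta : ∑ t ∈ Finset.range T, P {ω | M ≤ pulls ε (fun s => ξ s ω) t a ∧
      empMean (fun s => ξ s ω) a (pulls ε (fun s => ξ s ω) t a) ≤ x ∧
      eta ε b μ₁ (t + 1) ≤ theta ε (fun s => ξ s ω) t a (pulls ε (fun s => ξ s ω) t a)} ≤
      ENNReal.ofReal (1 + 1 / c) := by
    refine (Finset.sum_le_sum fun t ht => h.measure_eta_le_theta_le hε0 hε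
      (armMean_mem_Icc hν).1 hμ₁ hx hc hkl t (hM t (Finset.mem_range.1 ht)) a).trans ?_
    rw [← ENNReal.ofReal_sum_of_nonneg fun t _ => by positivity]
    exact ENNReal.ofReal_le_ofReal (sum_rpow_neg_le hc T)
  rw [show M + 2 + 1 / c + invKL x (armMean ν a) =
    M + 1 + invKL x (armMean ν a) + (1 + 1 / c) by ring,
    ENNReal.ofReal_add (add_nonneg (by positivity) (invKL_nonneg _ _)) (by positivity),
    ENNReal.ofReal_add (by positivity) (invKL_nonneg _ _)]
  refine le_trans ?_ (add_le_add (add_le_add few_pulls high_mean) high_theta)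
  rw [← Finset.sum_add_distrib, ← Finset.sum_add_distrib]
  refine Finset.sum_le_sum fun t _ => (measure_mono ?_).trans
    ((measure_union_le _ _).trans (add_le_add_left (measure_union_le _ _) _))
  rintro ω ⟨hact, le_theta⟩
  rcases lt_or_ge (pulls ε (fun s => ξ s ω) t a : ℝ) M with hfew | hmany
  · exact .inl (.inl ⟨hact, hfew⟩)
  rcases lt_or_ge x (empMean (fun s => ξ s ω) a (pulls ε (fun s => ξ s ω) t a)) with hhigh | hlow
  · exact .inl (.inr ⟨hact, hhigh⟩)
  · exact .inr ⟨hmany, hlow, le_theta⟩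

end LowBestMean

lemma exists_measure_theta_lt_eta_le {μ₁ ε b : ℝ} (hε0 : 0 < ε) (hε : ε < 1) (hμε : ε ≤ μ₁)
    (hμ₁ : μ₁ ≤ 1 - ε) (hb : 0 < b) :
    ∃ g : ℕ → ℝ, Summable g ∧ (∀ t, 0 ≤ g t) ∧ ∀ (K : ℕ) [NeZero K] (Ω : Type*)
      [MeasurableSpace Ω] (P : Measure Ω) [IsProbabilityMeasure P] (ν : Fin K → Measure ℝ)
      (ξ : Seed K → Ω → ℝ) (μ₂ : ℝ), IsBandit P ν ξ μ₁ μ₂ → ∀ t : ℕ,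
      P {ω | ((t : ℝ) + 1) ^ b ≤ pulls ε (fun s => ξ s ω) t 0 ∧
        theta ε (fun s => ξ s ω) t 0 (pulls ε (fun s => ξ s ω) t 0) < eta ε b μ₁ (t + 1)} ≤
      ENNReal.ofReal (g t) := by
  obtain ⟨t₀, ht₀⟩ := Filter.eventually_atTop.1
    ((tendsto_sqrt_log_div_rpow hb).eventually (ge_mem_nhds (half_pos hε0)))
  refine ⟨fun t => 2 * ((t : ℝ) + 1) ^ (-2 : ℝ) + if t < t₀ + 3 then 1 else 0,
    (summable_const_mul_succ_rpow 2).add (summable_of_ne_finset_zero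
      (s := Finset.range (t₀ + 3)) fun t ht => if_neg (by simpa using ht)),
    fun t => add_nonneg (by positivity) (by split_ifs <;> norm_num),
    fun K _ Ω _ P _ ν ξ μ₂ h t => ?_⟩
  rcases lt_or_ge t (t₀ + 3) with ht | ht
  · refine prob_le_one.trans (ENNReal.one_le_ofReal.2 ?_)
    exact (if_pos ht).ge.trans (le_add_of_nonneg_left (by positivity))
  · simpa only [if_neg ht.not_gt, add_zero] using
      h.measure_theta_lt_eta_le hε0.le hε hμε hμ₁ hb (by lia : 3 ≤ t) (ht₀ (t + 1) (by lia))

/-! ### Expected numbers of pulls -/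

/-- The defining property of the number `x_{a,c}` of the regret bound, where `μ` is the mean of the
arm `a`. -/
structure IsThreshold (c μ₁ μ ε x : ℝ) : Prop where
  mem_Ioo : x ∈ Set.Ioo μ (μ₁ - ε)
  klReal_eq : klReal (x / (1 - ε)) ((μ₁ - ε) / (1 - ε)) =
    klReal (μ / (1 - ε)) ((μ₁ - ε) / (1 - ε)) / (1 + c)

section Threshold

variable {c μ₁ μ ε : ℝ}

lemma IsThreshold.klBer_eq {x : ℝ} (h : IsThreshold c μ₁ μ ε x) (hc : 0 < c) (hε0 : 0 < ε)
    (hμ : 0 ≤ μ) (hμ₁ : μ₁ ≤ 1 - ε) :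
    klBer (x / (1 - ε)) ((μ₁ - ε) / (1 - ε)) =
      klBer (μ / (1 - ε)) ((μ₁ - ε) / (1 - ε)) / ENNReal.ofReal (1 + c) := by
  have hμlt : μ < μ₁ - ε := h.mem_Ioo.1.trans h.mem_Ioo.2
  have h1ε : 0 < 1 - ε := by linarith
  have hq0 : 0 < (μ₁ - ε) / (1 - ε) := div_pos (hμ.trans_lt hμlt) h1ε
  have hq1 : (μ₁ - ε) / (1 - ε) < 1 := (div_lt_one h1ε).2 (by linarith)
  rw [klBer_eq_ofReal hq0 hq1, klBer_eq_ofReal hq0 hq1, h.klReal_eq,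
    ENNReal.ofReal_div_of_pos (by linarith)]

lemma exists_isThreshold (hc : 0 < c) (hε0 : 0 < ε) (hμ0 : 0 ≤ μ) (hμ : μ < μ₁ - ε)
    (hμ₁ : μ₁ ≤ 1 - ε) : ∃ x, IsThreshold c μ₁ μ ε x := by
  have h1ε : 0 < 1 - ε := by linarith
  obtain ⟨x, hx, hkl⟩ := exists_klReal_eq_div (div_nonneg hμ0 h1ε.le)
    (div_lt_div_of_pos_right hμ h1ε) ((div_lt_one h1ε).2 (by linarith)) hc
  refine ⟨x * (1 - ε), ⟨(div_lt_iff₀ h1ε).1 hx.1, (lt_div_iff₀ h1ε).1 hx.2⟩, ?_⟩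
  rwa [mul_div_cancel_right₀ _ h1ε.ne']

end Threshold

/-- The logarithmic leading term of the bound on the expected number of pulls, during the first `T`
rounds, of an arm of mean `μ`. -/
noncomputable def leadingTerm (ε b c μ₁ μ : ℝ) (T : ℕ) : ℝ :=
  (1 + c) ^ 2 * ⨆ t : Set.Icc 1 T,
    Real.log (t : ℕ) * invKL (μ / (1 - ε)) (eta ε b μ₁ t / (1 - ε))

lemma leadingTerm_nonneg (ε b c μ₁ μ : ℝ) (T : ℕ) : 0 ≤ leadingTerm ε b c μ₁ μ T :=
  mul_nonneg (sq_nonneg _) (Real.iSup_nonneg fun _ =>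
    mul_nonneg (Real.log_natCast_nonneg _) (invKL_nonneg _ _))

lemma le_leadingTerm (ε b c μ₁ μ : ℝ) {t T : ℕ} (ht : t < T) :
    (1 + c) ^ 2 * (Real.log (t + 1 : ℕ) *
      invKL (μ / (1 - ε)) (eta ε b μ₁ (t + 1) / (1 - ε))) ≤ leadingTerm ε b c μ₁ μ T :=
  mul_le_mul_of_nonneg_left (le_ciSup (f := fun t : Set.Icc 1 T => Real.log (t : ℕ) *
      invKL (μ / (1 - ε)) (eta ε b μ₁ t / (1 - ε)))
    (Set.finite_range _).bddAbove ⟨t + 1, Nat.le_add_left _ _, ht⟩) (sq_nonneg _)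

/-- Bounds, uniform over all bandit problems with `K` arms whose best arm `0` has mean `μ₁` and
whose other arms have means at most `μ₂`, on the expected number of pulls of a suboptimal arm: by a
constant if `1 - ε < μ₁`, and by the logarithmic leading term plus a constant otherwise. -/
structure PullsBound.{u} (K : ℕ) [NeZero K] (μ₁ μ₂ ε b C : ℝ) : Prop where
  nonneg : 0 ≤ C
  of_lt : 1 - ε < μ₁ → ∀ (Ω : Type u) [MeasurableSpace Ω] (P : Measure Ω)
    [IsProbabilityMeasure P] (ν : Fin K → Measure ℝ) (ξ : Seed K → Ω → ℝ),
    IsBandit P ν ξ μ₁ μ₂ → ∀ a ≠ 0, ∀ T : ℕ,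
    ∑ t ∈ Finset.range T, P {ω | action ε (fun s => ξ s ω) t = a} ≤ ENNReal.ofReal C
  of_le : μ₁ ≤ 1 - ε → ∀ (Ω : Type u) [MeasurableSpace Ω] (P : Measure Ω)
    [IsProbabilityMeasure P] (ν : Fin K → Measure ℝ) (ξ : Seed K → Ω → ℝ),
    IsBandit P ν ξ μ₁ μ₂ → ∀ (a : Fin K) (T : ℕ), ∀ c > 0, ∀ x,
    IsThreshold c μ₁ (armMean ν a) ε x →
    ∑ t ∈ Finset.range T, P {ω | action ε (fun s => ξ s ω) t = a} ≤
      ENNReal.ofReal (leadingTerm ε b c μ₁ (armMean ν a) T + 2 + 1 / c +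
        invKL x (armMean ν a) + C)

section Pulls

variable {K : ℕ} [NeZero K]

lemma measure_action_eq_le_add {Ω : Type*} [MeasurableSpace Ω] (P : Measure Ω)
    (ξ : Seed K → Ω → ℝ) (ε A y : ℝ) (t : ℕ) (o a : Fin K) :
    P {ω | action ε (fun s => ξ s ω) t = a} ≤
      P {ω | (pulls ε (fun s => ξ s ω) t o : ℝ) ≤ A} +
      P {ω | A ≤ pulls ε (fun s => ξ s ω) t o ∧
        theta ε (fun s => ξ s ω) t o (pulls ε (fun s => ξ s ω) t o) < y} +
      P {ω | action ε (fun s => ξ s ω) t = a ∧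
        y ≤ theta ε (fun s => ξ s ω) t a (pulls ε (fun s => ξ s ω) t a)} := by
  refine (measure_mono ?_).trans
    ((measure_union_le _ _).trans (add_le_add_left (measure_union_le _ _) _))
  rintro ω rfl
  rcases le_total (pulls ε (fun s => ξ s ω) t o : ℝ) A with few | many
  · exact .inl (.inl few)
  rcases lt_or_ge (theta ε (fun s => ξ s ω) t o (pulls ε (fun s => ξ s ω) t o)) y with low | high
  · exact .inl (.inr ⟨many, low⟩)
  · exact .inr ⟨rfl, high.trans (theta_le_theta_action ε _ t o)⟩

/-- An arm `a` is played only if the best arm has few pulls, or its sample is unusually small, or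
else the sample of `a` is at least `η`. -/
lemma IsSeed.sum_measure_action_eq_le_leadingTerm {Ω : Type*} [MeasurableSpace Ω] {P : Measure Ω}
    [IsProbabilityMeasure P] {ν : Fin K → Measure ℝ} {ξ : Seed K → Ω → ℝ} (h : IsSeed P ν ξ)
    {a : Fin K} [IsProbabilityMeasure (ν a)] (hν : ∀ᵐ r ∂(ν a), r ∈ Set.Icc (0 : ℝ) 1)
    {μ₁ ε c x : ℝ} (hε0 : 0 < ε) (hε : ε < 1) (hμ₁ : μ₁ ≤ 1 - ε) (hc : 0 < c)
    (hx : IsThreshold c μ₁ (armMean ν a) ε x) (b : ℝ) (T : ℕ) :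
    ∑ t ∈ Finset.range T, P {ω | action ε (fun s => ξ s ω) t = a} ≤
      ∑ t ∈ Finset.range T, P {ω | (pulls ε (fun s => ξ s ω) t 0 : ℝ) ≤ ((t : ℝ) + 1) ^ b} +
      ∑ t ∈ Finset.range T, P {ω | ((t : ℝ) + 1) ^ b ≤ pulls ε (fun s => ξ s ω) t 0 ∧
        theta ε (fun s => ξ s ω) t 0 (pulls ε (fun s => ξ s ω) t 0) < eta ε b μ₁ (t + 1)} +
      ENNReal.ofReal (leadingTerm ε b c μ₁ (armMean ν a) T + 2 + 1 / c +
        invKL x (armMean ν a)) := by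
  refine (Finset.sum_le_sum fun (t : ℕ) _ => measure_action_eq_le_add P ξ ε
    (((t : ℝ) + 1) ^ b) (eta ε b μ₁ (t + 1)) t 0 a).trans ?_
  rw [Finset.sum_add_distrib, Finset.sum_add_distrib]
  exact add_le_add_right (h.sum_measure_action_eq_and_eta_le_le hν hε0 hε hμ₁ hx.mem_Ioo hc
    hx.klReal_eq (leadingTerm_nonneg _ _ _ _ _ T) fun t ht => le_leadingTerm ε b c μ₁ _ ht) _

lemma exists_pullsBound {μ₁ μ₂ ε : ℝ} (hε0 : 0 < ε) (hε : ε < 1) (hμ₂ : 0 ≤ μ₂)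
    (hμ : μ₂ < μ₁ - ε) (hμ₁ : μ₁ ≤ 1) :
    ∃ b ∈ Set.Ioo (0 : ℝ) 1, ∀ (K : ℕ) [NeZero K], ∃ C : ℝ, PullsBound K μ₁ μ₂ ε b C := by
  obtain ⟨b, hb, exists_few_pulls⟩ := exists_measure_pulls_le_rpow hε0.le hε hμ₂ hμ hμ₁
  refine ⟨b, hb, fun K _ => ?_⟩
  obtain ⟨g, hg, hg0, few_pulls⟩ := exists_few_pulls K
  rcases lt_or_ge (1 - ε) μ₁ with hcase | hcase
  · obtain ⟨C, hC0, hC⟩ := exists_sum_measure_action_eq_le_of_lt hε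
      (by linarith : μ₂ < 1 - ε) hcase hb.1
    refine ⟨∑' t, g t + C, add_nonneg (tsum_nonneg hg0) hC0,
      fun _ Ω _ P _ ν ξ h a ha T => ?_, fun hle => absurd hcase hle.not_gt⟩
    refine (hC K Ω P ν ξ h a ha T).trans ?_
    rw [ENNReal.ofReal_add (tsum_nonneg hg0) hC0]
    exact add_le_add_left (sum_le_ofReal_tsum hg hg0 (few_pulls Ω P ν ξ h) T) _
  · obtain ⟨g', hg', hg'0, low_theta⟩ := exists_measure_theta_lt_eta_le hε0 hε
      (by linarith : ε ≤ μ₁) hcase hb.1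
    have tsum_add_nonneg : 0 ≤ ∑' t, g t + ∑' t, g' t :=
      add_nonneg (tsum_nonneg hg0) (tsum_nonneg hg'0)
    refine ⟨∑' t, g t + ∑' t, g' t, tsum_add_nonneg,
      fun hlt => absurd hlt hcase.not_gt, fun _ Ω _ P _ ν ξ h a T c hc x hx => ?_⟩
    have := h.isProbabilityMeasure
    have := leadingTerm_nonneg ε b c μ₁ (armMean ν a) T
    have := invKL_nonneg x (armMean ν a)
    refine (h.toIsSeed.sum_measure_action_eq_le_leadingTerm (h.mem_Icc a) hε0 hε hcase hc hx b
      T).trans ?_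
    rw [add_comm _ (∑' t, g t + _), ENNReal.ofReal_add tsum_add_nonneg (by positivity),
      ENNReal.ofReal_add (tsum_nonneg hg0) (tsum_nonneg hg'0)]
    exact add_le_add_left (add_le_add (sum_le_ofReal_tsum hg hg0 (few_pulls Ω P ν ξ h) T)
      (sum_le_ofReal_tsum hg' hg'0 (low_theta K Ω P ν ξ μ₂ h) T)) _

end Pulls

lemma exists_lt_eta {β ε : ℝ} (hβ : 0 < β) (hε0 : 0 < ε) :
    ∃ L : ℝ, 2 ≤ L ∧ ∀ t : ℕ, L ≤ t → ∀ μ₁ : ℝ, μ₁ - ε < eta ε β μ₁ t := by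
  obtain ⟨t₀, ht₀⟩ := Filter.eventually_atTop.1
    ((tendsto_sqrt_log_div_rpow hβ).eventually (gt_mem_nhds (half_pos hε0)))
  refine ⟨max 2 t₀, le_max_left _ _, fun t ht μ₁ => lt_max_of_lt_right ?_⟩
  linarith [ht₀ t (Nat.cast_le.1 ((le_max_right _ _).trans ht))]

/-! ### Lenient regret -/

section Regret

universe u

variable {K : ℕ} [NeZero K] {Ω : Type u} [MeasurableSpace Ω] {P : Measure Ω}
  {ν : Fin K → Measure ℝ} {ξ : Seed K → Ω → ℝ} {μ₁ μ₂ : ℝ}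

lemma IsBandit.gap_eq (h : IsBandit P ν ξ μ₁ μ₂) (hμ : μ₂ ≤ μ₁) (a : Fin K) :
    gap ν a = μ₁ - armMean ν a := by
  have armMean_le_zero (k : Fin K) : armMean ν k ≤ armMean ν 0 := by
    rcases eq_or_ne k 0 with rfl | hk
    · exact le_rfl
    · exact (h.armMean_le k hk).trans (hμ.trans h.armMean_zero.ge)
  rw [gap, le_antisymm (ciSup_le armMean_le_zero)
    (le_ciSup (Set.finite_range (armMean ν)).bddAbove 0), h.armMean_zero]

variable {ε : ℝ} {f : ℝ → ℝ}

lemma IsBandit.gapFunction_gap_zero (h : IsBandit P ν ξ μ₁ μ₂) (hμ : μ₂ ≤ μ₁) (hε0 : 0 ≤ ε)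
    (hf : IsGapFunction ε f) : f (gap ν 0) = 0 := by
  rw [h.gap_eq hμ, h.armMean_zero, sub_self, hf.eq_zero 0 ⟨le_rfl, hε0⟩]

lemma IsBandit.gapFunction_gap_pos (h : IsBandit P ν ξ μ₁ μ₂) (hε0 : 0 ≤ ε) (hμ : μ₂ < μ₁ - ε)
    (hf : IsGapFunction ε f) {a : Fin K} (ha : a ≠ 0) : 0 < f (gap ν a) := by
  have := h.isProbabilityMeasure
  have hbest := (armMean_mem_Icc (h.mem_Icc 0)).2
  rw [h.armMean_zero] at hbest
  rw [h.gap_eq (by linarith)]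
  exact hf.pos _ ⟨by linarith [h.armMean_le a ha],
    by linarith [(armMean_mem_Icc (h.mem_Icc a)).1]⟩

variable [IsProbabilityMeasure P]

lemma IsSeed.lenientRegret_eq (h : IsSeed P ν ξ) (ε : ℝ) (f : ℝ → ℝ) (T : ℕ) :
    lenientRegret P ν ξ ε f T = ∑ a, f (gap ν a) *
      ∑ t ∈ Finset.range T, P.real {ω | action ε (fun s => ξ s ω) t = a} := by
  have measurableSet_action (t : ℕ) (a : Fin K) :
      MeasurableSet {ω | action ε (fun s => ξ s ω) t = a} :=
    h.measurable_pi (measurable_action ε t (measurableSet_singleton a))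
  have integrable_term (t : ℕ) (a : Fin K) : Integrable
      ({ω | action ε (fun s => ξ s ω) t = a}.indicator fun _ => f (gap ν a)) P :=
    (integrable_const _).indicator (measurableSet_action t a)
  have sum_indicator (t : ℕ) (ω : Ω) : f (gap ν (action ε (fun s => ξ s ω) t)) =
      ∑ a, {ω | action ε (fun s => ξ s ω) t = a}.indicator (fun _ => f (gap ν a)) ω := by
    simp [Set.indicator_apply]
  simp_rw [lenientRegret, sum_indicator]
  rw [integral_finsetSum _ fun t _ => integrable_finsetSum _ fun a _ => integrable_term t a]
  simp_rw [integral_finsetSum _ fun a _ => integrable_term _ a,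
    integral_indicator_const _ (measurableSet_action _ _), smul_eq_mul]
  rw [Finset.sum_comm]
  simp_rw [← Finset.sum_mul, mul_comm]

lemma IsBandit.lenientRegret_le (h : IsBandit P ν ξ μ₁ μ₂) (hε0 : 0 ≤ ε) (hμ : μ₂ < μ₁ - ε)
    (hf : IsGapFunction ε f) {T : ℕ} {B : Fin K → ℝ} {C D : ℝ} (hB : ∀ a, 0 ≤ B a) (hC : 0 ≤ C)
    (hCD : K * C ≤ D) (hpulls : ∀ a ≠ 0,
      ∑ t ∈ Finset.range T, P {ω | action ε (fun s => ξ s ω) t = a} ≤ ENNReal.ofReal (B a + C)) :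
    lenientRegret P ν ξ ε f T ≤
      ∑ a ∈ Finset.univ.erase 0, f (gap ν a) * B a + (⨆ a, f (gap ν a)) * D := by
  have gap_zero := h.gapFunction_gap_zero (by linarith) hε0 hf
  have le_sup : ∀ a, f (gap ν a) ≤ ⨆ a, f (gap ν a) := le_ciSup (Set.finite_range _).bddAbove
  have sup_nonneg : 0 ≤ ⨆ a, f (gap ν a) := gap_zero.ge.trans (le_sup 0)
  have term_le (a : Fin K) (ha : a ∈ Finset.univ.erase 0) : f (gap ν a) *
      ∑ t ∈ Finset.range T, P.real {ω | action ε (fun s => ξ s ω) t = a} ≤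
      f (gap ν a) * B a + (⨆ a, f (gap ν a)) * C := by
    have ha0 : a ≠ 0 := Finset.ne_of_mem_erase ha
    have pulls_le := ENNReal.toReal_mono ENNReal.ofReal_ne_top (hpulls a ha0)
    rw [ENNReal.toReal_ofReal (add_nonneg (hB a) hC),
      ENNReal.toReal_sum fun t _ => measure_ne_top _ _] at pulls_le
    calc _ ≤ f (gap ν a) * (B a + C) :=
          mul_le_mul_of_nonneg_left pulls_le (h.gapFunction_gap_pos hε0 hμ hf ha0).le
      _ ≤ _ := by
          rw [mul_add]
          exact add_le_add_right (mul_le_mul_of_nonneg_right (le_sup a) hC) _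
  calc lenientRegret P ν ξ ε f T
      = ∑ a ∈ Finset.univ.erase 0, f (gap ν a) *
          ∑ t ∈ Finset.range T, P.real {ω | action ε (fun s => ξ s ω) t = a} := by
        rw [h.toIsSeed.lenientRegret_eq, Finset.sum_erase _ (by rw [gap_zero, zero_mul])]
    _ ≤ ∑ a ∈ Finset.univ.erase 0, f (gap ν a) * B a +
          (Finset.univ.erase (0 : Fin K)).card * ((⨆ a, f (gap ν a)) * C) := by
        rw [← nsmul_eq_mul, ← Finset.sum_const, ← Finset.sum_add_distrib]
        exact Finset.sum_le_sum term_le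
    _ ≤ ∑ a ∈ Finset.univ.erase 0, f (gap ν a) * B a + (⨆ a, f (gap ν a)) * (K * C) := by
        rw [mul_left_comm (⨆ a, f (gap ν a))]
        gcongr
        exact (Finset.card_le_univ _).trans_eq (Fintype.card_fin K)
    _ ≤ _ := by gcongr

lemma PullsBound.lenientRegret_le_of_lt {C D : ℝ} (hC : PullsBound.{u} K μ₁ μ₂ ε b C)
    (h : IsBandit P ν ξ μ₁ μ₂) (hε0 : 0 ≤ ε) (hμ : μ₂ < μ₁ - ε) (hμ₁ : 1 - ε < μ₁)
    (hf : IsGapFunction ε f) (hCD : K * C ≤ D) (T : ℕ) :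
    lenientRegret P ν ξ ε f T ≤ ∑ a ∈ Finset.univ.erase 0,
      f (gap ν a) * invKL (1 - ε) (armMean ν a) + (⨆ a, f (gap ν a)) * D :=
  h.lenientRegret_le hε0 hμ hf (fun _ => invKL_nonneg _ _) hC.nonneg hCD fun a ha =>
    (hC.of_lt hμ₁ Ω P ν ξ h a ha T).trans
      (ENNReal.ofReal_le_ofReal (le_add_of_nonneg_left (invKL_nonneg _ _)))

lemma PullsBound.lenientRegret_le_of_le {c C D : ℝ} (hC : PullsBound.{u} K μ₁ μ₂ ε b C)
    (h : IsBandit P ν ξ μ₁ μ₂) (hε0 : 0 ≤ ε) (hμ : μ₂ < μ₁ - ε) (hμ₁ : μ₁ ≤ 1 - ε)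
    (hf : IsGapFunction ε f) (hc : 0 < c) {x : Fin K → ℝ}
    (hx : ∀ a ≠ 0, IsThreshold c μ₁ (armMean ν a) ε (x a)) (hCD : K * C ≤ D) (T : ℕ) :
    lenientRegret P ν ξ ε f T ≤ ∑ a ∈ Finset.univ.erase 0, f (gap ν a) *
      (leadingTerm ε b c μ₁ (armMean ν a) T + 2 + 1 / c + invKL (x a) (armMean ν a)) +
      (⨆ a, f (gap ν a)) * D := by
  refine h.lenientRegret_le hε0 hμ hf (fun a => ?_) hC.nonneg hCD fun a ha =>
    hC.of_le hμ₁ Ω P ν ξ h a T c hc _ (hx a ha)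
  have := leadingTerm_nonneg ε b c μ₁ (armMean ν a) T
  have := invKL_nonneg (x a) (armMean ν a)
  positivity

end Regret

end EpsTS

theorem mainTheorem2 :
    ∃ (b : ℝ → ℝ → ℝ → ℝ) (C : ℕ → ℝ → ℝ → ℝ → ℝ) (L₁ : ℝ → ℝ → ℝ → ℝ) (L₂ : ℝ → ℝ → ℝ)
      (x : ℝ → ℝ → ℝ → ℝ → ℝ),
      -- `b = b(μ₁, μ₂, ε) ∈ (0, 1)`
      (∀ μ₁ μ₂ ε : ℝ, 0 < ε → ε < 1 → 0 ≤ μ₂ → μ₂ < μ₁ - ε → μ₁ ≤ 1 →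
        b μ₁ μ₂ ε ∈ Set.Ioo (0 : ℝ) 1) ∧
      -- `L₁ = L₁(μ₁, ε, b)`
      (∀ μ₁ ε β : ℝ, 0 < ε → ε < 1 → 1 - ε < μ₁ → μ₁ ≤ 1 → β ∈ Set.Ioo (0 : ℝ) 1 →
        ∀ t : ℕ, 1 ≤ t → L₁ μ₁ ε β ≤ t →
          2 * Real.log t * EpsTS.invKL (1 - ε) μ₁ + 1 ≤ ((t : ℝ) - 1) ^ β) ∧
      -- `L₂ = L₂(b, ε)`
      (∀ β ε : ℝ, β ∈ Set.Ioo (0 : ℝ) 1 → 0 < ε → ε < 1 →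
        2 ≤ L₂ β ε ∧ ∀ t : ℕ, L₂ β ε ≤ t → ∀ μ₁ : ℝ, μ₁ - ε < EpsTS.eta ε β μ₁ t) ∧
      -- `x_{a,c} = x c μ₁ μ_a ε`
      (∀ c μ₁ μa ε : ℝ, 0 < c → 0 < ε → ε < 1 → 0 ≤ μa → μa < μ₁ - ε → μ₁ ≤ 1 - ε →
        x c μ₁ μa ε ∈ Set.Ioo μa (μ₁ - ε) ∧
        EpsTS.klBer (x c μ₁ μa ε / (1 - ε)) ((μ₁ - ε) / (1 - ε)) =
          EpsTS.klBer (μa / (1 - ε)) ((μ₁ - ε) / (1 - ε)) / ENNReal.ofReal (1 + c)) ∧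
      -- the regret bounds, for `K = m + 2` arms
      ∀ (m : ℕ) (ε : ℝ) (ν : Fin (m + 2) → MeasureTheory.Measure ℝ) (f : ℝ → ℝ),
        0 < ε → ε < 1 →
        (∀ a, MeasureTheory.IsProbabilityMeasure (ν a)) →
        (∀ a, ∀ᵐ r ∂(ν a), r ∈ Set.Icc (0 : ℝ) 1) →
        Antitone (EpsTS.armMean ν) →
        EpsTS.armMean ν 1 < EpsTS.armMean ν 0 - ε →
        EpsTS.IsGapFunction ε f →
        ∀ (Ω : Type*) [MeasurableSpace Ω] (P : MeasureTheory.Measure Ω)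
          [MeasureTheory.IsProbabilityMeasure P] (ξ : EpsTS.Seed (m + 2) → Ω → ℝ),
          EpsTS.IsSeed P ν ξ →
          (1 - ε < EpsTS.armMean ν 0 →
            ∀ T : ℕ, 1 ≤ T →
              EpsTS.lenientRegret P ν ξ ε f T ≤
                ∑ a ∈ Finset.univ.erase 0,
                  f (EpsTS.gap ν a) * EpsTS.invKL (1 - ε) (EpsTS.armMean ν a) +
                (⨆ a, f (EpsTS.gap ν a)) *
                  (C (m + 2) (EpsTS.armMean ν 0) (EpsTS.armMean ν 1) ε +
                    L₁ (EpsTS.armMean ν 0) ε (b (EpsTS.armMean ν 0) (EpsTS.armMean ν 1) ε) +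
                    Real.pi ^ 2 / 6 * EpsTS.invKL (1 - ε) (EpsTS.armMean ν 0))) ∧
          (EpsTS.armMean ν 0 ≤ 1 - ε →
            ∀ c : ℝ, 0 < c → ∀ T : ℕ, 1 ≤ T →
              EpsTS.lenientRegret P ν ξ ε f T ≤
                ∑ a ∈ Finset.univ.erase 0, f (EpsTS.gap ν a) *
                  ((1 + c) ^ 2 *
                      (⨆ t : Set.Icc 1 T, Real.log (t : ℕ) *
                        EpsTS.invKL (EpsTS.armMean ν a / (1 - ε))
                          (EpsTS.eta ε (b (EpsTS.armMean ν 0) (EpsTS.armMean ν 1) ε) (EpsTS.armMean ν 0) t / (1 - ε))) +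
                    2 + 1 / c +
                    EpsTS.invKL (x c (EpsTS.armMean ν 0) (EpsTS.armMean ν a) ε) (EpsTS.armMean ν a)) +
                (⨆ a, f (EpsTS.gap ν a)) *
                  (C (m + 2) (EpsTS.armMean ν 0) (EpsTS.armMean ν 1) ε +
                    L₂ (b (EpsTS.armMean ν 0) (EpsTS.armMean ν 1) ε) ε + 6)) := by
  choose! b hb C hC using fun μ₁ μ₂ ε => @EpsTS.exists_pullsBound.{u_1} μ₁ μ₂ ε
  choose! L₁ hL₁ using fun β => @EpsTS.exists_log_le_rpow β
  choose! L₂ hL₂ hη using fun β ε => @EpsTS.exists_lt_eta β ε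
  choose! x hx using fun c μ₁ μ ε => @EpsTS.exists_isThreshold c μ₁ μ ε
  refine ⟨b, fun K μ₁ μ₂ ε => K * C μ₁ μ₂ ε K, fun μ₁ ε β => L₁ β (EpsTS.invKL (1 - ε) μ₁), L₂, x,
    hb, fun μ₁ ε β _ _ _ _ hβ t _ ht => hL₁ β hβ.1 _ t (Nat.cast_le.1 ht),
    fun β ε hβ hε0 _ => ⟨hL₂ β ε hβ.1 hε0, hη β ε hβ.1 hε0⟩,
    fun c μ₁ μa ε hc hε0 _ hμa hμ hμ₁ => ?_,
    fun m ε ν f hε0 hε hprob hν hanti hgap hf Ω _ P _ ξ hξ => ?_⟩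
  · have threshold := hx c μ₁ μa ε hc hε0 hμa hμ hμ₁
    exact ⟨threshold.mem_Ioo, threshold.klBer_eq hc hε0 hμa hμ₁⟩
  have mean (a) : EpsTS.armMean ν a ∈ Set.Icc (0 : ℝ) 1 := EpsTS.armMean_mem_Icc (hν a)
  have bandit : EpsTS.IsBandit P ν ξ (EpsTS.armMean ν 0) (EpsTS.armMean ν 1) :=
    ⟨hξ, hprob, hν, rfl, fun a ha => hanti (Fin.one_le_of_ne_zero ha)⟩
  have bound := hC _ _ _ hε0 hε (mean 1).1 hgap (mean 0).2 (m + 2)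
  refine ⟨fun hμ₁ T _ => ?_, fun hμ₁ c hc T _ => ?_⟩
  · have := EpsTS.invKL_nonneg (1 - ε) (EpsTS.armMean ν 0)
    refine bound.lenientRegret_le_of_lt bandit hε0.le hgap hμ₁ hf ?_ T
    rw [add_assoc]
    exact le_add_of_nonneg_right (by positivity)
  · have := hL₂ _ ε (hb _ _ _ hε0 hε (mean 1).1 hgap (mean 0).2).1 hε0
    exact bound.lenientRegret_le_of_le bandit hε0.le hgap hμ₁ hf hc (fun a ha => hx c _ _ ε hc hε0
      (mean a).1 ((bandit.armMean_le a ha).trans_lt hgap) hμ₁) (by linarith) T
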